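/- A structured matrix $\bar M\in\{0,*\}^{a\times b}$ has fixed zero entries and free entries $*$; a realization assigns arbitrary independent real values to the $*$ entries, so the realizations form $\mathbb R^{n_{\bar M}}$, where $n_{\bar M}$ is the number of $*$ entries. The generic rank (grank) of a matrix depending on free real parameters is the maximum of its rank over all parameter values. $\bar A\in\{0,*\}^{n\times n}$ is generically diagonalizable if there is a proper algebraic variety $\mathbb V\subsetneq\mathbb R^{n_{\bar A}}$ such that every realization of $\bar A$ outside $\mathbb V$ is diagonalizable over $\mathbb C$. For $\bar B\in\{0,*\}^{n\times m}$, let $Q(A,B)=[B,AB,\dots,A^{n-1}B]$. Let $\mathcal G(\bar A,\bar B)$ be the digraph on $x_1,\dots,x_n,u_1,\dots,u_m$ with an edge $(x_i,x_j)$ whenever $\bar A_{ji}\neq0$ and an edge $(u_i,x_j)$ whenever $\bar B_{ji}\ne0$; a vertex $x_j$ is input-reachable if there is a path to it from some $u_i$. Let $\bar A_r$ be $\bar A$ with the rows and columns of all vertices $x_j$ that are not input-reachable replaced by zeros. For $\bar C\in\{0,*\}^{p\times n}$ let $\mathcal D(\bar A_r,\bar B,\bar C)$ be the digraph with vertex set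 $X^2\cup U^2\cup X^1\cup Y^0$, where $X^2=\{x_1^2,\dots,x_n^2\}$, $U^2=\{u_1,\dots,u_m\}$, $X^1=\{x_1^1,\dots,x_n^1\}$, $Y^0=\{y_1,\dots,y_p\}$, and with the edges $(x_i^2,x_j^1)$ for $[\bar A_r]_{ji}\neq0$, $(u_i,x_j^1)$ for $\bar B_{ji}\ne0$, and $(x_i^1,y_j)$ for $\bar C_{ji}\neq0$. A linking of size $l$ from $X^2\cup U^2$ to $Y^0$ is a collection of $l$ vertex-disjoint simple paths, each with its initial vertex in $X^2\cup U^2$ and its terminal vertex in $Y^0$. A triple $(A,B,C)$ of real matrices is output controllable if the system $\dot x=Ax+Bu$, $y=Cx$ can be steered, from any initial state (with any initial output $y(0)=y_0$), in some finite time $T$ and by some integrable control $u$ on $[0,T]$, to any prescribed final output $y(T)=y_f\in\mathbb R^p$; $(\bar A,\bar B,\bar C)$ is structurally output controllable (SOC) if some realization of it is output controllable. **Corollary.** Let $\bar A\in\{0,*\}^{n\times n}$ be generically diagonalizable. Then $$\operatorname{grank}[\bar A_r,\bar B]=\operatorname{grank}Q(\bar A,\bar B)\qquad\text{for all } m \text{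 and all }\bar B\in\{0,*\}^{n\times m}.$$ Consequently, for all $\bar B\in\{0,*\}^{n\times m}$ and $\bar C\in\{0,*\}^{p\times n}$, $(\bar A,\bar B,\bar C)$ is SOC if and only if there is a linking of size $p$ from $X^2\cup U^2$ to $Y^0$ in $\mathcal D(\bar A_r,\bar B,\bar C)$. Moreover, the existence of such a linking can be checked in polynomial time: there is one algorithm (a program of a unit-cost random access machine with addition and truncated subtraction as its only arithmetic) that, for all $n,m,p$ and all structured matrices $\bar A\in\{0,*\}^{n\times n}$, $\bar B\in\{0,*\}^{n\times m}$, $\bar C\in\{0,*\}^{p\times n}$, decides on input $(\bar A,\bar B,\bar C)$ whether a linking of size $p$ from $X^2\cup U^2$ to $Y^0$ in $\mathcal D(\bar A_r,\bar B,\bar C)$ exists, in a number of steps bounded by a polynomial in $n+m+p$. -/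

import Mathlib

/-! ### Structured matrices, realizations, genericity -/

/-- A structured matrix in `{0,*}^{ι × κ}`: `true` marks a free entry `*`, `false` a fixed zero. -/
abbrev StructMatrix (ι κ : Type) : Type := Matrix ι κ Bool

namespace StructMatrix

variable {ι κ : Type}

/-- The positions of the free entries `*`. -/
abbrev Pos (M : StructMatrix ι κ) : Type := {e : ι × κ // M e.1 e.2 = true}

/-- The parameter space `ℝ^{n_M}`, with one real coordinate for each free entry. -/
abbrev Param (M : StructMatrix ι κ) : Type := M.Pos → ℝ

/-- The realization of `M` given by a parameter vector. -/
def realize (M : StructMatrix ι κ) (θ : M.Param) : Matrix ι κ ℝ :=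
  Matrix.of fun i j => if h : M i j = true then θ ⟨(i, j), h⟩ else 0

end StructMatrix

/-- An algebraic variety in `ℝ^σ` (the common zero set of some polynomials) other than `ℝ^σ`. -/
def IsProperVariety {σ : Type} (V : Set (σ → ℝ)) : Prop :=
  (∃ S : Set (MvPolynomial σ ℝ), V = {x | ∀ f ∈ S, MvPolynomial.eval x f = 0}) ∧ V ≠ Set.univ

/-- The maximum rank that a parametrized family of matrices achieves. -/
noncomputable def genericRank {Θ ι κ : Type} [Fintype κ] (P : Θ → Matrix ι κ ℝ) : ℕ :=
  ⨆ θ, (P θ).rank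

/-- The generic rank of a structured matrix. -/
noncomputable def StructMatrix.grank {ι κ : Type} [Fintype κ] (M : StructMatrix ι κ) : ℕ :=
  genericRank M.realize

/-- A real square matrix is diagonalizable (over `ℂ`). -/
def IsDiagonalizable {n : ℕ} (A : Matrix (Fin n) (Fin n) ℝ) : Prop :=
  ∃ (P : Matrix (Fin n) (Fin n) ℂ) (d : Fin n → ℂ),
    IsUnit P.det ∧ A.map Complex.ofReal * P = P * Matrix.diagonal d

/-- Almost all realizations are diagonalizable. -/
def GenericallyDiagonalizable {n : ℕ} (A : StructMatrix (Fin n) (Fin n)) : Prop :=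
  ∃ V : Set A.Param, IsProperVariety V ∧ ∀ θ ∉ V, IsDiagonalizable (A.realize θ)

/-! ### Controllability matrix and output controllability -/

/-- The controllability matrix `Q(A,B) = [B, AB, …, A^{n-1}B]`; the column `(k, j)` is the `j`-th
column of `A ^ k * B`. -/
def ctrbMatrix {n m : ℕ} (A : Matrix (Fin n) (Fin n) ℝ) (B : Matrix (Fin n) (Fin m) ℝ) :
    Matrix (Fin n) (Fin n × Fin m) ℝ :=
  Matrix.of fun i c => (A ^ (c.1 : ℕ) * B) i c.2

/-- The generic rank of `Q(Ā,B̄)`, as a function of the free parameters of `Ā` and `B̄`. -/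
noncomputable def grankCtrb {n m : ℕ} (A : StructMatrix (Fin n) (Fin n))
    (B : StructMatrix (Fin n) (Fin m)) : ℕ :=
  genericRank fun θ : A.Param × B.Param => ctrbMatrix (A.realize θ.1) (B.realize θ.2)

open MeasureTheory in
/-- `x` is the state trajectory on `[0,T]` of `x' = A x + B u` for the (integrable) control `u`:
`x` is continuous and satisfies the integrated equation, so it is absolutely continuous and
satisfies the differential equation almost everywhere. -/
def IsTrajectory {n m : ℕ} (A : Matrix (Fin n) (Fin n) ℝ) (B : Matrix (Fin n) (Fin m) ℝ) (T : ℝ)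
    (u : ℝ → Fin m → ℝ) (x : ℝ → Fin n → ℝ) : Prop :=
  IntervalIntegrable u volume 0 T ∧ ContinuousOn x (Set.Icc 0 T) ∧
    ∀ t ∈ Set.Icc 0 T, x t = x 0 + ∫ s in (0 : ℝ)..t, (A.mulVec (x s) + B.mulVec (u s))

/-- Output controllability of `x' = A x + B u`, `y = C x`: a system that starts at an arbitrary
initial state, with initial output `y₀`, can be steered in finite time to any final output
`y₁`. -/
def OutputControllable {n m p : ℕ} (A : Matrix (Fin n) (Fin n) ℝ) (B : Matrix (Fin n) (Fin m) ℝ)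
    (C : Matrix (Fin p) (Fin n) ℝ) : Prop :=
  ∀ (y₀ y₁ : Fin p → ℝ) (x₀ : Fin n → ℝ), C.mulVec x₀ = y₀ →
    ∃ (T : ℝ) (u : ℝ → Fin m → ℝ) (x : ℝ → Fin n → ℝ),
      0 < T ∧ IsTrajectory A B T u x ∧ x 0 = x₀ ∧ C.mulVec (x T) = y₁

/-- Structural output controllability: some realization is output controllable. -/
def StructurallyOutputControllable {n m p : ℕ} (A : StructMatrix (Fin n) (Fin n))
    (B : StructMatrix (Fin n) (Fin m)) (C : StructMatrix (Fin p) (Fin n)) : Prop :=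
  ∃ (θA : A.Param) (θB : B.Param) (θC : C.Param),
    OutputControllable (A.realize θA) (B.realize θB) (C.realize θC)

/-! ### System digraph, input-reachability, linkings -/

/-- The digraph `𝒢(Ā,B̄)`: state vertices `inl i`, input vertices `inr k`, an edge
`x_i → x_j` if `Ā_{ji} ≠ 0` and an edge `u_k → x_j` if `B̄_{jk} ≠ 0`. -/
def systemDigraph {n m : ℕ} (A : StructMatrix (Fin n) (Fin n)) (B : StructMatrix (Fin n) (Fin m)) :
    Digraph (Fin n ⊕ Fin m) where
  Adj
    | Sum.inl i, Sum.inl j => A j i = true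
    | Sum.inr k, Sum.inl j => B j k = true
    | _, Sum.inr _ => False

/-- The state vertex `x_i` is reachable from some input vertex in `𝒢(Ā,B̄)`. -/
def InputReachable {n m : ℕ} (A : StructMatrix (Fin n) (Fin n)) (B : StructMatrix (Fin n) (Fin m))
    (i : Fin n) : Prop :=
  ∃ k : Fin m, Relation.ReflTransGen (systemDigraph A B).Adj (Sum.inr k) (Sum.inl i)

open Classical in
/-- `Ā_r`: the rows and columns of `Ā` at the input-unreachable state vertices are replaced by
zeros. -/
noncomputable def reachablePart {n m : ℕ} (A : StructMatrix (Fin n) (Fin n))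
    (B : StructMatrix (Fin n) (Fin m)) : StructMatrix (Fin n) (Fin n) :=
  Matrix.of fun i j =>
    if InputReachable A B i ∧ InputReachable A B j then A i j else false

/-- The vertices `X² ∪ U² ∪ X¹ ∪ Y⁰` of the layered digraph. -/
inductive LayerVertex (n m p : ℕ) : Type
  | x2 (i : Fin n)
  | u2 (k : Fin m)
  | x1 (i : Fin n)
  | y0 (j : Fin p)

namespace LayerVertex

/-- Membership in `X² ∪ U²`. -/
def IsSource {n m p : ℕ} : LayerVertex n m p → Prop
  | x2 _ => True
  | u2 _ => True
  | _ => False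

/-- Membership in `Y⁰`. -/
def IsSink {n m p : ℕ} : LayerVertex n m p → Prop
  | y0 _ => True
  | _ => False

end LayerVertex

/-- The layered digraph `𝒟(M,B̄,C̄)`, which is used with `M = Ā_r`. -/
def layeredDigraph {n m p : ℕ} (M : StructMatrix (Fin n) (Fin n)) (B : StructMatrix (Fin n) (Fin m))
    (C : StructMatrix (Fin p) (Fin n)) : Digraph (LayerVertex n m p) where
  Adj
    | .x2 i, .x1 j => M j i = true
    | .u2 k, .x1 j => B j k = true
    | .x1 i, .y0 j => C j i = true
    | _, _ => False

/-- `l` is the vertex sequence of a simple path of `G` from a vertex in `S` to a vertex in `T`. -/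
def IsSimplePath {V : Type} (G : Digraph V) (S T : V → Prop) (l : List V) : Prop :=
  l.IsChain G.Adj ∧ l.Nodup ∧ (∃ v, l.head? = some v ∧ S v) ∧ (∃ w, l.getLast? = some w ∧ T w)

/-- There are `k` pairwise vertex-disjoint simple paths of `G` from `S` to `T`. -/
def HasLinking {V : Type} (G : Digraph V) (S T : V → Prop) (k : ℕ) : Prop :=
  ∃ P : Fin k → List V, (∀ a, IsSimplePath G S T (P a)) ∧
    ∀ a b, a ≠ b → List.Disjoint (P a) (P b)

/-- There is a linking of size `p` from `X² ∪ U²` to `Y⁰` in `𝒟(Ā_r,B̄,C̄)`. -/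
def HasFullLinking {n m p : ℕ} (A : StructMatrix (Fin n) (Fin n)) (B : StructMatrix (Fin n) (Fin m))
    (C : StructMatrix (Fin p) (Fin n)) : Prop :=
  HasLinking (layeredDigraph (reachablePart A B) B C) LayerVertex.IsSource LayerVertex.IsSink p

/-! ### Random access machines with unit cost, and polynomial time

The machine has registers, which are addressed directly, and arrays, which are addressed through
registers; all cells hold natural numbers. Its arithmetic is addition and truncated subtraction
only. Hence numbers computed in `t` steps have `O(t)` more bits than the input and polynomial time
on this machine is polynomial time on a Turing machine. -/

/-- Structured programs of the random access machine. -/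
inductive RamProgram : Type
  /-- `reg r := c` -/
  | const (r c : ℕ)
  /-- `reg r := reg s` -/
  | copy (r s : ℕ)
  /-- `reg r := reg s + reg t` -/
  | plus (r s t : ℕ)
  /-- `reg r := reg s - reg t`, truncated at zero -/
  | minus (r s t : ℕ)
  /-- `reg r := arr a [reg s]` -/
  | load (r a s : ℕ)
  /-- `arr a [reg r] := reg s` -/
  | store (a r s : ℕ)
  /-- first `P`, then `Q` -/
  | seq (P Q : RamProgram)
  /-- `P` if `reg r ≠ 0`, otherwise `Q` -/
  | branch (r : ℕ) (P Q : RamProgram)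
  /-- repeat `P` as long as `reg r ≠ 0` -/
  | loop (r : ℕ) (P : RamProgram)

/-- The contents of the registers and of the arrays. -/
structure RamState : Type where
  reg : ℕ → ℕ
  arr : ℕ → ℕ → ℕ

namespace RamState

/-- Write `v` into register `r`. -/
def setReg (s : RamState) (r v : ℕ) : RamState :=
  { s with reg := Function.update s.reg r v }

/-- Write `v` into the cell `k` of array `a`. -/
def setArr (s : RamState) (a k v : ℕ) : RamState :=
  { s with arr := Function.update s.arr a (Function.update (s.arr a) k v) }

end RamState

/-- `RamRuns P s t s'`: started in `s`, the program `P` halts in `s'` after exactly `t` steps. Each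
elementary instruction and each test is one step. -/
inductive RamRuns : RamProgram → RamState → ℕ → RamState → Prop
  | const (s : RamState) (r c : ℕ) : RamRuns (.const r c) s 1 (s.setReg r c)
  | copy (s : RamState) (r a : ℕ) : RamRuns (.copy r a) s 1 (s.setReg r (s.reg a))
  | plus (s : RamState) (r a b : ℕ) :
      RamRuns (.plus r a b) s 1 (s.setReg r (s.reg a + s.reg b))
  | minus (s : RamState) (r a b : ℕ) :
      RamRuns (.minus r a b) s 1 (s.setReg r (s.reg a - s.reg b))
  | load (s : RamState) (r a b : ℕ) :
      RamRuns (.load r a b) s 1 (s.setReg r (s.arr a (s.reg b)))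
  | store (s : RamState) (a r b : ℕ) :
      RamRuns (.store a r b) s 1 (s.setArr a (s.reg r) (s.reg b))
  | seq {P Q : RamProgram} {s s' s'' : RamState} {t t' : ℕ} :
      RamRuns P s t s' → RamRuns Q s' t' s'' → RamRuns (.seq P Q) s (t + t') s''
  | branch_pos {r : ℕ} {P Q : RamProgram} {s s' : RamState} {t : ℕ} :
      s.reg r ≠ 0 → RamRuns P s t s' → RamRuns (.branch r P Q) s (t + 1) s'
  | branch_zero {r : ℕ} {P Q : RamProgram} {s s' : RamState} {t : ℕ} :
      s.reg r = 0 → RamRuns Q s t s' → RamRuns (.branch r P Q) s (t + 1) s'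
  | loop_stop {r : ℕ} {P : RamProgram} {s : RamState} :
      s.reg r = 0 → RamRuns (.loop r P) s 1 s
  | loop_step {r : ℕ} {P : RamProgram} {s s' s'' : RamState} {t t' : ℕ} :
      s.reg r ≠ 0 → RamRuns P s t s' → RamRuns (.loop r P) s' t' s'' →
        RamRuns (.loop r P) s (t + t' + 1) s''

/-- The row-major array of the entries of a structured matrix (`1` for `*`, `0` for `0`): the
entry `(i, j)` stands at the address `i * b + j`, and the rest of the array is zero. -/
def encodeStruct {a b : ℕ} (M : StructMatrix (Fin a) (Fin b)) : ℕ → ℕ := fun k =>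
  if h : k < a * b then
    (M (finProdFinEquiv.symm ⟨k, h⟩).1 (finProdFinEquiv.symm ⟨k, h⟩).2).toNat
  else 0

/-- The initial state on the input `(Ā,B̄,C̄)`: `n`, `m`, `p` in the registers `0`, `1`, `2`, the
three matrices in the arrays `0`, `1`, `2`, and zeros elsewhere. -/
def ramInput {n m p : ℕ} (A : StructMatrix (Fin n) (Fin n)) (B : StructMatrix (Fin n) (Fin m))
    (C : StructMatrix (Fin p) (Fin n)) : RamState where
  reg
    | 0 => n
    | 1 => m
    | 2 => p
    | _ => 0
  arr
    | 0 => encodeStruct A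
    | 1 => encodeStruct B
    | 2 => encodeStruct C
    | _ => fun _ => 0

/-- One program decides the property `L` of structured triples, with the answer `1` (yes) or `0`
(no) in register `0`, in a number of steps that is polynomial in `n + m + p`. -/
def DecidableInPolyTime
    (L : ∀ {n m p : ℕ}, StructMatrix (Fin n) (Fin n) → StructMatrix (Fin n) (Fin m) →
      StructMatrix (Fin p) (Fin n) → Prop) : Prop :=
  ∃ (P : RamProgram) (q : Polynomial ℕ), ∀ (n m p : ℕ) (A : StructMatrix (Fin n) (Fin n))
    (B : StructMatrix (Fin n) (Fin m)) (C : StructMatrix (Fin p) (Fin n)),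
    ∃ (t : ℕ) (s : RamState), RamRuns P (ramInput A B C) t s ∧ t ≤ q.eval (n + m + p) ∧
      ((L A B C ∧ s.reg 0 = 1) ∨ (¬ L A B C ∧ s.reg 0 = 0))

/-! ### Properties that hold outside a proper hypersurface -/

/-! The columns of `B`, `A B`, … live on the input-reachable states, so `Q(A,B)` depends on `A` only
through `A_r` (`ctrbMatrix_realize_eq`). If `w A_r = 0` and `w B = 0`, then `w Q = 0`; this gives
one inequality of ranks at every parameter. The heart of the matter is the generic converse
`holdsGenerically_left_kernel`: `w Q = 0` forces `w A_r = 0`.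

Diagonalizability enters only through `ker A ^ 2 = ker A`. The matrix `A_r` inherits this, so `A_r`
and `A_r ^ n` have the same rank, and it suffices to prove `w A_r ^ n = 0`. This says that
generically all nonzero modes of `A_r` are controllable, or `rank (A_r ^ n) = rank (A_r ^ n Q)`. The
rank on the right is lower semicontinuous in the Zariski sense, so one realization suffices in which
it reaches the maximum of `rank (A_r ^ n)` over all realizations (`exists_realization_rank_pow_le`).
That maximum is at most the number of vertices covered by some family of disjoint cycles, read off
from a Leibniz term of the characteristic polynomial. The realization gives these cycles distinct
positive weights and joins them to the inputs by a spanning forest of the contracted cycles. Forest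
edges leave the characteristic polynomial alone. A left eigenvector with nonzero eigenvalue singles
out one cycle by the modulus of the eigenvalue, and its support descends along the unique forest
path to an input that sees it (`IsCycleForest.eq_zero_of_eigenvector`).

Output controllability is full row rank of `C Q` (`outputControllable_iff`), by a Gramian argument.
By the agreement of left kernels, `Q` may be replaced by `[A_r, B]`. Full row rank of `C [A_r, B]`
yields two compatible matchings by expanding determinants, and 0/1 realizations give the converse;
the compatible matchings are the linkings, because every path has exactly three vertices
(`exists_rank_output_eq_iff`).

For the algorithm, a linking is turned into a bipartite matching that saturates all rows
(`hasRowMatching_linkingAdj_iff`). An auction finds such a matching: a potential increases at every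
step until all rows are matched, and it is bounded by a polynomial if a matching exists. The auction
is written in a small language of bounded loops whose compilation to the machine comes with a
polynomial bound of the cost. -/

section Generic

variable {σ : Type}

/-- `Q` holds at every point where some nonzero polynomial does not vanish. -/
def HoldsGenerically (Q : (σ → ℝ) → Prop) : Prop :=
  ∃ p : MvPolynomial σ ℝ, p ≠ 0 ∧ ∀ x, MvPolynomial.eval x p ≠ 0 → Q x

theorem HoldsGenerically.mono {Q Q' : (σ → ℝ) → Prop} (h : HoldsGenerically Q)
    (hQ : ∀ x, Q x → Q' x) : HoldsGenerically Q' := by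
  obtain ⟨p, hp, hpQ⟩ := h
  exact ⟨p, hp, fun x hx => hQ x (hpQ x hx)⟩

theorem HoldsGenerically.and {Q Q' : (σ → ℝ) → Prop} (h : HoldsGenerically Q)
    (h' : HoldsGenerically Q') : HoldsGenerically fun x => Q x ∧ Q' x := by
  obtain ⟨p, hp, hpQ⟩ := h
  obtain ⟨p', hp', hpQ'⟩ := h'
  refine ⟨p * p', mul_ne_zero hp hp', fun x hx => ?_⟩
  rw [map_mul] at hx
  exact ⟨hpQ x (left_ne_zero_of_mul hx), hpQ' x (right_ne_zero_of_mul hx)⟩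

/-- The field `ℝ` is infinite, so a nonzero polynomial is not the zero function. -/
theorem HoldsGenerically.exists {Q : (σ → ℝ) → Prop} (h : HoldsGenerically Q) : ∃ x, Q x := by
  obtain ⟨p, hp, hpQ⟩ := h
  by_contra! hc
  refine hp (MvPolynomial.funext fun x => ?_)
  by_contra hx
  exact hc x (hpQ x (by simpa using hx))

/-- A property that holds generically in some of the coordinates holds generically. -/
theorem HoldsGenerically.comp {τ : Type} {Q : (σ → ℝ) → Prop} (h : HoldsGenerically Q)
    (f : σ → τ) (hf : Function.Injective f) :
    HoldsGenerically fun x : τ → ℝ => Q (x ∘ f) := by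
  obtain ⟨p, hp, hpQ⟩ := h
  refine ⟨MvPolynomial.rename f p, ?_, fun x hx => hpQ _ ?_⟩
  · exact fun h0 => hp (MvPolynomial.rename_injective f hf (by simpa using h0))
  · rwa [MvPolynomial.eval_rename] at hx

theorem IsProperVariety.holdsGenerically {V : Set (σ → ℝ)} (hV : IsProperVariety V) :
    HoldsGenerically fun x => x ∉ V := by
  obtain ⟨⟨S, rfl⟩, hne⟩ := hV
  obtain ⟨x, hx⟩ := (Set.ne_univ_iff_exists_notMem _).1 hne
  simp only [Set.mem_ofPred_eq, not_forall] at hx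
  obtain ⟨f, hf, hfx⟩ := hx
  refine ⟨f, fun h0 => hfx (by simp [h0]), fun y hy hyV => hy (hyV f hf)⟩

/-- A matrix of rank `r` has an invertible two-sided compression of size `r`. -/
theorem Matrix.exists_mul_mul_eq_one {a κ : Type} [Fintype a] [DecidableEq a] [Fintype κ]
    [DecidableEq κ] (M : Matrix a κ ℝ) :
    ∃ (L : Matrix (Fin M.rank) a ℝ) (R : Matrix κ (Fin M.rank) ℝ), L * M * R = 1 := by
  let f := Matrix.toLin' M
  have hr : Module.finrank ℝ (LinearMap.range f) = M.rank := by
    rfl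
  -- `L` extends a coordinate isomorphism of the range to the whole space, and `R` is a section of
  -- the resulting surjection.
  let e : LinearMap.range f ≃ₗ[ℝ] (Fin M.rank → ℝ) :=
    LinearEquiv.ofFinrankEq _ _ (by simp [hr])
  obtain ⟨l, hl⟩ := LinearMap.exists_extend e.toLinearMap
  have hs : LinearMap.range (e.toLinearMap ∘ₗ f.rangeRestrict) = ⊤ := by
    rw [LinearMap.range_comp, LinearMap.range_rangeRestrict, Submodule.map_top, LinearEquiv.range]
  obtain ⟨g, hg⟩ := LinearMap.exists_rightInverse_of_surjective _ hs
  have hlf : l ∘ₗ f = e.toLinearMap ∘ₗ f.rangeRestrict := by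
    rw [← hl]; rfl
  refine ⟨LinearMap.toMatrix' l, LinearMap.toMatrix' g, ?_⟩
  have : LinearMap.toMatrix' (l ∘ₗ f ∘ₗ g) = 1 := by
    rw [← LinearMap.comp_assoc, hlf, hg, LinearMap.toMatrix'_id]
  rw [LinearMap.toMatrix'_comp, LinearMap.toMatrix'_comp, LinearMap.toMatrix'_toLin'] at this
  rw [Matrix.mul_assoc, this]

/-- The rank of a polynomial matrix at a point is a lower bound for its rank at a generic point. -/
theorem holdsGenerically_rank_le {a κ : Type} [Fintype a] [Fintype κ]
    (P : Matrix a κ (MvPolynomial σ ℝ)) (x₀ : σ → ℝ) :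
    HoldsGenerically fun x =>
      (P.map (MvPolynomial.eval x₀)).rank ≤ (P.map (MvPolynomial.eval x)).rank := by
  classical
  obtain ⟨L, R, hLR⟩ := (P.map (MvPolynomial.eval x₀)).exists_mul_mul_eq_one
  let c : ℝ →+* MvPolynomial σ ℝ := MvPolynomial.C
  have key : ∀ x, MvPolynomial.eval x (L.map c * P * R.map c).det
      = (L * P.map (MvPolynomial.eval x) * R).det := by
    intro x
    rw [RingHom.map_det, RingHom.mapMatrix_apply, Matrix.map_mul, Matrix.map_mul]
    congr 3 <;> ext i j <;> simp [c]
  -- With `L` and `R` frozen at `x₀`, the determinant of the compression is a polynomial that equals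
  -- `1` at `x₀`; wherever it is nonzero, the rank is at least the size of the compression.
  refine ⟨(L.map c * P * R.map c).det, fun h0 => ?_, fun x hx => ?_⟩
  · have := key x₀
    rw [h0, hLR] at this
    simp at this
  · rw [key] at hx
    have h1 := Matrix.rank_of_isUnit _
      ((Matrix.isUnit_iff_isUnit_det _).2 (isUnit_iff_ne_zero.2 hx))
    rw [Fintype.card_fin] at h1
    calc _ = (L * P.map (MvPolynomial.eval x) * R).rank := h1.symm
      _ ≤ (L * P.map (MvPolynomial.eval x)).rank := Matrix.rank_mul_le_left _ _
      _ ≤ _ := Matrix.rank_mul_le_right _ _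

/-- Matrices that depend polynomially on parameters. -/
def IsPolyMatrix {a κ : Type} (F : (σ → ℝ) → Matrix a κ ℝ) : Prop :=
  ∃ P : Matrix a κ (MvPolynomial σ ℝ), ∀ x, F x = P.map (MvPolynomial.eval x)

theorem IsPolyMatrix.holdsGenerically_rank_le {a κ : Type} [Fintype a] [Fintype κ]
    {F : (σ → ℝ) → Matrix a κ ℝ} (hF : IsPolyMatrix F) (x₀ : σ → ℝ) :
    HoldsGenerically fun x => (F x₀).rank ≤ (F x).rank := by
  obtain ⟨P, hP⟩ := hF
  simp only [hP]
  exact _root_.holdsGenerically_rank_le P x₀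

theorem IsPolyMatrix.mul {a κ ι : Type} [Fintype κ] {F : (σ → ℝ) → Matrix a κ ℝ}
    {G : (σ → ℝ) → Matrix κ ι ℝ} (hF : IsPolyMatrix F) (hG : IsPolyMatrix G) :
    IsPolyMatrix fun x => F x * G x := by
  obtain ⟨P, hP⟩ := hF
  obtain ⟨P', hP'⟩ := hG
  exact ⟨P * P', fun x => by simp only [hP, hP', Matrix.map_mul]⟩

theorem IsPolyMatrix.const {a κ : Type} (M : Matrix a κ ℝ) :
    IsPolyMatrix fun _ : σ → ℝ => M :=
  ⟨M.map MvPolynomial.C, fun x => by ext; simp⟩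

theorem IsPolyMatrix.pow {a : Type} [Fintype a] [DecidableEq a] {F : (σ → ℝ) → Matrix a a ℝ}
    (hF : IsPolyMatrix F) (k : ℕ) : IsPolyMatrix fun x => F x ^ k := by
  induction k with
  | zero => simpa using IsPolyMatrix.const 1
  | succ k ih => simpa only [pow_succ] using ih.mul hF

theorem IsPolyMatrix.ofEntries {a κ : Type} {F : (σ → ℝ) → Matrix a κ ℝ}
    (h : ∀ i j, ∃ p : MvPolynomial σ ℝ, ∀ x, F x i j = MvPolynomial.eval x p) :
    IsPolyMatrix F := by
  choose p hp using h
  exact ⟨Matrix.of p, fun x => by ext i j; simp [hp]⟩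

theorem IsPolyMatrix.entry {a κ : Type} {F : (σ → ℝ) → Matrix a κ ℝ} (hF : IsPolyMatrix F)
    (i : a) (j : κ) : ∃ p : MvPolynomial σ ℝ, ∀ x, F x i j = MvPolynomial.eval x p := by
  obtain ⟨P, hP⟩ := hF
  exact ⟨P i j, fun x => by rw [hP]; rfl⟩

theorem IsPolyMatrix.fromCols {a κ ι : Type} {F : (σ → ℝ) → Matrix a κ ℝ}
    {G : (σ → ℝ) → Matrix a ι ℝ} (hF : IsPolyMatrix F) (hG : IsPolyMatrix G) :
    IsPolyMatrix fun x => Matrix.fromCols (F x) (G x) := by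
  refine IsPolyMatrix.ofEntries fun i j => ?_
  rcases j with j | j
  · simpa using hF.entry i j
  · simpa using hG.entry i j

theorem IsPolyMatrix.ctrbMatrix {n m : ℕ} {F : (σ → ℝ) → Matrix (Fin n) (Fin n) ℝ}
    {G : (σ → ℝ) → Matrix (Fin n) (Fin m) ℝ} (hF : IsPolyMatrix F) (hG : IsPolyMatrix G) :
    IsPolyMatrix fun x => ctrbMatrix (F x) (G x) :=
  IsPolyMatrix.ofEntries fun i c => ((hF.pow c.1).mul hG).entry i c.2

/-- The map `f` selects coordinates, so that realizations of several patterns can share one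
parameter vector. -/
theorem StructMatrix.isPolyMatrix_realize {ι κ : Type} (M : StructMatrix ι κ) (f : M.Pos → σ) :
    IsPolyMatrix fun x : σ → ℝ => M.realize (x ∘ f) := by
  refine IsPolyMatrix.ofEntries fun i j => ?_
  by_cases h : M i j = true
  · exact ⟨MvPolynomial.X (f ⟨(i, j), h⟩), fun x => by simp [StructMatrix.realize, h]⟩
  · exact ⟨0, fun x => by simp [StructMatrix.realize, h]⟩

end Generic

/-! ### Realizations -/

/-- The matrices with zeros at the fixed zeros of `M` are the realizations of `M`. -/
theorem StructMatrix.exists_realize_eq {ι κ : Type} (M : StructMatrix ι κ) (N : Matrix ι κ ℝ)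
    (h : ∀ i j, M i j = false → N i j = 0) : ∃ θ, M.realize θ = N := by
  refine ⟨fun e => N e.1.1 e.1.2, ?_⟩
  ext i j
  by_cases hM : M i j = true
  · simp [StructMatrix.realize, hM]
  · simp [StructMatrix.realize, hM, h i j (by simpa using hM)]

theorem StructMatrix.realize_eq_zero {ι κ : Type} (M : StructMatrix ι κ) (θ : M.Param) {i : ι}
    {j : κ} (h : M i j = false) : M.realize θ i j = 0 := by
  simp [StructMatrix.realize, h]

theorem bddAbove_range_rank {Θ ι κ : Type} [Fintype κ] (P : Θ → Matrix ι κ ℝ) :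
    BddAbove (Set.range fun θ => (P θ).rank) :=
  ⟨Fintype.card κ, by rintro _ ⟨θ, rfl⟩; exact Matrix.rank_le_card_width _⟩

theorem rank_le_genericRank {Θ ι κ : Type} [Fintype κ] (P : Θ → Matrix ι κ ℝ) (θ : Θ) :
    (P θ).rank ≤ genericRank P :=
  le_ciSup (bddAbove_range_rank P) θ

theorem exists_rank_eq_genericRank {Θ ι κ : Type} [Nonempty Θ] [Fintype κ]
    (P : Θ → Matrix ι κ ℝ) : ∃ θ, (P θ).rank = genericRank P :=
  Nat.sSup_mem (Set.range_nonempty _) (bddAbove_range_rank P)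

/-! ### Rank of high powers and cycle covers -/

/-- The kernel of `A ^ n` is the generalized eigenspace of `0`, whose dimension is the multiplicity
of `0` as a root of the characteristic polynomial. -/
theorem Matrix.rank_pow_add_natTrailingDegree {K : Type} [Field K] {n : ℕ}
    (A : Matrix (Fin n) (Fin n) K) : (A ^ n).rank + A.charpoly.natTrailingDegree = n := by
  have h1 := LinearMap.finrank_maxGenEigenspace_zero_eq (Matrix.toLin' A)
  rw [Matrix.charpoly_toLin', Module.End.maxGenEigenspace_eq_genEigenspace_finrank,
    Module.End.genEigenspace_nat, zero_smul, sub_zero, Module.finrank_fin_fun] at h1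
  have h2 := LinearMap.finrank_range_add_finrank_ker (Matrix.toLin' A ^ n)
  rw [h1, ← Matrix.toLin'_pow, Module.finrank_fin_fun] at h2
  exact h2

/-- The kernels of the powers of the transpose stabilize at the latest at exponent `n`, so large
exponents can be lowered to `n`. -/
theorem Matrix.ker_pow_le {K : Type} [Field K] {n : ℕ} (A : Matrix (Fin n) (Fin n) K) {k : ℕ}
    {v : Fin n → K} (hv : Matrix.vecMul v (A ^ k) = 0) : Matrix.vecMul v (A ^ n) = 0 := by
  have h := Module.End.ker_pow_le_ker_pow_finrank (f := Matrix.toLin' A.transpose) k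
  have hv' : v ∈ LinearMap.ker (Matrix.toLin' A.transpose ^ k) := by
    rw [LinearMap.mem_ker, ← Matrix.toLin'_pow, Matrix.toLin'_apply, ← Matrix.transpose_pow,
      Matrix.mulVec_transpose, hv]
  have := h hv'
  rwa [LinearMap.mem_ker, ← Matrix.toLin'_pow, Matrix.toLin'_apply, ← Matrix.transpose_pow,
      Matrix.mulVec_transpose, Module.finrank_fin_fun] at this

/-- The vertices at which a permutation follows the free entries of `M`. -/
def StructMatrix.support {n : ℕ} (M : StructMatrix (Fin n) (Fin n)) (σ : Equiv.Perm (Fin n)) :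
    Finset (Fin n) :=
  Finset.univ.filter fun j => M (σ j) j = true

open Polynomial in
/-- The rank of a high power of a realization is bounded by the size of a family of disjoint
cycles. -/
theorem StructMatrix.exists_perm_rank_pow_le {n : ℕ} (M : StructMatrix (Fin n) (Fin n))
    (θ : M.Param) : ∃ σ : Equiv.Perm (Fin n), (∀ j, M (σ j) j = false → σ j = j) ∧
      (M.realize θ ^ n).rank ≤ (M.support σ).card := by
  classical
  set A := M.realize θ with hA
  have h1 := A.rank_pow_add_natTrailingDegree
  set t := A.charpoly.natTrailingDegree with ht
  have hc : A.charpoly.coeff t ≠ 0 :=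
    Polynomial.trailingCoeff_nonzero_iff_nonzero.2 A.charpoly_monic.ne_zero
  -- Some permutation contributes to the lowest nonzero coefficient; it can move a vertex only along
  -- a free entry, since otherwise a factor of its term is zero.
  rw [Matrix.charpoly, Matrix.det_apply', Polynomial.finsetSum_coeff] at hc
  obtain ⟨σ, -, hσ⟩ := Finset.exists_ne_zero_of_sum_ne_zero hc
  have hσ' : (∏ i, A.charmatrix (σ i) i).coeff t ≠ 0 := by
    intro h0
    apply hσ
    have : ((Equiv.Perm.sign σ : ℤ) : ℝ[X]) = C ((Equiv.Perm.sign σ : ℤ) : ℝ) := by simp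
    rw [this, Polynomial.coeff_C_mul, h0, mul_zero]
  have hfix : ∀ j, M (σ j) j = false → σ j = j := by
    intro j hj
    by_contra hne
    apply hσ'
    rw [Finset.prod_eq_zero (Finset.mem_univ j), coeff_zero]
    rw [Matrix.charmatrix_apply_ne _ _ _ hne, hA, M.realize_eq_zero θ hj, map_zero, neg_zero]
  refine ⟨σ, hfix, ?_⟩
  -- Every vertex outside the support is a fixed point with zero diagonal entry and contributes the
  -- factor `X`, so at most `t` vertices are left out.
  have hdvd : (X : ℝ[X]) ^ (M.support σ)ᶜ.card ∣ ∏ i, A.charmatrix (σ i) i := by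
    rw [← Finset.prod_const, ← Finset.prod_mul_prod_compl (M.support σ)]
    refine Dvd.dvd.mul_left (Finset.prod_dvd_prod_of_dvd _ _ fun j hj => ?_) _
    have hj' : M (σ j) j = false := by simpa [StructMatrix.support] using hj
    have hjj := hfix j hj'
    rw [hjj] at hj' ⊢
    rw [Matrix.charmatrix_apply_eq, hA, M.realize_eq_zero θ hj', map_zero, sub_zero]
  rw [X_pow_dvd_iff] at hdvd
  have : (M.support σ)ᶜ.card ≤ t := by
    by_contra! hlt
    exact hσ' (hdvd t hlt)
  rw [Finset.card_compl, Fintype.card_fin] at this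
  omega

/-! ### A spanning forest of the contracted cycles -/

section Forest

variable {n m : ℕ} (M : StructMatrix (Fin n) (Fin n)) (B : StructMatrix (Fin n) (Fin m))
  (σ : Equiv.Perm (Fin n))

/-- The states that are reached from the inputs by `k + 1` edges and arbitrary jumps within the
cycles of `σ`. -/
def cycleLayer : ℕ → Set (Fin n)
  | 0 => {j | ∃ i k, σ.SameCycle j i ∧ B i k = true}
  | l + 1 => {j | ∃ i j', σ.SameCycle j i ∧ j' ∈ cycleLayer l ∧ M i j' = true}

theorem mem_cycleLayer_congr {l : ℕ} {i j : Fin n} (h : σ.SameCycle i j)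
    (hi : i ∈ cycleLayer M B σ l) : j ∈ cycleLayer M B σ l := by
  cases l with
  | zero =>
    obtain ⟨i', k, hi', hk⟩ := hi
    exact ⟨i', k, h.symm.trans hi', hk⟩
  | succ l =>
    obtain ⟨i', j', hi', hk⟩ := hi
    exact ⟨i', j', h.symm.trans hi', hk⟩

/-- Levels, entry vertices and parents of the cycles of `σ` in a breadth-first spanning forest. -/
theorem exists_cycleForest :
    ∃ (d : Fin n → ℕ) (ent : Fin n → Fin n) (par : Fin n → Fin n ⊕ Fin m),
      (∀ i j, σ.SameCycle i j → d i = d j ∧ ent i = ent j ∧ par i = par j) ∧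
      ∀ j, (∃ l, j ∈ cycleLayer M B σ l) → σ.SameCycle j (ent j) ∧
        ((∃ k, par j = Sum.inr k ∧ B (ent j) k = true ∧ d j = 0) ∨
          ∃ j', par j = Sum.inl j' ∧ M (ent j) j' = true ∧ d j = d j' + 1 ∧
            ∃ l, j' ∈ cycleLayer M B σ l) := by
  classical
  -- An unreached state gets the level `sInf ∅ = 0`; apart from constancy on cycles, nothing is
  -- claimed about such states.
  let d : Fin n → ℕ := fun j => sInf {l | j ∈ cycleLayer M B σ l}
  have hd : ∀ i j, σ.SameCycle i j → d i = d j := by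
    intro i j h
    have : {l | i ∈ cycleLayer M B σ l} = {l | j ∈ cycleLayer M B σ l} :=
      Set.ext fun l => ⟨mem_cycleLayer_congr M B σ h, mem_cycleLayer_congr M B σ h.symm⟩
    simp only [d, this]
  have key : ∀ j, ∃ e : Fin n × (Fin n ⊕ Fin m), (∃ l, j ∈ cycleLayer M B σ l) →
      σ.SameCycle j e.1 ∧ ((∃ k, e.2 = Sum.inr k ∧ B e.1 k = true ∧ d j = 0) ∨
          ∃ j', e.2 = Sum.inl j' ∧ M e.1 j' = true ∧ d j = d j' + 1 ∧
            ∃ l, j' ∈ cycleLayer M B σ l) := by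
    intro j
    by_cases hj : ∃ l, j ∈ cycleLayer M B σ l
    · have hmem : j ∈ cycleLayer M B σ (d j) := Nat.sInf_mem hj
      rcases hdj : d j with - | l
      · rw [hdj] at hmem
        obtain ⟨i, k, hi, hk⟩ := hmem
        exact ⟨(i, Sum.inr k), fun _ => ⟨hi, Or.inl ⟨k, rfl, hk, rfl⟩⟩⟩
      · rw [hdj] at hmem
        obtain ⟨i, j', hi, hj', hk⟩ := hmem
        refine ⟨(i, Sum.inl j'), fun _ => ⟨hi, Or.inr ⟨j', rfl, hk, ?_, l, hj'⟩⟩⟩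
        -- The parent lies in layer `l`, and it cannot have a smaller level, because `j` would then
        -- lie in an earlier layer.
        have h1 : d j' ≤ l := Nat.sInf_le hj'
        have h2 : j' ∈ cycleLayer M B σ (d j') :=
          Nat.sInf_mem (s := {l | j' ∈ cycleLayer M B σ l}) ⟨l, hj'⟩
        have h3 : d j ≤ d j' + 1 := Nat.sInf_le ⟨i, j', hi, h2, hk⟩
        omega
    · exact ⟨(j, Sum.inl j), fun h => absurd h hj⟩
  choose e he using key
  -- Entry and parent are chosen at one representative of each cycle, which makes them constant on
  -- cycles.
  let rep : Fin n → Fin n := fun j => (Quotient.mk (Equiv.Perm.SameCycle.setoid σ) j).out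
  have hrep : ∀ j, σ.SameCycle j (rep j) := fun j =>
    Equiv.Perm.SameCycle.symm (Quotient.mk_out (s := Equiv.Perm.SameCycle.setoid σ) j)
  have hrep' : ∀ i j, σ.SameCycle i j → rep i = rep j := fun i j h =>
    congrArg Quotient.out (Quotient.sound (s := Equiv.Perm.SameCycle.setoid σ) h)
  refine ⟨d, fun j => (e (rep j)).1, fun j => (e (rep j)).2, fun i j h =>
    ⟨hd i j h, congrArg (fun r => (e r).1) (hrep' i j h), congrArg (fun r => (e r).2) (hrep' i j h)⟩, fun j ⟨l, hl⟩ => ?_⟩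
  have h := he (rep j) ⟨l, mem_cycleLayer_congr M B σ (hrep j) hl⟩
  rw [← hd _ _ (hrep j)] at h
  exact ⟨(hrep j).trans h.1, h.2⟩

/-- The states that are reached from the inputs within `M` lie in the layers. -/
theorem exists_mem_cycleLayer (A : StructMatrix (Fin n) (Fin n)) {j : Fin n}
    (hj : InputReachable A B j) : ∃ l, j ∈ cycleLayer (reachablePart A B) B σ l := by
  obtain ⟨k, hk⟩ := hj
  have : ∀ v, Relation.ReflTransGen (systemDigraph A B).Adj (Sum.inr k) v → ∀ j, v = Sum.inl j →
      ∃ l, j ∈ cycleLayer (reachablePart A B) B σ l := by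
    intro v hv
    induction hv with
    | refl => intro j h; cases h
    | @tail b c hb hbc ih =>
      rintro j rfl
      rcases b with i | k'
      · obtain ⟨l, hl⟩ := ih i rfl
        refine ⟨l + 1, j, i, Equiv.Perm.SameCycle.refl _ _, hl, ?_⟩
        have h1 : InputReachable A B i := ⟨k, hb⟩
        have h2 : InputReachable A B j := ⟨k, hb.tail hbc⟩
        simp only [reachablePart, Matrix.of_apply, h1, h2, and_self, if_true]
        exact hbc
      · exact ⟨0, j, k', Equiv.Perm.SameCycle.refl _ _, hbc⟩
  exact this _ hk j rfl

end Forest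

/-! ### The nonzero modes of a weighted cycle forest are controllable -/

theorem Equiv.Perm.SameCycle.pow_induction {α : Type} [Finite α] {σ : Equiv.Perm α} {P : α → Prop}
    {i j : α} (h : σ.SameCycle i j) (hi : P i) (hstep : ∀ x, σ.SameCycle i x → P x → P (σ x)) :
    P j := by
  obtain ⟨k, rfl⟩ := h.exists_nat_pow_eq
  clear h
  induction k with
  | zero => simpa using hi
  | succ k ih =>
    rw [pow_succ', Equiv.Perm.mul_apply]
    exact hstep _ (Equiv.Perm.sameCycle_pow_right.2 (Equiv.Perm.SameCycle.refl _ _)) ih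

/-- If a vector is an eigenvector of a weighted cycle, then the eigenvalue has the modulus of the
weight. -/
theorem norm_eq_weight_of_cycle {n : ℕ} {σ : Equiv.Perm (Fin n)} {s : Fin n → ℝ}
    (hs0 : ∀ j, 0 ≤ s j) (hsσ : ∀ j, s (σ j) = s j) {lam : ℂ} {v : Fin n → ℂ} {j : Fin n}
    (hj : v j ≠ 0) (h : ∀ i, σ.SameCycle j i → lam * v i = s i * v (σ i)) : ‖lam‖ = s j := by
  have hs : ∀ k : ℕ, s ((σ ^ k) j) = s j := by
    intro k
    induction k with
    | zero => simp
    | succ k ih => rw [pow_succ', Equiv.Perm.mul_apply, hsσ, ih]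
  have hk : ∀ k : ℕ, lam ^ k * v j = (s j : ℂ) ^ k * v ((σ ^ k) j) := by
    intro k
    induction k with
    | zero => simp
    | succ k ih =>
      rw [pow_succ', mul_assoc, ih, mul_left_comm,
        h _ (Equiv.Perm.sameCycle_pow_right.2 (Equiv.Perm.SameCycle.refl _ _)), hs,
        pow_succ' σ, Equiv.Perm.mul_apply]
      ring
  -- After `orderOf σ` steps the walk is back at `j`, so `lam` and `s j` have powers of equal
  -- modulus.
  have h1 := congrArg norm (hk (orderOf σ))
  rw [pow_orderOf_eq_one, Equiv.Perm.one_apply, norm_mul, norm_mul, norm_pow, norm_pow,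
    Complex.norm_real, Real.norm_of_nonneg (hs0 j)] at h1
  have h2 := mul_right_cancel₀ (norm_ne_zero_iff.2 hj) h1
  exact (pow_left_inj₀ (norm_nonneg _) (hs0 j) (orderOf_pos σ).ne').1 h2

open Classical in
/-- The matrix with weighted edges `j → σ j` and edges `j → i` of weight one for `F i j`. -/
noncomputable def cycleForestMatrix {n : ℕ} (σ : Equiv.Perm (Fin n)) (s : Fin n → ℝ)
    (F : Fin n → Fin n → Prop) : Matrix (Fin n) (Fin n) ℝ :=
  Matrix.of fun i j => (if i = σ j then s j else 0) + if F i j then 1 else 0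

/-- A forest of the cycles of `σ`: edges `F` between states and edges `G` from inputs enter each
cycle at most once, and each cycle in `R` is entered. -/
structure IsCycleForest {n m : ℕ} (σ : Equiv.Perm (Fin n)) (d : Fin n → ℕ) (R : Fin n → Prop)
    (F : Fin n → Fin n → Prop) (G : Fin n → Fin m → Prop) : Prop where
  level_congr : ∀ i j, σ.SameCycle i j → d i = d j
  level_edge : ∀ i j, F i j → d i = d j + 1
  level_root : ∀ i k, G i k → d i = 0
  edge_unique : ∀ i j i' j', F i j → F i' j' → σ.SameCycle i i' → i = i' ∧ j = j'
  root_unique : ∀ i k i' k', G i k → G i' k' → σ.SameCycle i i' → i = i'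
  entered : ∀ j, R j → ∃ i, σ.SameCycle j i ∧ ((∃ k, G i k) ∨ ∃ j', F i j' ∧ R j')

-- On a cycle of the highest level in the support, no forest term remains, so `v` restricts to an
-- eigenvector of that cycle and `‖lam‖` is its weight. Distinct weights exclude this for every
-- other cycle. The cycle passes a nonzero entry to its parent cycle and so on downwards, until an
-- input edge has a nonzero value, contrary to `hG`.
open Classical in
theorem IsCycleForest.eq_zero_of_eigenvector {n m : ℕ} {σ : Equiv.Perm (Fin n)} {d : Fin n → ℕ}
    {R : Fin n → Prop} {F : Fin n → Fin n → Prop} {G : Fin n → Fin m → Prop}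
    (hf : IsCycleForest σ d R F G) {s : Fin n → ℝ} (hs0 : ∀ j, 0 ≤ s j)
    (hsσ : ∀ j, s (σ j) = s j) (hsfix : ∀ j, s j = 0 → σ j = j)
    (hsR : ∀ j, s j ≠ 0 → R j)
    (hsinj : ∀ i j, s i = s j → s j ≠ 0 → σ.SameCycle i j) {lam : ℂ} (hlam : lam ≠ 0)
    {v : Fin n → ℂ} (hv : ∀ j, lam * v j = s j * v (σ j) + ∑ i, if F i j then v i else 0)
    (hG : ∀ k, (∑ i, if G i k then v i else 0) = 0) : v = 0 := by
  by_contra hv0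
  obtain ⟨c₀, hc₀⟩ := Function.ne_iff.1 hv0
  obtain ⟨c, hc, hmax⟩ := Finset.exists_max_image (Finset.univ.filter fun j => v j ≠ 0) d
    ⟨c₀, by simpa using hc₀⟩
  simp only [Finset.mem_filter, Finset.mem_univ, true_and] at hc hmax
  have refl : ∀ x, σ.SameCycle x x := Equiv.Perm.SameCycle.refl σ
  -- cycles of maximal level carry an eigenvector of the cycle itself
  have htop : ∀ j, d j = d c → lam * v j = s j * v (σ j) := by
    intro j hj
    rw [hv j, Finset.sum_eq_zero, add_zero]
    intro i _
    split_ifs with hF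
    · by_contra hi
      have := hmax i hi
      have := hf.level_edge i j hF
      omega
    · rfl
  have hsc : ‖lam‖ = s c := norm_eq_weight_of_cycle hs0 hsσ hc fun i hi =>
    htop i (hf.level_congr _ _ hi).symm
  have hsc0 : s c ≠ 0 := by rw [← hsc]; exact norm_ne_zero_iff.2 hlam
  have hcyc : ∀ j, v j ≠ 0 → (∀ i, σ.SameCycle j i → lam * v i = s i * v (σ i)) →
      σ.SameCycle c j := fun j hj h =>
    (hsinj j c ((norm_eq_weight_of_cycle hs0 hsσ hj h).symm.trans hsc) hsc0).symm
  -- Descending through the levels from `d c`, the support of `v` on each level is exactly one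
  -- cycle, the ancestor of the cycle of `c`.
  have main : ∀ q, q ≤ d c → ∃ b, d b = d c - q ∧ R b ∧
      ∀ j, d j = d c - q → (v j ≠ 0 ↔ σ.SameCycle b j) := by
    intro q
    induction q with
    | zero =>
      intro _
      refine ⟨c, by simp, hsR c hsc0, fun j hj => ⟨fun hvj => ?_, fun hcj => ?_⟩⟩
      · exact hcyc j hvj fun i hi => htop i ((hf.level_congr _ _ hi).symm.trans (by simpa using hj))
      · refine hcj.pow_induction (P := fun x => v x ≠ 0) hc fun x hx hvx h0 => ?_
        have := htop x (hf.level_congr _ _ hx).symm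
        rw [h0, mul_zero] at this
        exact mul_ne_zero hlam hvx this
    | succ q ih =>
      intro hq
      obtain ⟨b', hb', hR', hiff'⟩ := ih (by omega)
      obtain ⟨i₀, hi₀, h | ⟨j₀, hF₀, hR₀⟩⟩ := hf.entered b' hR'
      · obtain ⟨k, hk⟩ := h
        have h1 := hf.level_root _ _ hk
        have h2 := hf.level_congr _ _ hi₀
        omega
      have hd₀ : d i₀ = d c - q := (hf.level_congr _ _ hi₀).symm.trans hb'
      have hvi₀ : v i₀ ≠ 0 := (hiff' i₀ hd₀).2 hi₀
      have hdj₀ : d j₀ = d c - (q + 1) := by have := hf.level_edge _ _ hF₀; omega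
      -- On the level above only one cycle carries `v`, and it is entered by the single edge from
      -- `j₀` to `i₀`; hence the forest term lives at `j₀` alone.
      have hsum : ∀ j, d j = d c - (q + 1) →
          (∑ i, if F i j then v i else 0) = if j = j₀ then v i₀ else 0 := by
        intro j hj
        have key : ∀ i, F i j → v i ≠ 0 → i₀ = i ∧ j₀ = j := by
          intro i hi hvi
          have hdi : d i = d c - q := by have := hf.level_edge _ _ hi; omega
          exact hf.edge_unique _ _ _ _ hF₀ hi (hi₀.symm.trans ((hiff' i hdi).1 hvi))
        split_ifs with hjj
        · subst hjj
          rw [Finset.sum_eq_single i₀, if_pos hF₀]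
          · intro i _ hne
            split_ifs with hF
            · by_contra hvi
              exact hne (key i hF hvi).1.symm
            · rfl
          · simp
        · refine Finset.sum_eq_zero fun i _ => ?_
          split_ifs with hF
          · by_contra hvi
            exact hjj (key i hF hvi).2.symm
          · rfl
      refine ⟨j₀, hdj₀, hR₀, fun j hj => ⟨fun hvj => ?_, fun hjj => ?_⟩⟩
      -- A cycle that avoids `j₀` gets no forest term. A nonzero `v` on it would make it the cycle
      -- of `c`, which has a higher level.
      · by_contra hne
        have := hcyc j hvj fun i hi => by
          rw [hv i, hsum i ((hf.level_congr _ _ hi).symm.trans hj), if_neg, add_zero]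
          rintro rfl
          exact hne hi.symm
        have := hf.level_congr _ _ this
        omega
      · have hstep : ∀ x, σ.SameCycle j₀ x → x ≠ j₀ → lam * v x = s x * v (σ x) := by
          intro x hx hne
          rw [hv x, hsum x ((hf.level_congr _ _ hx).symm.trans hdj₀), if_neg hne, add_zero]
        have hj₀ : lam * v j₀ = s j₀ * v (σ j₀) + v i₀ := by
          rw [hv j₀, hsum j₀ hdj₀, if_pos rfl]
        have hσ₀ : σ.SameCycle j₀ (σ j₀) := Equiv.Perm.sameCycle_apply_right.2 (refl _)
        have hsx : ∀ x, σ.SameCycle j₀ x → s x = s j₀ := by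
          intro x hx
          exact hx.pow_induction (P := fun x => s x = s j₀) rfl fun y _ hy => (hsσ y).trans hy
        -- A cycle of weight zero is the single vertex `j₀`, where `lam * v j₀ = v i₀ ≠ 0`.
        by_cases hs : s j₀ = 0
        · obtain rfl : j₀ = j := hjj.eq_of_left (hsfix j₀ hs)
          intro h0
          rw [h0, hs] at hj₀
          simp at hj₀
          exact hvi₀ hj₀.symm
        -- A zero at `σ j₀` would propagate around the cycle to `j₀`, and the equation at `j₀` would
        -- give `v i₀ = 0`. Starting at `σ j₀`, nonvanishing propagates in the same way.
        · have hy : v (σ j₀) ≠ 0 := by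
            intro h0
            have h1 : v j₀ = 0 := by
              refine (hσ₀.symm).pow_induction (P := fun x => v x = 0) h0 fun x hx hvx => ?_
              by_cases hxj : x = j₀
              · rw [hxj, h0]
              · have := hstep x (hσ₀.trans hx) hxj
                rw [hvx, mul_zero, hsx x (hσ₀.trans hx)] at this
                simpa [hs] using this.symm
            rw [h1, h0] at hj₀
            simp at hj₀
            exact hvi₀ hj₀.symm
          refine (hσ₀.symm.trans hjj).pow_induction (P := fun x => v x ≠ 0) hy
            fun x hx hvx h0 => ?_
          by_cases hxj : x = j₀
          · rw [hxj] at h0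
            exact hy h0
          · have := hstep x (hσ₀.trans hx) hxj
            rw [h0, mul_zero] at this
            exact mul_ne_zero hlam hvx this
  -- A cycle of level zero can only be entered by an input edge, and the sum in `hG` for this input
  -- reduces to `v i₀`.
  obtain ⟨b, hb, hR, hiff⟩ := main (d c) le_rfl
  rw [Nat.sub_self] at hb hiff
  obtain ⟨i₀, hi₀, ⟨k, hk⟩ | ⟨j₀, hF₀, -⟩⟩ := hf.entered b hR
  · refine (hiff i₀ (hf.level_root _ _ hk)).2 hi₀ ?_
    rw [← hG k, Finset.sum_eq_single i₀, if_pos hk]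
    · intro i _ hne
      split_ifs with hGi
      · by_contra hvi
        exact hne (hf.root_unique _ _ _ _ hk hGi
          (hi₀.symm.trans ((hiff i (hf.level_root _ _ hGi)).1 hvi))).symm
      · rfl
    · simp
  · have h1 := hf.level_edge _ _ hF₀
    have h2 := hf.level_congr _ _ hi₀
    omega

/-! ### Controllable modes and the rank of the controllability matrix -/

/-- By Cayley–Hamilton, every power of `A` is a combination of the powers below `n`. -/
theorem Matrix.vecMul_pow_mul_eq_zero {K : Type} [Field K] {n m : ℕ} {A : Matrix (Fin n) (Fin n) K}
    {B : Matrix (Fin n) (Fin m) K} {w : Fin n → K}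
    (h : ∀ k < n, Matrix.vecMul w (A ^ k * B) = 0) (k : ℕ) : Matrix.vecMul w (A ^ k * B) = 0 := by
  rw [Matrix.pow_eq_aeval_mod_charpoly, Polynomial.aeval_def, Polynomial.eval₂_eq_sum,
    Polynomial.sum_def, Matrix.sum_mul, Matrix.vecMul_sum]
  refine Finset.sum_eq_zero fun i hi => ?_
  have h1 : (i : WithBot ℕ) < A.charpoly.degree :=
    (Polynomial.le_degree_of_mem_supp i hi).trans_lt
      (Polynomial.degree_modByMonic_lt _ A.charpoly_monic)
  rw [Matrix.charpoly_degree_eq_dim, Fintype.card_fin, Nat.cast_lt] at h1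
  rw [Algebra.algebraMap_eq_smul_one, smul_mul_assoc, one_mul, Matrix.smul_mul, Matrix.vecMul_smul,
    h i h1, smul_zero]

/-- With all powers on the right-hand side, the left kernel is visibly invariant under `A`, and
shifts of the exponent cost nothing. -/
theorem vecMul_mul_ctrbMatrix_eq_zero_iff {n m p : ℕ} {A : Matrix (Fin n) (Fin n) ℝ}
    {B : Matrix (Fin n) (Fin m) ℝ} {C : Matrix (Fin p) (Fin n) ℝ} {w : Fin p → ℝ} :
    Matrix.vecMul w (C * ctrbMatrix A B) = 0 ↔
      ∀ k, Matrix.vecMul (Matrix.vecMul w C) (A ^ k * B) = 0 := by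
  rw [← Matrix.vecMul_vecMul]
  have key : ∀ (k : Fin n) j, Matrix.vecMul (Matrix.vecMul w C) (ctrbMatrix A B) (k, j) =
      Matrix.vecMul (Matrix.vecMul w C) (A ^ (k : ℕ) * B) j := fun k j => rfl
  constructor
  · intro h
    refine Matrix.vecMul_pow_mul_eq_zero fun k hk => ?_
    ext j
    rw [← key ⟨k, hk⟩ j, h]
    rfl
  · intro h
    ext ⟨k, j⟩
    rw [key, h]
    rfl

/-- A smaller left kernel means a larger rank. -/
theorem Matrix.rank_le_of_vecMul {a κ ι : Type} [Fintype a] [Fintype κ] [Fintype ι]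
    {X : Matrix a κ ℝ} {Y : Matrix a ι ℝ}
    (h : ∀ w, Matrix.vecMul w Y = 0 → Matrix.vecMul w X = 0) : X.rank ≤ Y.rank := by
  have hk : LinearMap.ker Y.vecMulLinear ≤ LinearMap.ker X.vecMulLinear := fun w hw => h w hw
  have h1 := LinearMap.finrank_range_add_finrank_ker X.vecMulLinear
  have h2 := LinearMap.finrank_range_add_finrank_ker Y.vecMulLinear
  have h3 := Submodule.finrank_mono hk
  have hX : X.rank = Module.finrank ℝ (LinearMap.range X.vecMulLinear) := by
    rw [← Matrix.rank_transpose, Matrix.rank, Matrix.mulVecLin_transpose]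
  have hY : Y.rank = Module.finrank ℝ (LinearMap.range Y.vecMulLinear) := by
    rw [← Matrix.rank_transpose, Matrix.rank, Matrix.mulVecLin_transpose]
  omega

/-- An endomorphism of a complex space without nonzero eigenvalues is nilpotent. -/
theorem Module.End.isNilpotent_of_eigenvalues {V : Type} [AddCommGroup V] [Module ℂ V]
    [FiniteDimensional ℂ V] (g : Module.End ℂ V)
    (h : ∀ μ : ℂ, μ ≠ 0 → ∀ v, g v = μ • v → v = 0) : IsNilpotent g := by
  have h0 : ∀ μ : ℂ, μ ≠ 0 → g.maxGenEigenspace μ = ⊥ := by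
    intro μ hμ
    by_contra hne
    have h1 : g.HasEigenvalue μ := Module.End.HasUnifEigenvalue.lt (k := ⊤) zero_lt_one hne
    obtain ⟨v, hv⟩ := h1.exists_hasEigenvector
    exact hv.2 (h μ hμ v hv.apply_eq_smul)
  have htop := Module.End.iSup_maxGenEigenspace_eq_top g
  have h2 : g.maxGenEigenspace 0 = ⊤ := by
    rw [eq_top_iff, ← htop]
    refine iSup_le fun μ => ?_
    by_cases hμ : μ = 0
    · rw [hμ]
    · rw [h0 μ hμ]; exact bot_le
  rw [Module.End.maxGenEigenspace_eq_genEigenspace_finrank, Module.End.genEigenspace_nat,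
    zero_smul, sub_zero, LinearMap.ker_eq_top] at h2
  exact ⟨_, h2⟩

/-- This is the eigenvector test for controllability, restricted to nonzero eigenvalues. The complex
row vectors that annihilate all `A ^ k * B` form an `A`-invariant space `U`; by hypothesis `A` has
no nonzero eigenvalue on `U`, so it is nilpotent there. If `w * A ^ n` lies in `U`, then a further
power of `A` kills it, and stabilization of kernels gives `w * A ^ n = 0`. -/
theorem rank_pow_le_of_controllable_modes {n m : ℕ} {A : Matrix (Fin n) (Fin n) ℝ}
    {B : Matrix (Fin n) (Fin m) ℝ}
    (h : ∀ (lam : ℂ) (v : Fin n → ℂ), lam ≠ 0 →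
      Matrix.vecMul v (A.map Complex.ofRealHom) = lam • v →
      Matrix.vecMul v (B.map Complex.ofRealHom) = 0 → v = 0) :
    (A ^ n).rank ≤ (A ^ n * ctrbMatrix A B).rank := by
  refine Matrix.rank_le_of_vecMul fun w hw => ?_
  rw [vecMul_mul_ctrbMatrix_eq_zero_iff] at hw
  set w' := Matrix.vecMul w (A ^ n) with hw'
  let Ac := A.map Complex.ofRealHom
  let Bc := B.map Complex.ofRealHom
  let U : Submodule ℂ (Fin n → ℂ) :=
    { carrier := {u | ∀ k : ℕ, Matrix.vecMul u (Ac ^ k * Bc) = 0}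
      add_mem' := fun {a b} ha hb k => by rw [Matrix.add_vecMul, ha k, hb k, add_zero]
      zero_mem' := fun k => Matrix.zero_vecMul _
      smul_mem' := fun c a ha k => by rw [Matrix.smul_vecMul, ha k, smul_zero] }
  have hU : ∀ u ∈ U, Ac.vecMulLinear u ∈ U := by
    intro u hu k
    rw [Matrix.vecMulLinear_apply, Matrix.vecMul_vecMul, ← Matrix.mul_assoc, ← pow_succ']
    exact hu (k + 1)
  obtain ⟨N, hN⟩ := Module.End.isNilpotent_of_eigenvalues (Ac.vecMulLinear.restrict hU) (by
    intro μ hμ v hv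
    have h1 := congrArg Subtype.val hv
    refine Subtype.ext (h μ v hμ h1 ?_)
    have h2 := v.2 0
    rwa [pow_zero, Matrix.one_mul] at h2)
  have hpow : ∀ k (u : Fin n → ℂ), (Ac.vecMulLinear ^ k) u = Matrix.vecMul u (Ac ^ k) := by
    intro k
    induction k with
    | zero => simp
    | succ k ih =>
      intro u
      rw [pow_succ, Module.End.mul_apply, ih, Matrix.vecMulLinear_apply, Matrix.vecMul_vecMul,
        ← pow_succ']
  have hAk : ∀ k, Ac ^ k = (A ^ k).map Complex.ofRealHom := fun k =>
    (map_pow Complex.ofRealHom.mapMatrix A k).symm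
  have hvm : ∀ {κ : Type} (u : Fin n → ℝ) (X : Matrix (Fin n) κ ℝ),
      Matrix.vecMul (Complex.ofRealHom ∘ u) (X.map Complex.ofRealHom) =
        Complex.ofRealHom ∘ Matrix.vecMul u X := by
    intro κ u X
    ext j
    exact (RingHom.map_vecMul Complex.ofRealHom X u j).symm
  have hmem : Complex.ofRealHom ∘ w' ∈ U := by
    intro k
    rw [hAk, ← Matrix.map_mul, hvm, hw k]
    ext; simp
  have hz : Matrix.vecMul w' (A ^ N) = 0 := by
    have h1 := congrArg Subtype.val (LinearMap.congr_fun hN ⟨_, hmem⟩)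
    rw [Module.End.pow_restrict, LinearMap.coe_restrict_apply, hpow, hAk, hvm] at h1
    ext j
    have := congrFun h1 j
    simpa using this
  rw [hw', Matrix.vecMul_vecMul, ← pow_add] at hz
  exact Matrix.ker_pow_le A hz

/-! ### A realization with controllable nonzero modes -/

/-- Forest edges do not change the characteristic polynomial of a family of disjoint cycles. -/
theorem IsCycleForest.charpoly_cycleForestMatrix {n m : ℕ} {σ : Equiv.Perm (Fin n)}
    {d : Fin n → ℕ} {R : Fin n → Prop} {F : Fin n → Fin n → Prop} {G : Fin n → Fin m → Prop}
    (hf : IsCycleForest σ d R F G) (s : Fin n → ℝ) :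
    (cycleForestMatrix σ s F).charpoly = (cycleForestMatrix σ s fun _ _ => False).charpoly := by
  have hσ : ∀ i, d (σ i) = d i := fun i =>
    (hf.level_congr _ _ (Equiv.Perm.sameCycle_apply_right.2 (Equiv.Perm.SameCycle.refl σ i))).symm
  -- Cycle edges preserve the level and forest edges raise it by one, so the matrix is block
  -- triangular along the levels, and its diagonal blocks contain no forest edge.
  have htri : ∀ F' : Fin n → Fin n → Prop, (∀ i j, F' i j → F i j) →
      (cycleForestMatrix σ s F').charmatrix.BlockTriangular (OrderDual.toDual ∘ d) := by
    intro F' hF' i j hij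
    have hlt : d i < d j := hij
    rw [Matrix.charmatrix_apply_ne _ _ _ (by rintro rfl; exact lt_irrefl _ hlt), cycleForestMatrix,
      Matrix.of_apply, if_neg, if_neg]
    · simp
    · intro h
      have := hf.level_edge _ _ (hF' _ _ h)
      omega
    · rintro rfl
      rw [hσ] at hlt
      exact lt_irrefl _ hlt
  rw [Matrix.charpoly, Matrix.charpoly, (htri F fun _ _ h => h).det,
    (htri (fun _ _ => False) fun _ _ h => h.elim).det]
  refine Finset.prod_congr rfl fun k _ => congrArg Matrix.det ?_
  ext1 ⟨i, hi⟩ ⟨j, hj⟩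
  have hij : d i = d j := OrderDual.toDual.injective (hi.trans hj.symm)
  have hF : ¬ F i j := fun h => by have := hf.level_edge _ _ h; omega
  simp [Matrix.toSquareBlock_def, Matrix.charmatrix_apply, cycleForestMatrix, hF]

/-- Each application moves the coordinate `j` to `σ j` and multiplies it by the weight. A vector
killed by the power therefore vanishes on `S`, and the kernel embeds into the coordinates outside
`S`. -/
theorem card_le_rank_cycleMatrix_pow {n : ℕ} (σ : Equiv.Perm (Fin n)) {s : Fin n → ℝ}
    (hsσ : ∀ j, s (σ j) = s j) (S : Finset (Fin n)) (hS : ∀ j ∈ S, s j ≠ 0) :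
    S.card ≤ (cycleForestMatrix σ s (fun _ _ => False) ^ n).rank := by
  set A := cycleForestMatrix σ s fun _ _ => False with hA
  have hmul : ∀ x j, A.mulVec x (σ j) = s j * x j := by
    intro x j
    simp only [hA, cycleForestMatrix, Matrix.mulVec, dotProduct, Matrix.of_apply, if_false,
      add_zero, EmbeddingLike.apply_eq_iff_eq]
    simp
  have hpow : ∀ k x j, (A ^ k).mulVec x ((σ ^ k) j) = s j ^ k * x j := by
    intro k
    induction k with
    | zero => simp
    | succ k ih =>
      intro x j
      have hs : s ((σ ^ k) j) = s j := by
        clear ih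
        induction k with
        | zero => simp
        | succ k ih => rw [pow_succ', Equiv.Perm.mul_apply, hsσ, ih]
      rw [pow_succ' A, ← Matrix.mulVec_mulVec, pow_succ' σ, Equiv.Perm.mul_apply, hmul, ih, hs]
      ring
  have h1 := LinearMap.finrank_range_add_finrank_ker (A ^ n).mulVecLin
  rw [Module.finrank_fin_fun] at h1
  have h2 : Module.finrank ℝ (LinearMap.ker (A ^ n).mulVecLin) ≤ Sᶜ.card := by
    let r : (Fin n → ℝ) →ₗ[ℝ] ({j // j ∈ Sᶜ} → ℝ) := LinearMap.funLeft ℝ ℝ Subtype.val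
    have hinj : Function.Injective (r.domRestrict (LinearMap.ker (A ^ n).mulVecLin)) := by
      rw [injective_iff_map_eq_zero]
      rintro ⟨x, hx⟩ hr
      refine Subtype.ext (funext fun j => ?_)
      by_cases hj : j ∈ S
      · have h3 := hpow n x j
        have h4 : (A ^ n).mulVec x = 0 := hx
        rw [h4, Pi.zero_apply] at h3
        exact (mul_eq_zero.1 h3.symm).resolve_left (pow_ne_zero _ (hS j hj))
      · exact congrFun hr ⟨j, Finset.mem_compl.2 hj⟩
    have := LinearMap.finrank_le_finrank_of_injective hinj
    rwa [Module.finrank_fintype_fun_eq_card, Fintype.card_coe] at this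
  rw [Finset.card_compl, Fintype.card_fin] at h2
  have h3 : S.card ≤ n := by simpa using S.card_le_univ
  change S.card ≤ Module.finrank ℝ (LinearMap.range (A ^ n).mulVecLin)
  omega

/-- Some realization with the pattern of `(Ā_r, B̄)` has as many controllable nonzero modes as any
realization of `Ā_r` has nonzero modes. -/
theorem exists_realization_rank_pow_le {n m : ℕ} (A : StructMatrix (Fin n) (Fin n))
    (B : StructMatrix (Fin n) (Fin m)) (θ : (reachablePart A B).Param) :
    ∃ (N : Matrix (Fin n) (Fin n) ℝ) (B' : Matrix (Fin n) (Fin m) ℝ),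
      (∀ i j, reachablePart A B i j = false → N i j = 0) ∧ (∀ i k, B i k = false → B' i k = 0) ∧
      ((reachablePart A B).realize θ ^ n).rank ≤ (N ^ n * ctrbMatrix N B').rank := by
  classical
  let M := reachablePart A B
  have hM : M = reachablePart A B := rfl
  obtain ⟨σ, hσ, hrank⟩ := M.exists_perm_rank_pow_le θ
  obtain ⟨d, ent, par, hcongr, hent⟩ := exists_cycleForest M B σ
  let _ := Equiv.Perm.SameCycle.setoid σ
  -- Numbering the cycles and adding one gives positive weights that are constant on cycles and
  -- distinct on different cycles.
  let t : Fin n → ℝ := fun j => (Fintype.equivFin (Quotient (Equiv.Perm.SameCycle.setoid σ)) ⟦j⟧ : ℕ) + 1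
  have ht0 : ∀ j, 0 < t j := fun j => by positivity
  have htinj : ∀ i j, t i = t j ↔ σ.SameCycle i j := by
    intro i j
    simp only [t, add_left_inj, Nat.cast_inj, Fin.val_inj, EmbeddingLike.apply_eq_iff_eq,
      Quotient.eq]
    rfl
  -- The weight is zero exactly at the vertices outside the support, which are fixed points of `σ`
  -- without a free loop.
  let s : Fin n → ℝ := fun j => if M (σ j) j = true then t j else 0
  have hs_ne : ∀ j, s j ≠ 0 ↔ M (σ j) j = true := fun j => by
    simp only [s]; split_ifs with h <;> simp [h, (ht0 j).ne']
  have hs_eq : ∀ j, s j ≠ 0 → s j = t j := fun j hj => if_pos ((hs_ne j).1 hj)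
  have hcσ : ∀ j, σ.SameCycle (σ j) j := fun j =>
    Equiv.Perm.sameCycle_apply_left.2 (Equiv.Perm.SameCycle.refl σ j)
  have hsσ : ∀ j, s (σ j) = s j := by
    intro j
    by_cases h1 : M (σ j) j = true
    · by_cases h2 : M (σ (σ j)) (σ j) = true
      · simp only [s, h1, h2, if_true]
        exact (htinj _ _).2 (hcσ j)
      · have h3 := σ.injective (hσ (σ j) (by simpa using h2))
        rw [h3]
    · rw [hσ j (by simpa using h1)]
  let R : Fin n → Prop := fun j => ∃ l, j ∈ cycleLayer M B σ l
  have hR : ∀ i j, σ.SameCycle i j → R i → R j := fun i j h ⟨l, hl⟩ =>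
    ⟨l, mem_cycleLayer_congr M B σ h hl⟩
  -- Only the chosen entry vertex of a reached cycle receives a forest edge, so each cycle is
  -- entered at most once.
  let F : Fin n → Fin n → Prop := fun i j => R i ∧ i = ent i ∧ par i = Sum.inl j
  let G : Fin n → Fin m → Prop := fun i k => R i ∧ i = ent i ∧ par i = Sum.inr k
  have hF : ∀ i j, F i j → M i j = true ∧ d i = d j + 1 := by
    rintro i j ⟨h1, h2, h3⟩
    obtain ⟨-, ⟨k, hk, -⟩ | ⟨j', hj', h4, h5, -⟩⟩ := hent i h1
    · rw [h3] at hk; cases hk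
    · rw [h3] at hj'
      cases hj'
      exact ⟨by rwa [← h2] at h4, h5⟩
  have hG : ∀ i k, G i k → B i k = true ∧ d i = 0 := by
    rintro i k ⟨h1, h2, h3⟩
    obtain ⟨-, ⟨k', hk, h4, h5⟩ | ⟨j', hj', -⟩⟩ := hent i h1
    · rw [h3] at hk
      cases hk
      exact ⟨by rwa [← h2] at h4, h5⟩
    · rw [h3] at hj'; cases hj'
  have hf : IsCycleForest σ d R F G :=
    { level_congr := fun i j h => (hcongr i j h).1
      level_edge := fun i j h => (hF i j h).2
      level_root := fun i k h => (hG i k h).2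
      edge_unique := by
        rintro i j i' j' ⟨-, h1, h2⟩ ⟨-, h1', h2'⟩ h
        obtain ⟨-, h3, h4⟩ := hcongr _ _ h
        refine ⟨by rw [h1, h3, ← h1'], ?_⟩
        rw [h2, h2'] at h4
        exact Sum.inl_injective h4
      root_unique := by
        rintro i k i' k' ⟨-, h1, -⟩ ⟨-, h1', -⟩ h
        rw [h1, (hcongr _ _ h).2.1, ← h1']
      entered := by
        intro j hj
        obtain ⟨h1, h2⟩ := hent j hj
        obtain ⟨-, h3, h4⟩ := hcongr _ _ h1
        refine ⟨ent j, h1, ?_⟩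
        rcases h2 with ⟨k, hk, -⟩ | ⟨j', hj', -, -, hRj'⟩
        · exact Or.inl ⟨k, hR _ _ h1 hj, h3, h4.symm.trans hk⟩
        · exact Or.inr ⟨j', ⟨hR _ _ h1 hj, h3, h4.symm.trans hj'⟩, hRj'⟩ }
  let N := cycleForestMatrix σ s F
  let B' : Matrix (Fin n) (Fin m) ℝ := Matrix.of fun i k => if G i k then 1 else 0
  refine ⟨N, B', fun i j hij => ?_, fun i k hik => ?_, hrank.trans ?_⟩
  · have hFij : ¬ F i j := fun h => absurd ((hF i j h).1.symm.trans hij) (by decide)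
    simp only [N, cycleForestMatrix, Matrix.of_apply, if_neg hFij, add_zero]
    split_ifs with h
    · by_contra hne
      have := (hs_ne j).1 hne
      rw [← h] at this
      exact absurd (this.symm.trans hij) (by decide)
    · rfl
  · simp only [B', Matrix.of_apply]
    rw [if_neg fun h => by simp [(hG i k h).1] at hik]
  -- The characteristic polynomials with and without the forest agree, hence also the trailing
  -- degrees and the ranks of the `n`-th powers.
  · have h1 := card_le_rank_cycleMatrix_pow σ hsσ (M.support σ) fun j hj => (hs_ne j).2 (by
      simpa [StructMatrix.support] using hj)
    have h2 := N.rank_pow_add_natTrailingDegree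
    have h3 := (cycleForestMatrix σ s fun _ _ => False).rank_pow_add_natTrailingDegree
    rw [hf.charpoly_cycleForestMatrix] at h2
    have h4 : (N ^ n).rank ≤ (N ^ n * ctrbMatrix N B').rank := by
      refine rank_pow_le_of_controllable_modes fun lam v hlam hv hvB => ?_
      refine hf.eq_zero_of_eigenvector (s := s) (lam := lam) (fun j => ?_) hsσ (fun j hj => ?_)
        (fun j hj => ?_) (fun i j hij hj => ?_) hlam (fun j => ?_) (fun k => ?_)
      · simp only [s]; split_ifs
        · exact (ht0 j).le
        · exact le_rfl
      · refine hσ j ?_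
        by_contra h
        exact (hs_ne j).2 (by simpa using h) hj
      · have h := (hs_ne j).1 hj
        rw [hM] at h
        simp only [reachablePart, Matrix.of_apply] at h
        split_ifs at h with hr
        exact exists_mem_cycleLayer B σ A hr.2
      · rw [hs_eq i (hij ▸ hj), hs_eq j hj] at hij
        exact (htinj i j).1 hij
      · have h := congrFun hv j
        rw [Pi.smul_apply, smul_eq_mul] at h
        rw [← h]
        simp only [Matrix.vecMul, dotProduct, N, cycleForestMatrix, Matrix.map_apply,
          Matrix.of_apply, map_add, mul_add, Finset.sum_add_distrib]
        congr 1
        · rw [Finset.sum_eq_single (σ j)]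
          · simp [mul_comm]
          · intro i _ hi; simp [hi]
          · simp
        · refine Finset.sum_congr rfl fun i _ => ?_
          split_ifs <;> simp
      · have h := congrFun hvB k
        refine Eq.trans ?_ h
        simp only [Matrix.vecMul, dotProduct, B', Matrix.map_apply, Matrix.of_apply]
        refine Finset.sum_congr rfl fun i _ => ?_
        split_ifs <;> simp
    omega

/-! ### Left kernels and the generic controllable subspace -/

/-- The left kernels are nested, and the ranks force equal dimensions. -/
theorem Matrix.vecMul_eq_zero_of_rank_le {a κ ι : Type} [Fintype a] [Fintype κ] [Fintype ι]
    {X : Matrix a κ ℝ} {Y : Matrix a ι ℝ}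
    (h : ∀ w, Matrix.vecMul w X = 0 → Matrix.vecMul w Y = 0) (hr : X.rank ≤ Y.rank) {w : a → ℝ}
    (hw : Matrix.vecMul w Y = 0) : Matrix.vecMul w X = 0 := by
  have hk : LinearMap.ker X.vecMulLinear ≤ LinearMap.ker Y.vecMulLinear := fun w hw => h w hw
  have h1 := LinearMap.finrank_range_add_finrank_ker X.vecMulLinear
  have h2 := LinearMap.finrank_range_add_finrank_ker Y.vecMulLinear
  have hX : X.rank = Module.finrank ℝ (LinearMap.range X.vecMulLinear) := by
    rw [← Matrix.rank_transpose, Matrix.rank, Matrix.mulVecLin_transpose]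
  have hY : Y.rank = Module.finrank ℝ (LinearMap.range Y.vecMulLinear) := by
    rw [← Matrix.rank_transpose, Matrix.rank, Matrix.mulVecLin_transpose]
  have h3 := Submodule.eq_of_le_of_finrank_le hk (by omega)
  have h4 : w ∈ LinearMap.ker X.vecMulLinear := by rw [h3]; exact hw
  exact h4

/-- This is the only consequence of diagonalizability that the proof uses. In eigencoordinates it
says that `d i * (d i * y i) = 0` implies `d i * y i = 0`. -/
theorem IsDiagonalizable.mulVec_eq_zero {n : ℕ} {A : Matrix (Fin n) (Fin n) ℝ}
    (hA : IsDiagonalizable A) {x : Fin n → ℝ} (hx : A.mulVec (A.mulVec x) = 0) :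
    A.mulVec x = 0 := by
  obtain ⟨P, d, hP, hAP⟩ := hA
  set Ac := A.map Complex.ofReal with hAc
  have hmv : ∀ y : Fin n → ℝ, Ac.mulVec (fun i => (y i : ℂ)) = fun i => ((A.mulVec y i : ℝ) : ℂ) := by
    intro y
    ext i
    exact (RingHom.map_mulVec Complex.ofRealHom A y i).symm
  set y := P⁻¹.mulVec fun i => (x i : ℂ) with hy
  have hPy : P.mulVec y = fun i => (x i : ℂ) := by
    rw [hy, Matrix.mulVec_mulVec, Matrix.mul_nonsing_inv _ hP, Matrix.one_mulVec]
  have hinj : ∀ z, P.mulVec z = 0 → z = 0 := by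
    intro z hz
    have := congrArg P⁻¹.mulVec hz
    rwa [Matrix.mulVec_mulVec, Matrix.nonsing_inv_mul _ hP, Matrix.one_mulVec,
      Matrix.mulVec_zero] at this
  have h1 : ∀ z, Ac.mulVec (P.mulVec z) = P.mulVec ((Matrix.diagonal d).mulVec z) := by
    intro z
    rw [Matrix.mulVec_mulVec, hAP, ← Matrix.mulVec_mulVec]
  have h2 : (Matrix.diagonal d).mulVec ((Matrix.diagonal d).mulVec y) = 0 := by
    refine hinj _ ?_
    rw [← h1, ← h1, hPy, hmv, hmv, hx]
    ext; simp
  have h3 : (Matrix.diagonal d).mulVec y = 0 := by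
    ext i
    have := congrFun h2 i
    simp only [Matrix.mulVec_diagonal, Pi.zero_apply, mul_eq_zero] at this ⊢
    tauto
  have h4 := hmv x
  rw [← hPy, h1, h3, Matrix.mulVec_zero] at h4
  ext i
  have := congrFun h4 i
  simpa using this.symm

theorem inputReachable_of_edge {n m : ℕ} {A : StructMatrix (Fin n) (Fin n)}
    {B : StructMatrix (Fin n) (Fin m)} {i j : Fin n} (hj : InputReachable A B j)
    (h : A i j = true) : InputReachable A B i := by
  obtain ⟨k, hk⟩ := hj
  exact ⟨k, hk.tail h⟩

theorem inputReachable_of_input {n m : ℕ} {A : StructMatrix (Fin n) (Fin n)}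
    {B : StructMatrix (Fin n) (Fin m)} {i : Fin n} {k : Fin m} (h : B i k = true) :
    InputReachable A B i :=
  ⟨k, Relation.ReflTransGen.single h⟩

/-! ### Restriction to the input-reachable states and the generic left kernel -/

section

variable {n m : ℕ} (A : StructMatrix (Fin n) (Fin n)) (B : StructMatrix (Fin n) (Fin m))

/-- The condition on the row `i` is redundant, since successors of reachable states are reachable.
-/
theorem reachablePart_eq_true {i j : Fin n} :
    reachablePart A B i j = true ↔ InputReachable A B j ∧ A i j = true := by
  simp only [reachablePart, Matrix.of_apply]
  split_ifs with h
  · exact ⟨fun h' => ⟨h.2, h'⟩, fun h' => h'.2⟩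
  · refine ⟨fun h' => (by cases h'), fun h' => absurd ⟨inputReachable_of_edge h'.1 h'.2, h'.1⟩ h⟩

/-- The free entries of `Ā_r` as free entries of `Ā`. -/
def reachablePos (e : (reachablePart A B).Pos) : A.Pos :=
  ⟨e.1, ((reachablePart_eq_true A B).1 e.2).2⟩

theorem realize_reachablePart_apply_of_reachable (θ : A.Param) (i j : Fin n)
    (hj : InputReachable A B j) :
    (reachablePart A B).realize (θ ∘ reachablePos A B) i j = A.realize θ i j := by
  by_cases h : A i j = true
  · have h' := (reachablePart_eq_true A B).2 ⟨hj, h⟩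
    simp [StructMatrix.realize, h, h', reachablePos]
  · have h' : ¬ reachablePart A B i j = true := fun h' => h ((reachablePart_eq_true A B).1 h').2
    simp [StructMatrix.realize, h, h']

theorem realize_reachablePart_apply_eq_zero (θ : (reachablePart A B).Param) (i j : Fin n)
    (h : ¬ InputReachable A B i ∨ ¬ InputReachable A B j) :
    (reachablePart A B).realize θ i j = 0 := by
  refine StructMatrix.realize_eq_zero _ _ ?_
  have : ¬ (InputReachable A B i ∧ InputReachable A B j) := by tauto
  simp [reachablePart, this]

theorem realize_mulVec_of_support (θ : A.Param) {x : Fin n → ℝ}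
    (hx : ∀ j, ¬ InputReachable A B j → x j = 0) :
    (A.realize θ).mulVec x = ((reachablePart A B).realize (θ ∘ reachablePos A B)).mulVec x := by
  ext i
  simp only [Matrix.mulVec, dotProduct]
  refine Finset.sum_congr rfl fun j _ => ?_
  by_cases hj : InputReachable A B j
  · rw [realize_reachablePart_apply_of_reachable A B θ i j hj]
  · simp [hx j hj]

theorem realize_reachablePart_mulVec_support (θ : (reachablePart A B).Param) (x : Fin n → ℝ)
    (i : Fin n) (hi : ¬ InputReachable A B i) :
    ((reachablePart A B).realize θ).mulVec x i = 0 := by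
  simp only [Matrix.mulVec, dotProduct]
  exact Finset.sum_eq_zero fun j _ => by
    rw [realize_reachablePart_apply_eq_zero A B θ i j (Or.inl hi), zero_mul]

/-- The columns of `B` are supported on reachable states; on such vectors `A` and `A_r` agree, and
the image is again so supported. -/
theorem ctrbMatrix_realize_eq (θ : A.Param) (θ' : B.Param) :
    ctrbMatrix (A.realize θ) (B.realize θ') =
      ctrbMatrix ((reachablePart A B).realize (θ ∘ reachablePos A B)) (B.realize θ') := by
  have key : ∀ (k : ℕ) (j : Fin m), (∀ i, ¬ InputReachable A B i →
      (((reachablePart A B).realize (θ ∘ reachablePos A B)) ^ k * B.realize θ') i j = 0) ∧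
      ∀ i, (A.realize θ ^ k * B.realize θ') i j =
      (((reachablePart A B).realize (θ ∘ reachablePos A B)) ^ k * B.realize θ') i j := by
    intro k j
    induction k with
    | zero =>
      refine ⟨fun i hi => ?_, fun i => by simp⟩
      rw [pow_zero, Matrix.one_mul]
      refine B.realize_eq_zero θ' ?_
      by_contra h
      exact hi (inputReachable_of_input (by simpa using h))
    | succ k ih =>
      have hcol : ∀ (X : Matrix (Fin n) (Fin n) ℝ) (Y : Matrix (Fin n) (Fin m) ℝ) i,
          (X * Y) i j = X.mulVec (fun l => Y l j) i := fun X Y i => rfl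
      refine ⟨fun i hi => ?_, fun i => ?_⟩
      · rw [pow_succ', Matrix.mul_assoc, hcol]
        exact realize_reachablePart_mulVec_support A B _ _ i hi
      · rw [pow_succ', Matrix.mul_assoc, hcol, pow_succ', Matrix.mul_assoc, hcol,
          ← realize_mulVec_of_support A B θ ih.1]
        congr 2
        ext l
        exact ih.2 l
  ext i c
  exact (key c.1 c.2).2 i

/-- `A_r x` is `A` applied to the reachable part of `x`, and `A_r x` is itself supported on
reachable states. Thus `A_r (A_r x) = 0` puts the reachable part of `x` into `ker A ^ 2 = ker A`,
and all positive powers of `A_r` have the same kernel. -/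
theorem rank_realize_reachablePart_le_pow (θ : A.Param) (hA : IsDiagonalizable (A.realize θ)) :
    ((reachablePart A B).realize (θ ∘ reachablePos A B)).rank ≤
      ((reachablePart A B).realize (θ ∘ reachablePos A B) ^ n).rank := by
  classical
  set N := (reachablePart A B).realize (θ ∘ reachablePos A B) with hN
  have hproj : ∀ x : Fin n → ℝ,
      N.mulVec x = (A.realize θ).mulVec fun j => if InputReachable A B j then x j else 0 := by
    intro x
    rw [realize_mulVec_of_support A B θ (fun j hj => by simp [hj])]
    ext i
    simp only [Matrix.mulVec, dotProduct]
    refine Finset.sum_congr rfl fun j _ => ?_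
    by_cases hj : InputReachable A B j
    · simp [hj, hN]
    · simp [hN, hj, realize_reachablePart_apply_eq_zero A B _ i j (Or.inr hj)]
  have h2 : ∀ x, N.mulVec (N.mulVec x) = 0 → N.mulVec x = 0 := by
    intro x hx
    have h3 := realize_mulVec_of_support A B θ (x := N.mulVec x) fun j hj =>
      realize_reachablePart_mulVec_support A B _ _ j hj
    rw [← hN, hx, hproj x] at h3
    rw [hproj]
    exact hA.mulVec_eq_zero h3
  have hpow : ∀ k x, (N ^ (k + 1)).mulVec x = 0 → N.mulVec x = 0 := by
    intro k
    induction k with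
    | zero => intro x hx; simpa using hx
    | succ k ih =>
      intro x hx
      rw [pow_succ, ← Matrix.mulVec_mulVec] at hx
      exact h2 x (ih _ hx)
  rcases n with - | n
  · exact (Matrix.rank_le_card_height _).trans (by simp)
  · rw [← Matrix.rank_transpose, ← Matrix.rank_transpose (N ^ (n + 1))]
    refine Matrix.rank_le_of_vecMul fun w hw => ?_
    rw [Matrix.vecMul_transpose] at hw ⊢
    exact hpow n w hw

theorem vecMul_fromCols_eq_zero_iff {a κ ι : Type} [Fintype a] (X : Matrix a κ ℝ)
    (Y : Matrix a ι ℝ) (w : a → ℝ) : Matrix.vecMul w (Matrix.fromCols X Y) = 0 ↔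
      Matrix.vecMul w X = 0 ∧ Matrix.vecMul w Y = 0 := by
  rw [Matrix.vecMul_fromCols]
  constructor
  · intro h
    exact ⟨funext fun i => congrFun h (Sum.inl i), funext fun i => congrFun h (Sum.inr i)⟩
  · rintro ⟨h, h'⟩
    rw [h, h']
    ext (i | i) <;> rfl

theorem vecMul_ctrbMatrix_eq_zero_of_fromCols {N : Matrix (Fin n) (Fin n) ℝ}
    {B' : Matrix (Fin n) (Fin m) ℝ} {w : Fin n → ℝ}
    (h : Matrix.vecMul w (Matrix.fromCols N B') = 0) : Matrix.vecMul w (ctrbMatrix N B') = 0 := by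
  obtain ⟨h1, h2⟩ := (vecMul_fromCols_eq_zero_iff _ _ _).1 h
  have := (vecMul_mul_ctrbMatrix_eq_zero_iff (A := N) (B := B') (C := 1) (w := w)).2 fun k => by
    rw [Matrix.vecMul_one]
    cases k with
    | zero => rw [pow_zero, Matrix.one_mul, h2]
    | succ k => rw [pow_succ', Matrix.mul_assoc, ← Matrix.vecMul_vecMul, h1, Matrix.zero_vecMul]
  rwa [Matrix.one_mul] at this

/-- The realization of `Ā_r` at a joint parameter vector of `Ā` and `B̄`. -/
noncomputable def realizeReachable (x : A.Pos ⊕ B.Pos → ℝ) : Matrix (Fin n) (Fin n) ℝ :=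
  (reachablePart A B).realize ((x ∘ Sum.inl) ∘ reachablePos A B)

theorem exists_realizeReachable_eq {N : Matrix (Fin n) (Fin n) ℝ} {B' : Matrix (Fin n) (Fin m) ℝ}
    (hN : ∀ i j, reachablePart A B i j = false → N i j = 0) (hB : ∀ i k, B i k = false → B' i k = 0) :
    ∃ x : A.Pos ⊕ B.Pos → ℝ, realizeReachable A B x = N ∧ B.realize (x ∘ Sum.inr) = B' := by
  obtain ⟨θ, rfl⟩ := B.exists_realize_eq B' hB
  refine ⟨Sum.elim (fun e => N e.1.1 e.1.2) θ, ?_, rfl⟩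
  ext i j
  by_cases h : reachablePart A B i j = true
  · simp [realizeReachable, StructMatrix.realize, h, reachablePos]
  · simp [realizeReachable, StructMatrix.realize, h, hN i j (by simpa using h)]

/-- Generically the left kernels of `Q(A,B)` and of `[A_r,B]` agree. -/
theorem holdsGenerically_left_kernel (hA : GenericallyDiagonalizable A) :
    HoldsGenerically fun x : A.Pos ⊕ B.Pos → ℝ => ∀ w,
      Matrix.vecMul w (ctrbMatrix (A.realize (x ∘ Sum.inl)) (B.realize (x ∘ Sum.inr))) = 0 →
      Matrix.vecMul w (Matrix.fromCols (realizeReachable A B x) (B.realize (x ∘ Sum.inr))) = 0 := by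
  obtain ⟨V, hV, hdiag⟩ := hA
  obtain ⟨θ, hθ⟩ := exists_rank_eq_genericRank fun θ : (reachablePart A B).Param =>
    (reachablePart A B).realize θ ^ n
  obtain ⟨N, B', hN, hB', hrank⟩ := exists_realization_rank_pow_le A B θ
  obtain ⟨x₀, rfl, rfl⟩ := exists_realizeReachable_eq A B hN hB'
  have hpolyA : IsPolyMatrix (realizeReachable A B) :=
    (reachablePart A B).isPolyMatrix_realize (Sum.inl ∘ reachablePos A B)
  have hpolyB : IsPolyMatrix fun x : A.Pos ⊕ B.Pos → ℝ => B.realize (x ∘ Sum.inr) :=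
    B.isPolyMatrix_realize Sum.inr
  refine ((hV.holdsGenerically.comp Sum.inl Sum.inl_injective).and
    (((hpolyA.pow n).mul (hpolyA.ctrbMatrix hpolyB)).holdsGenerically_rank_le x₀)).mono ?_
  rintro x ⟨hx, hr⟩ w hw
  have hctrb := ctrbMatrix_realize_eq A B (x ∘ Sum.inl) (x ∘ Sum.inr)
  change _ = ctrbMatrix (realizeReachable A B x) _ at hctrb
  rw [hctrb] at hw
  set X := realizeReachable A B x with hX
  set Y := B.realize (x ∘ Sum.inr)
  -- The rank of the `n`-th power is at most its maximum, attained at `θ`; the special realization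
  -- at `x₀` reaches it with the product, and a generic `x` does no worse than `x₀`.
  have hmax : (X ^ n).rank ≤ (X ^ n * ctrbMatrix X Y).rank :=
    (rank_le_genericRank (fun θ : (reachablePart A B).Param => (reachablePart A B).realize θ ^ n)
      _).trans (hθ.symm.le.trans (hrank.trans hr))
  have hw' := (vecMul_mul_ctrbMatrix_eq_zero_iff (A := X) (B := Y) (C := 1) (w := w)).1
    (by rwa [Matrix.one_mul])
  rw [Matrix.vecMul_one] at hw'
  have h1 : Matrix.vecMul w (X ^ n * ctrbMatrix X Y) = 0 := by
    rw [vecMul_mul_ctrbMatrix_eq_zero_iff]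
    intro k
    rw [Matrix.vecMul_vecMul, ← Matrix.mul_assoc, ← pow_add]
    exact hw' _
  have h2 : Matrix.vecMul w (X ^ n) = 0 := Matrix.vecMul_eq_zero_of_rank_le
    (fun w hw => by rw [← Matrix.vecMul_vecMul, hw, Matrix.zero_vecMul]) hmax h1
  -- Equal ranks of `X` and `X ^ n` identify their left kernels; for `n = 0` there is nothing to
  -- show.
  have h3 : Matrix.vecMul w X = 0 := by
    have hle := rank_realize_reachablePart_le_pow A B (x ∘ Sum.inl) (hdiag _ hx)
    rcases Nat.eq_zero_or_pos n with rfl | hn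
    · exact Subsingleton.elim _ _
    · refine Matrix.vecMul_eq_zero_of_rank_le (fun w hw => ?_) hle h2
      obtain ⟨k, rfl⟩ := Nat.exists_eq_succ_of_ne_zero hn.ne'
      rw [pow_succ', ← Matrix.vecMul_vecMul, hw, Matrix.zero_vecMul]
  have h4 := hw' 0
  rw [pow_zero, Matrix.one_mul] at h4
  exact (vecMul_fromCols_eq_zero_iff _ _ _).2 ⟨h3, h4⟩

theorem vecMul_ctrbMatrix_eq_zero_of_realizeReachable (x : A.Pos ⊕ B.Pos → ℝ) {w : Fin n → ℝ}
    (hw : Matrix.vecMul w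
      (Matrix.fromCols (realizeReachable A B x) (B.realize (x ∘ Sum.inr))) = 0) :
    Matrix.vecMul w (ctrbMatrix (A.realize (x ∘ Sum.inl)) (B.realize (x ∘ Sum.inr))) = 0 := by
  rw [ctrbMatrix_realize_eq A B]
  exact vecMul_ctrbMatrix_eq_zero_of_fromCols hw

theorem isPolyMatrix_fromCols : IsPolyMatrix fun x : A.Pos ⊕ B.Pos → ℝ =>
    Matrix.fromCols (realizeReachable A B x) (B.realize (x ∘ Sum.inr)) :=
  IsPolyMatrix.fromCols ((reachablePart A B).isPolyMatrix_realize (Sum.inl ∘ reachablePos A B))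
    (B.isPolyMatrix_realize Sum.inr)

/-- For a generically diagonalizable `Ā`, the generic dimension of the controllable subspace is the
generic rank of `[Ā_r, B̄]`. -/
theorem grank_fromCols_eq_grankCtrb (hA : GenericallyDiagonalizable A) :
    StructMatrix.grank (Matrix.fromCols (reachablePart A B) B) = grankCtrb A B := by
  refine le_antisymm ?_ ?_
  · obtain ⟨φ, hφ⟩ := exists_rank_eq_genericRank
      (StructMatrix.realize (Matrix.fromCols (reachablePart A B) B))
    rw [StructMatrix.grank, ← hφ]
    set X : Matrix (Fin n) (Fin n ⊕ Fin m) ℝ :=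
      StructMatrix.realize (Matrix.fromCols (reachablePart A B) B) φ with hX
    obtain ⟨x₀, hx₁, hx₂⟩ := exists_realizeReachable_eq A B (N := X.toCols₁) (B' := X.toCols₂)
      (fun i j hij => StructMatrix.realize_eq_zero (Matrix.fromCols (reachablePart A B) B) φ
        (j := Sum.inl j) hij)
      (fun i k hik => StructMatrix.realize_eq_zero (Matrix.fromCols (reachablePart A B) B) φ
        (j := Sum.inr k) hik)
    have hx₀ := Matrix.fromCols_toCols X
    rw [← hx₁, ← hx₂] at hx₀
    -- The rank maximizer `x₀` need not lie where the left kernels agree, but a generic `x` keeps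
    -- its rank and has this property.
    obtain ⟨x, hx, hr⟩ := ((holdsGenerically_left_kernel A B hA).and
      ((isPolyMatrix_fromCols A B).holdsGenerically_rank_le x₀)).exists
    rw [hx₀] at hr
    exact hr.trans ((Matrix.rank_le_of_vecMul hx).trans (rank_le_genericRank
      (fun θ : A.Param × B.Param => ctrbMatrix (A.realize θ.1) (B.realize θ.2))
      (x ∘ Sum.inl, x ∘ Sum.inr)))
  · obtain ⟨⟨θ, θ'⟩, hφ⟩ := exists_rank_eq_genericRank
      fun θ : A.Param × B.Param => ctrbMatrix (A.realize θ.1) (B.realize θ.2)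
    rw [grankCtrb, ← hφ]
    refine (Matrix.rank_le_of_vecMul fun w hw =>
      vecMul_ctrbMatrix_eq_zero_of_realizeReachable A B (Sum.elim θ θ') hw).trans ?_
    obtain ⟨φ, hφ⟩ := StructMatrix.exists_realize_eq (Matrix.fromCols (reachablePart A B) B)
      (Matrix.fromCols (realizeReachable A B (Sum.elim θ θ')) (B.realize θ')) (by
        rintro i (j | k) h
        · exact StructMatrix.realize_eq_zero (reachablePart A B) _ h
        · exact StructMatrix.realize_eq_zero B _ h)
    change (Matrix.fromCols (realizeReachable A B (Sum.elim θ θ')) (B.realize θ')).rank ≤ _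
    rw [← hφ]
    exact rank_le_genericRank _ φ

end

/-! ### Linkings of the layered digraph -/

section

variable {n m p : ℕ}

/-- The source vertex of the layered digraph for a column of `[Ā_r, B̄]`. -/
def LayerVertex.source : Fin n ⊕ Fin m → LayerVertex n m p :=
  Sum.elim LayerVertex.x2 LayerVertex.u2

theorem LayerVertex.source_injective :
    Function.Injective (LayerVertex.source : Fin n ⊕ Fin m → LayerVertex n m p) := by
  rintro (i | i) (j | j) h <;> simp_all [LayerVertex.source]

/-- Edges lead only from the sources to `X¹` and from there to `Y⁰`, which leaves no room for paths
of another length. -/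
theorem isSimplePath_layeredDigraph {M : StructMatrix (Fin n) (Fin n)}
    {B : StructMatrix (Fin n) (Fin m)} {C : StructMatrix (Fin p) (Fin n)}
    {l : List (LayerVertex n m p)}
    (h : IsSimplePath (layeredDigraph M B C) LayerVertex.IsSource LayerVertex.IsSink l) :
    ∃ c j k, l = [LayerVertex.source c, .x1 j, .y0 k] ∧ Matrix.fromCols M B j c = true ∧
      C k j = true := by
  obtain ⟨hch, -, ⟨v, hv, hvS⟩, w, hw, hwT⟩ := h
  rcases l with - | ⟨a, - | ⟨b, - | ⟨c, - | ⟨d, l⟩⟩⟩⟩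
  · simp at hv
  · simp only [List.head?_cons, List.getLast?_singleton, Option.some.injEq] at hv hw
    subst hv; subst hw
    cases a <;> simp_all [LayerVertex.IsSource, LayerVertex.IsSink]
  · simp at hv hw hch
    subst hv; subst hw
    cases a <;> cases b <;> simp_all [LayerVertex.IsSource, LayerVertex.IsSink, layeredDigraph]
  · simp at hv hw hch
    subst hv; subst hw
    cases a <;> cases b <;> cases c <;>
      simp_all [LayerVertex.IsSource, LayerVertex.IsSink, layeredDigraph, LayerVertex.source]
  · simp at hv hch
    subst hv
    cases a <;> cases b <;> cases c <;> cases d <;>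
      simp_all [LayerVertex.IsSource, layeredDigraph]

/-- A full linking is a pair of compatible matchings. -/
theorem hasFullLinking_iff {A : StructMatrix (Fin n) (Fin n)} {B : StructMatrix (Fin n) (Fin m)}
    {C : StructMatrix (Fin p) (Fin n)} :
    HasFullLinking A B C ↔ ∃ (f : Fin p → Fin n) (g : Fin p → Fin n ⊕ Fin m),
      Function.Injective f ∧ Function.Injective g ∧ (∀ k, C k (f k) = true) ∧
      ∀ k, Matrix.fromCols (reachablePart A B) B (f k) (g k) = true := by
  constructor
  · rintro ⟨P, hP, hdis⟩
    choose c j k hl hM hC using fun a => isSimplePath_layeredDigraph (hP a)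
    have hc : Function.Injective c := by
      intro a b hab
      by_contra hne
      have := hdis a b hne
      simp [hl, hab, List.Disjoint] at this
    have hj : Function.Injective j := by
      intro a b hab
      by_contra hne
      have := hdis a b hne
      simp [hl, hab, List.Disjoint] at this
    have hk : Function.Injective k := by
      intro a b hab
      by_contra hne
      have := hdis a b hne
      simp [hl, hab, List.Disjoint] at this
    -- The `p` disjoint paths end in `p` distinct sinks, so they can be indexed by their sinks.
    let e := Equiv.ofBijective k (Finite.injective_iff_bijective.1 hk)
    have he : ∀ y, k (e.symm y) = y := e.apply_symm_apply
    refine ⟨j ∘ e.symm, c ∘ e.symm, hj.comp e.symm.injective, hc.comp e.symm.injective,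
      fun y => ?_, fun y => hM _⟩
    have := hC (e.symm y)
    rwa [he] at this
  · rintro ⟨f, g, hf, hg, hC, hM⟩
    refine ⟨fun a => [LayerVertex.source (g a), .x1 (f a), .y0 a], fun a => ⟨?_, ?_, ?_, ?_⟩,
      fun a b hab => ?_⟩
    · have h1 := hM a
      have h2 := hC a
      rcases h : g a with i | i <;> rw [h] at h1 <;>
        simp_all [LayerVertex.source, layeredDigraph]
    · rcases h : g a with i | i <;> simp [LayerVertex.source, h]
    · refine ⟨_, rfl, ?_⟩
      rcases g a with i | i <;> simp [LayerVertex.source, LayerVertex.IsSource]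
    · exact ⟨_, rfl, trivial⟩
    · have h1 : f a ≠ f b := hf.ne hab
      have h2 : g a ≠ g b := hg.ne hab
      have h3 : (LayerVertex.source (g a) : LayerVertex n m p) ≠ .source (g b) :=
        LayerVertex.source_injective.ne h2
      have h4 : ∀ c : Fin n ⊕ Fin m, ∀ j, (LayerVertex.source c : LayerVertex n m p) ≠ .x1 j := by
        rintro (i | i) j <;> simp [LayerVertex.source]
      have h5 : ∀ c : Fin n ⊕ Fin m, ∀ j, (LayerVertex.source c : LayerVertex n m p) ≠ .y0 j := by
        rintro (i | i) j <;> simp [LayerVertex.source]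
      simp [List.Disjoint, hab, h1, h3, h4, h5, (h4 _ _).symm, (h5 _ _).symm]

/-! ### Matchings from nonsingular products -/

/-- The rows of `X * Y` are combinations of rows of `Y`. Expanding the determinant by multilinearity
leaves some nonzero term, which is one choice `f` of rows. -/
theorem Matrix.exists_of_det_mul_ne_zero {κ : Type} [Fintype κ] {X : Matrix (Fin p) κ ℝ}
    {Y : Matrix κ (Fin p) ℝ} (h : (X * Y).det ≠ 0) :
    ∃ f : Fin p → κ, (∀ i, X i (f i) ≠ 0) ∧ (Y.submatrix f id).det ≠ 0 := by
  classical
  have hrow : (X * Y).det = Matrix.detRowAlternating fun i => ∑ j, X i j • Y j := by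
    congr 1
    ext i k
    simp [Matrix.mul_apply]
  have hsum := (Matrix.detRowAlternating (n := Fin p) (R := ℝ)).toMultilinearMap.map_sum
    fun i j => X i j • Y j
  rw [hrow] at h
  change (Matrix.detRowAlternating (n := Fin p) (R := ℝ)).toMultilinearMap _ ≠ 0 at h
  rw [hsum] at h
  obtain ⟨f, -, hf⟩ := Finset.exists_ne_zero_of_sum_ne_zero h
  rw [MultilinearMap.map_smul_univ, smul_eq_mul] at hf
  exact ⟨f, fun i => Finset.prod_ne_zero_iff.1 (left_ne_zero_of_mul hf) i (Finset.mem_univ i),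
    right_ne_zero_of_mul hf⟩

/-- If `C M` has full row rank, then there are matchings in `C` and `M` that fit together. -/
theorem Matrix.exists_matchings_of_rank {κ ι : Type} [Fintype κ] [Fintype ι]
    {C : Matrix (Fin p) κ ℝ} {M : Matrix κ ι ℝ} (h : (C * M).rank = p) :
    ∃ (f : Fin p → κ) (g : Fin p → ι), Function.Injective f ∧ Function.Injective g ∧
      (∀ k, C k (f k) ≠ 0) ∧ ∀ k, M (f k) (g k) ≠ 0 := by
  classical
  have hLR := (C * M).exists_mul_mul_eq_one
  rw [h] at hLR
  obtain ⟨L, R, hLR⟩ := hLR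
  have h1 : (C * (M * R)).det ≠ 0 := by
    intro h0
    have := congrArg Matrix.det hLR
    rw [Matrix.mul_assoc, Matrix.mul_assoc C, Matrix.det_mul, h0] at this
    simp at this
  obtain ⟨f, hf, h2⟩ := Matrix.exists_of_det_mul_ne_zero h1
  -- After rows have been selected by `f`, the transpose lets the same expansion select columns.
  have h3 : (R.transpose * (M.submatrix f id).transpose).det ≠ 0 := by
    rw [← Matrix.transpose_mul, Matrix.det_transpose]
    exact h2
  obtain ⟨g, -, h4⟩ := Matrix.exists_of_det_mul_ne_zero h3
  rw [← Matrix.det_transpose, Matrix.transpose_submatrix, Matrix.transpose_transpose] at h4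
  have hfinj : Function.Injective f := by
    intro a b hab
    by_contra hne
    exact h4 (Matrix.det_zero_of_row_eq hne (by ext j; simp [hab]))
  have hginj : Function.Injective g := by
    intro a b hab
    by_contra hne
    exact h4 (Matrix.det_zero_of_column_eq hne (by intro j; simp [hab]))
  -- The selected square block of `M` is nonsingular; a nonzero Leibniz term supplies the
  -- permutation that pairs its rows and columns.
  rw [Matrix.det_apply'] at h4
  obtain ⟨τ, -, hτ⟩ := Finset.exists_ne_zero_of_sum_ne_zero h4
  refine ⟨f, g ∘ τ.symm, hfinj, hginj.comp τ.symm.injective, hf, fun k => ?_⟩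
  have := Finset.prod_ne_zero_iff.1 (right_ne_zero_of_mul hτ) (τ.symm k) (Finset.mem_univ _)
  simpa using this

/-- For a generically diagonalizable `Ā`, the matrix `C Q(A,B)` has full row rank for some
realization if and only if there is a full linking. -/
theorem exists_rank_output_eq_iff (A : StructMatrix (Fin n) (Fin n))
    (B : StructMatrix (Fin n) (Fin m)) (C : StructMatrix (Fin p) (Fin n))
    (hA : GenericallyDiagonalizable A) :
    (∃ (θA : A.Param) (θB : B.Param) (θC : C.Param),
      (C.realize θC * ctrbMatrix (A.realize θA) (B.realize θB)).rank = p) ↔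
      HasFullLinking A B C := by
  classical
  rw [hasFullLinking_iff]
  constructor
  · rintro ⟨θA, θB, θC, h⟩
    have hpat : ∀ i c, Matrix.fromCols (reachablePart A B) B i c = false →
        Matrix.fromCols (realizeReachable A B (Sum.elim θA θB)) (B.realize θB) i c = 0 := by
      rintro i (j | k) hi
      · exact StructMatrix.realize_eq_zero (reachablePart A B) _ hi
      · exact StructMatrix.realize_eq_zero B _ hi
    have hle := Matrix.rank_le_of_vecMul
      (X := C.realize θC * ctrbMatrix (A.realize θA) (B.realize θB))
      (Y := C.realize θC * Matrix.fromCols (realizeReachable A B (Sum.elim θA θB)) (B.realize θB))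
      fun w hw => by
        rw [← Matrix.vecMul_vecMul] at hw ⊢
        exact vecMul_ctrbMatrix_eq_zero_of_realizeReachable A B (Sum.elim θA θB) hw
    rw [h] at hle
    obtain ⟨f, g, hf, hg, hC, hM⟩ := Matrix.exists_matchings_of_rank
      (le_antisymm ((Matrix.rank_le_card_height _).trans_eq (Fintype.card_fin p)) hle)
    refine ⟨f, g, hf, hg, fun k => ?_, fun k => ?_⟩
    · by_contra h0
      exact hC k (C.realize_eq_zero θC (Bool.eq_false_of_not_eq_true h0))
    · by_contra h0
      exact hM k (hpat _ _ (Bool.eq_false_of_not_eq_true h0))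
  · rintro ⟨f, g, hf, hg, hC, hM⟩
    obtain ⟨θC, hθC⟩ := C.exists_realize_eq (Matrix.of fun k j => if j = f k then 1 else 0) (by
      intro k j hkj
      rw [Matrix.of_apply, if_neg]
      rintro rfl
      rw [hC] at hkj
      cases hkj)
    -- The 0/1 matrices supported on the two matchings have a product that a column selection turns
    -- into the identity.
    let M₀ : Matrix (Fin n) (Fin n ⊕ Fin m) ℝ :=
      Matrix.of fun i c => if ∃ k, i = f k ∧ c = g k then 1 else 0
    have hM₀ : ∀ i c, Matrix.fromCols (reachablePart A B) B i c = false → M₀ i c = 0 := by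
      intro i c hic
      simp only [M₀, Matrix.of_apply]
      rw [if_neg]
      rintro ⟨k, rfl, rfl⟩
      rw [hM] at hic
      cases hic
    obtain ⟨x₀, hx₁, hx₂⟩ := exists_realizeReachable_eq A B (N := M₀.toCols₁) (B' := M₀.toCols₂)
      (fun i j hij => hM₀ i (Sum.inl j) hij) (fun i k hik => hM₀ i (Sum.inr k) hik)
    have hx₀ := Matrix.fromCols_toCols M₀
    rw [← hx₁, ← hx₂] at hx₀
    have hrank₀ : p ≤ (C.realize θC * M₀).rank := by
      have hone : C.realize θC * M₀ * (Matrix.of fun c k => if c = g k then (1 : ℝ) else 0) = 1 := by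
        ext k k'
        rw [Matrix.mul_apply, Finset.sum_eq_single (g k'), Matrix.mul_apply,
          Finset.sum_eq_single (f k)]
        · by_cases hk : k = k'
          · subst hk
            have : ∃ k', f k = f k' ∧ g k = g k' := ⟨k, rfl, rfl⟩
            simp [hθC, M₀, this]
          · have : ¬ ∃ k'', f k = f k'' ∧ g k' = g k'' := by
              rintro ⟨k'', h1, h2⟩
              exact hk ((hf h1).trans (hg h2).symm)
            simp [hθC, M₀, hk, this]
        · intro j _ hj; simp [hθC, hj]
        · simp
        · intro c _ hc; simp [hc]
        · simp
      have := Matrix.rank_mul_le_left (C.realize θC * M₀)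
        (Matrix.of fun c k => if c = g k then (1 : ℝ) else 0)
      rwa [hone, Matrix.rank_one, Fintype.card_fin] at this
    -- With `C` fixed, a generic point keeps the rank of `C [A_r, B]`; the inclusion of left
    -- kernels, applied to `w C`, transfers it to `C Q`.
    obtain ⟨x, hx, hr⟩ := ((holdsGenerically_left_kernel A B hA).and
      (((IsPolyMatrix.const (C.realize θC)).mul
        (isPolyMatrix_fromCols A B)).holdsGenerically_rank_le x₀)).exists
    rw [hx₀] at hr
    refine ⟨x ∘ Sum.inl, x ∘ Sum.inr, θC, le_antisymm ((Matrix.rank_le_card_height _).trans_eq (Fintype.card_fin p)) ?_⟩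
    · refine (hrank₀.trans hr).trans (Matrix.rank_le_of_vecMul fun w hw => ?_)
      rw [← Matrix.vecMul_vecMul] at hw ⊢
      exact hx _ hw

end

/-! ### Output controllability and the rank of `C Q(A,B)` -/

section OutputControllability

open MeasureTheory

variable {n m p : ℕ}

/-- Multiplication by a matrix as a continuous linear map. -/
noncomputable def Matrix.mulVecCLM {a b : ℕ} (M : Matrix (Fin a) (Fin b) ℝ) :
    (Fin b → ℝ) →L[ℝ] (Fin a → ℝ) :=
  LinearMap.toContinuousLinearMap M.mulVecLin

@[simp]
theorem Matrix.mulVecCLM_apply {a b : ℕ} (M : Matrix (Fin a) (Fin b) ℝ) (x : Fin b → ℝ) :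
    M.mulVecCLM x = M.mulVec x := rfl

/-- A continuous solution of `z(t) = ∫₀ᵗ K z` vanishes. -/
theorem eq_zero_of_integral_eq {r : ℕ} (K : Matrix (Fin r) (Fin r) ℝ) {T : ℝ}
    {z : ℝ → Fin r → ℝ} (hz : ContinuousOn z (Set.Icc 0 T))
    (h : ∀ t ∈ Set.Icc 0 T, z t = ∫ s in (0 : ℝ)..t, K.mulVec (z s)) :
    ∀ t ∈ Set.Icc 0 T, z t = 0 := by
  intro t ht
  have hT : 0 ≤ T := ht.1.trans ht.2
  have hKz : ContinuousOn (fun s => K.mulVec (z s)) (Set.Icc 0 T) :=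
    K.mulVecCLM.continuous.comp_continuousOn hz
  have hderiv : ∀ s ∈ Set.Ico 0 T, HasDerivWithinAt z (K.mulVec (z s)) (Set.Ici s) s := by
    intro s hs
    have hs' : s ∈ Set.Icc 0 T := ⟨hs.1, hs.2.le⟩
    have hint : IntervalIntegrable (fun s => K.mulVec (z s)) volume 0 s :=
      (hKz.mono (Set.Icc_subset_Icc_right hs.2.le)).intervalIntegrable_of_Icc hs.1
    have hc : ContinuousWithinAt (fun s => K.mulVec (z s)) (Set.Icc s T) s :=
      (hKz s hs').mono (Set.Icc_subset_Icc_left hs.1)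
    have hmeas : StronglyMeasurableAtFilter (fun s => K.mulVec (z s))
        (nhdsWithin s (Set.Ioi s)) volume :=
      (hKz.mono (Set.Icc_subset_Icc_left hs.1)).stronglyMeasurableAtFilter_nhdsWithin
        measurableSet_Icc s |>.filter_mono (by
          rw [← nhdsWithin_Ioc_eq_nhdsGT hs.2]
          exact nhdsWithin_mono _ Set.Ioc_subset_Icc_self)
    have hc' : ContinuousWithinAt (fun s => K.mulVec (z s)) (Set.Ioi s) s := by
      have := hc.mono Set.Ioc_subset_Icc_self
      rwa [ContinuousWithinAt, nhdsWithin_Ioc_eq_nhdsGT hs.2] at this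
    have h1 := intervalIntegral.integral_hasDerivWithinAt_right (s := Set.Ici s) hint hmeas hc'
    refine h1.congr_of_eventuallyEq ?_ (h s hs')
    filter_upwards [Icc_mem_nhdsGE hs.2] with y hy
    exact h y ⟨hs.1.trans hy.1, hy.2⟩
  have hz0 : z 0 = 0 := by
    rw [h 0 ⟨le_rfl, hT⟩, intervalIntegral.integral_same]
  -- Grönwall's inequality with zero initial value and zero inhomogeneity.
  have hb := norm_le_gronwallBound_of_norm_deriv_right_le (K := ‖K.mulVecCLM‖) (δ := 0) (ε := 0)
    hz hderiv (by rw [hz0, norm_zero]) (fun s _ => by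
      rw [add_zero]
      exact K.mulVecCLM.le_opNorm (z s)) t ht
  rw [gronwallBound_ε0_δ0] at hb
  exact norm_le_zero_iff.1 hb

/-- A trajectory that starts at the origin stays in the controllable subspace. -/
theorem IsTrajectory.dotProduct_eq_zero {A : Matrix (Fin n) (Fin n) ℝ}
    {B : Matrix (Fin n) (Fin m) ℝ} {T : ℝ} {u : ℝ → Fin m → ℝ} {x : ℝ → Fin n → ℝ}
    (h : IsTrajectory A B T u x) (hx0 : x 0 = 0) (hT : 0 ≤ T) {v : Fin n → ℝ}
    (hv : ∀ k, Matrix.vecMul v (A ^ k * B) = 0) : v ⬝ᵥ x T = 0 := by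
  obtain ⟨hu, hx, heq⟩ := h
  let U : Submodule ℝ (Fin n → ℝ) :=
    { carrier := {v | ∀ k : ℕ, Matrix.vecMul v (A ^ k * B) = 0}
      add_mem' := fun {a b} ha hb k => by rw [Matrix.add_vecMul, ha k, hb k, add_zero]
      zero_mem' := fun k => Matrix.zero_vecMul _
      smul_mem' := fun c a ha k => by rw [Matrix.smul_vecMul, ha k, smul_zero] }
  have hUA : ∀ v ∈ U, Matrix.vecMul v A ∈ U := by
    intro v hv k
    rw [Matrix.vecMul_vecMul, ← Matrix.mul_assoc, ← pow_succ']
    exact hv (k + 1)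
  -- The rows of `O` are a basis of the annihilator `U`. Invariance of `U` gives `O A = K O` and `O
  -- B = 0`, so `O x` solves a homogeneous equation that starts at zero.
  let b := Module.finBasis ℝ U
  let O : Matrix (Fin (Module.finrank ℝ U)) (Fin n) ℝ := Matrix.of fun i => (b i : Fin n → ℝ)
  let K : Matrix (Fin (Module.finrank ℝ U)) (Fin (Module.finrank ℝ U)) ℝ :=
    Matrix.of fun i j => b.repr ⟨_, hUA _ (b i).2⟩ j
  have hrepr : ∀ y : U, Matrix.vecMul (b.repr y) O = y := by
    intro y
    have h1 := congrArg Subtype.val (b.sum_repr y)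
    rw [Submodule.coe_sum] at h1
    rw [← h1, Matrix.vecMul_eq_sum]
    rfl
  have hOA : O * A = K * O := by
    refine funext fun i => ?_
    change Matrix.vecMul (b i : Fin n → ℝ) A = Matrix.vecMul (b.repr ⟨_, hUA _ (b i).2⟩) O
    rw [hrepr]
  have hOB : O * B = 0 := by
    refine funext fun i => ?_
    change Matrix.vecMul (b i : Fin n → ℝ) B = 0
    have := (b i).2 0
    rwa [pow_zero, Matrix.one_mul] at this
  have hz := eq_zero_of_integral_eq K (T := T) (z := fun t => O.mulVec (x t))
    (O.mulVecCLM.continuous.comp_continuousOn hx) (fun t ht => by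
      have hAx : IntervalIntegrable (fun s => A.mulVec (x s)) volume 0 t :=
        ContinuousOn.intervalIntegrable_of_Icc ht.1
          ((A.mulVecCLM.continuous.comp_continuousOn hx).mono (Set.Icc_subset_Icc_right ht.2))
      have hut : IntervalIntegrable u volume 0 t := hu.mono_set (by
        rw [Set.uIcc_of_le ht.1, Set.uIcc_of_le hT]
        exact Set.Icc_subset_Icc_right ht.2)
      have hBu : IntervalIntegrable (fun s => B.mulVec (u s)) volume 0 t :=
        ⟨B.mulVecCLM.integrable_comp hut.1, B.mulVecCLM.integrable_comp hut.2⟩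
      change O.mulVec (x t) = _
      rw [heq t ht, hx0, zero_add, ← Matrix.mulVecCLM_apply,
        ← O.mulVecCLM.intervalIntegral_comp_comm (hAx.add hBu)]
      refine intervalIntegral.integral_congr fun s _ => ?_
      simp only [Matrix.mulVecCLM_apply, Matrix.mulVec_add, Matrix.mulVec_mulVec]
      rw [hOA, hOB, Matrix.zero_mulVec, add_zero]) T ⟨hT, le_rfl⟩
  have h1 := hrepr ⟨v, hv⟩
  change Matrix.vecMul (b.repr ⟨v, hv⟩) O = v at h1
  rw [← h1, ← Matrix.dotProduct_mulVec, hz, dotProduct_zero]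

/-- For `w` in the left kernel of `C Q`, steer from the origin to the output `w` itself; the reached
output is orthogonal to `w`, so `w = 0`. -/
theorem OutputControllable.rank_eq {A : Matrix (Fin n) (Fin n) ℝ} {B : Matrix (Fin n) (Fin m) ℝ}
    {C : Matrix (Fin p) (Fin n) ℝ} (h : OutputControllable A B C) :
    (C * ctrbMatrix A B).rank = p := by
  refine le_antisymm ((Matrix.rank_le_card_height _).trans_eq (Fintype.card_fin p)) ?_
  have hle := Matrix.rank_le_of_vecMul (X := (1 : Matrix (Fin p) (Fin p) ℝ))
    (Y := C * ctrbMatrix A B) fun w hw => by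
      rw [vecMul_mul_ctrbMatrix_eq_zero_iff] at hw
      obtain ⟨T, u, x, hT, htraj, hx0, hxT⟩ := h 0 w 0 (Matrix.mulVec_zero _)
      have h1 := htraj.dotProduct_eq_zero hx0 hT.le hw
      rw [← Matrix.dotProduct_mulVec, hxT, dotProduct_self_eq_zero] at h1
      rw [Matrix.vecMul_one, h1]
  rwa [Matrix.rank_one, Fintype.card_fin] at hle

/-- The flow `exp (t A)` of a matrix. -/
noncomputable def Matrix.flow (A : Matrix (Fin n) (Fin n) ℝ) (t : ℝ) :
    (Fin n → ℝ) →L[ℝ] (Fin n → ℝ) :=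
  NormedSpace.exp (t • A.mulVecCLM)

theorem Matrix.hasDerivAt_flow (A : Matrix (Fin n) (Fin n) ℝ) (t : ℝ) :
    HasDerivAt A.flow (A.flow t * A.mulVecCLM) t :=
  hasDerivAt_exp_smul_const A.mulVecCLM t

theorem Matrix.hasDerivAt_flow' (A : Matrix (Fin n) (Fin n) ℝ) (t : ℝ) :
    HasDerivAt A.flow (A.mulVecCLM * A.flow t) t :=
  hasDerivAt_exp_smul_const' A.mulVecCLM t

theorem Matrix.continuous_flow (A : Matrix (Fin n) (Fin n) ℝ) : Continuous A.flow :=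
  continuous_iff_continuousAt.2 fun t => (A.hasDerivAt_flow t).continuousAt

theorem Matrix.flow_zero (A : Matrix (Fin n) (Fin n) ℝ) : A.flow 0 = 1 := by
  rw [Matrix.flow, zero_smul, NormedSpace.exp_zero]

theorem Matrix.flow_add (A : Matrix (Fin n) (Fin n) ℝ) (s t : ℝ) :
    A.flow (s + t) = A.flow s * A.flow t := by
  let _ : NormedAlgebra ℚ ((Fin n → ℝ) →L[ℝ] (Fin n → ℝ)) := NormedAlgebra.restrictScalars ℚ ℝ _
  rw [Matrix.flow, add_smul, NormedSpace.exp_add_of_commute]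
  · rfl
  · exact ((Commute.refl _).smul_left s).smul_right t

/-- The variation of constants formula. -/
theorem exists_isTrajectory (A : Matrix (Fin n) (Fin n) ℝ) (B : Matrix (Fin n) (Fin m) ℝ) (T : ℝ)
    {u : ℝ → Fin m → ℝ} (hu : Continuous u) (x₀ : Fin n → ℝ) :
    ∃ x : ℝ → Fin n → ℝ, IsTrajectory A B T u x ∧ x 0 = x₀ ∧
      x T = A.flow T x₀ + ∫ s in (0 : ℝ)..T, A.flow (T - s) (B.mulVec (u s)) := by
  have hc : Continuous fun s => A.flow (-s) (B.mulVec (u s)) :=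
    (A.continuous_flow.comp continuous_neg).clm_apply (B.mulVecCLM.continuous.comp hu)
  let c : ℝ → Fin n → ℝ := fun t => x₀ + ∫ s in (0 : ℝ)..t, A.flow (-s) (B.mulVec (u s))
  have hcd : ∀ t, HasDerivAt c (A.flow (-t) (B.mulVec (u t))) t := fun t =>
    (intervalIntegral.integral_hasDerivAt_right (hc.intervalIntegrable _ _)
      hc.stronglyMeasurable.stronglyMeasurableAtFilter hc.continuousAt).const_add x₀
  let x : ℝ → Fin n → ℝ := fun t => A.flow t (c t)
  have hxd : ∀ t, HasDerivAt x (A.mulVec (x t) + B.mulVec (u t)) t := by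
    intro t
    have h1 := (A.hasDerivAt_flow' t).clm_apply (hcd t)
    have h2 : A.flow t (A.flow (-t) (B.mulVec (u t))) = B.mulVec (u t) := by
      rw [← mul_apply_eq_comp, ← A.flow_add, add_neg_cancel, A.flow_zero]
      rfl
    rw [h2] at h1
    exact h1
  have hxc : Continuous x := continuous_iff_continuousAt.2 fun t => (hxd t).continuousAt
  have hx0 : x 0 = x₀ := by
    simp only [x, c, A.flow_zero, intervalIntegral.integral_same, add_zero]
    rfl
  refine ⟨x, ⟨hu.intervalIntegrable _ _, hxc.continuousOn, fun t _ => ?_⟩, hx0, ?_⟩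
  · rw [intervalIntegral.integral_eq_sub_of_hasDerivAt (fun s _ => hxd s)
      (((A.mulVecCLM.continuous.comp hxc).add
        (B.mulVecCLM.continuous.comp hu)).intervalIntegrable _ _)]
    abel
  · simp only [x, c, map_add]
    rw [← (A.flow T).intervalIntegral_comp_comm (hc.intervalIntegrable _ _)]
    congr 1
    refine intervalIntegral.integral_congr fun s _ => ?_
    change (A.flow T * A.flow (-s)) _ = _
    rw [← A.flow_add, ← sub_eq_add_neg]

/-- If a functional annihilates the impulse response on `[0,1]`, then it annihilates all the
blocks `A ^ k * B`. -/
theorem vecMul_eq_zero_of_flow {A : Matrix (Fin n) (Fin n) ℝ} {B : Matrix (Fin n) (Fin m) ℝ}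
    {w : Fin n → ℝ} (h : ∀ t ∈ Set.Icc (0 : ℝ) 1, ∀ v, w ⬝ᵥ A.flow t (B.mulVec v) = 0) (k : ℕ) :
    Matrix.vecMul w (A ^ k * B) = 0 := by
  let φ : (Fin n → ℝ) →L[ℝ] ℝ := LinearMap.toContinuousLinearMap (dotProductBilin ℝ ℝ w)
  have hφ : ∀ y, φ y = w ⬝ᵥ y := fun y => rfl
  have key : ∀ (k : ℕ) (v : Fin m → ℝ), ∀ t ∈ Set.Icc (0 : ℝ) 1,
      φ (A.flow t ((A ^ k).mulVec (B.mulVec v))) = 0 := by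
    intro k v
    induction k with
    | zero => intro t ht; simpa [hφ] using h t ht v
    | succ k ih =>
      intro t ht
      have h1 : HasDerivAt (fun t => φ (A.flow t ((A ^ k).mulVec (B.mulVec v))))
          (φ (A.flow t (A.mulVec ((A ^ k).mulVec (B.mulVec v))))) t :=
        φ.hasFDerivAt.comp_hasDerivAt t
          (((A.hasDerivAt_flow t).clm_apply (hasDerivAt_const t _)).congr_deriv (by simp))
      have h2 : HasDerivWithinAt (fun t => φ (A.flow t ((A ^ k).mulVec (B.mulVec v)))) 0
          (Set.Icc 0 1) t :=
        (hasDerivWithinAt_const t (Set.Icc (0 : ℝ) 1) (0 : ℝ)).congr (fun s hs => ih s hs) (ih t ht)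
      -- Differentiating the identity within the interval, including its end points, produces one
      -- more factor `A`.
      have h3 := (uniqueDiffOn_Icc zero_lt_one t ht).eq_deriv _ h1.hasDerivWithinAt h2
      rwa [pow_succ', ← Matrix.mulVec_mulVec]
  have h0 : ∀ v, Matrix.vecMul w (A ^ k * B) ⬝ᵥ v = 0 := by
    intro v
    have := key k v 0 ⟨le_rfl, zero_le_one⟩
    rw [A.flow_zero, one_apply_eq_self, hφ, Matrix.mulVec_mulVec,
      Matrix.dotProduct_mulVec] at this
    exact this
  exact dotProduct_self_eq_zero.1 (h0 _)

/-- The horizon `1` suffices. The map `W` is the output Gramian: it sends a multiplier `ξ` to the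
output generated by the input `g s ξ`, the adjoint of the impulse response. If `W ξ = 0`, this input
has zero energy, so `ξ C` annihilates all `A ^ k * B`, and full row rank gives `ξ = 0`. Injectivity
implies surjectivity. -/
theorem outputControllable_of_rank_eq {A : Matrix (Fin n) (Fin n) ℝ}
    {B : Matrix (Fin n) (Fin m) ℝ} {C : Matrix (Fin p) (Fin n) ℝ}
    (h : (C * ctrbMatrix A B).rank = p) : OutputControllable A B C := by
  rintro _ y₁ x₀ rfl
  -- the input that corresponds to a multiplier
  let g : ℝ → (Fin p → ℝ) →L[ℝ] (Fin m → ℝ) := fun s =>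
    LinearMap.toContinuousLinearMap
      (LinearMap.toMatrix' (C.mulVecCLM ∘L A.flow (1 - s) ∘L B.mulVecCLM).toLinearMap).transpose.mulVecLin
  have hg : ∀ s ξ v, g s ξ ⬝ᵥ v = Matrix.vecMul ξ C ⬝ᵥ A.flow (1 - s) (B.mulVec v) := by
    intro s ξ v
    change (Matrix.transpose _).mulVec ξ ⬝ᵥ v = _
    rw [Matrix.mulVec_transpose, ← Matrix.dotProduct_mulVec, LinearMap.toMatrix'_mulVec,
      ← Matrix.dotProduct_mulVec]
    rfl
  have hgc : ∀ ξ, Continuous fun s => g s ξ := by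
    intro ξ
    refine continuous_pi fun j => ?_
    have : (fun s => g s ξ j) = fun s =>
        Matrix.vecMul ξ C ⬝ᵥ A.flow (1 - s) (B.mulVec (Pi.single j 1)) := by
      ext s
      rw [← hg, dotProduct_single_one]
    rw [this]
    have hfl : Continuous fun s => A.flow (1 - s) (B.mulVec (Pi.single j 1)) :=
      (A.continuous_flow.comp (continuous_const.sub continuous_id)).clm_apply continuous_const
    exact Continuous.dotProduct continuous_const hfl
  have hint : ∀ ξ, Continuous fun s => A.flow (1 - s) (B.mulVec (g s ξ)) := fun ξ =>
    (A.continuous_flow.comp (continuous_const.sub continuous_id)).clm_apply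
      (B.mulVecCLM.continuous.comp (hgc ξ))
  let W : (Fin p → ℝ) →ₗ[ℝ] (Fin p → ℝ) :=
    { toFun := fun ξ => C.mulVec (∫ s in (0 : ℝ)..1, A.flow (1 - s) (B.mulVec (g s ξ)))
      map_add' := fun ξ η => by
        simp only [map_add, Matrix.mulVec_add]
        rw [intervalIntegral.integral_add ((hint ξ).intervalIntegrable _ _)
          ((hint η).intervalIntegrable _ _), Matrix.mulVec_add]
      map_smul' := fun c ξ => by
        simp only [map_smul, Matrix.mulVec_smul, RingHom.id_apply]
        rw [intervalIntegral.integral_smul, Matrix.mulVec_smul] }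
  have hW : Function.Injective W := by
    rw [injective_iff_map_eq_zero]
    intro ξ hξ
    -- The energy of the input equals `ξ ⬝ᵥ W ξ`.
    have h1 : ∫ s in (0 : ℝ)..1, g s ξ ⬝ᵥ g s ξ = 0 := by
      let φ : (Fin n → ℝ) →L[ℝ] ℝ :=
        LinearMap.toContinuousLinearMap (dotProductBilin ℝ ℝ (Matrix.vecMul ξ C))
      have h2 := φ.intervalIntegral_comp_comm ((hint ξ).intervalIntegrable (μ := volume) 0 1)
      have h3 : φ (∫ s in (0 : ℝ)..1, A.flow (1 - s) (B.mulVec (g s ξ))) = 0 := by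
        change Matrix.vecMul ξ C ⬝ᵥ _ = 0
        rw [← Matrix.dotProduct_mulVec]
        change ξ ⬝ᵥ W ξ = 0
        rw [hξ, dotProduct_zero]
      rw [h3] at h2
      refine Eq.trans ?_ h2
      exact intervalIntegral.integral_congr fun s _ => hg s ξ _
    have h4 : ∀ s ∈ Set.Icc (0 : ℝ) 1, g s ξ = 0 := by
      intro s hs
      by_contra hne
      have hnn : ∀ s, 0 ≤ g s ξ ⬝ᵥ g s ξ := fun s =>
        Finset.sum_nonneg fun i _ => mul_self_nonneg _
      have hpos : 0 < g s ξ ⬝ᵥ g s ξ :=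
        lt_of_le_of_ne (hnn s) fun h => hne (dotProduct_self_eq_zero.1 h.symm)
      exact absurd h1 (intervalIntegral.integral_pos zero_lt_one
        ((hgc ξ).dotProduct (hgc ξ)).continuousOn (fun s _ => hnn s) ⟨s, hs, hpos⟩).ne'
    have h5 := vecMul_eq_zero_of_flow (A := A) (B := B) (w := Matrix.vecMul ξ C) fun t ht v => by
      have := hg (1 - t) ξ v
      rw [h4 (1 - t) ⟨by linarith [ht.2], by linarith [ht.1]⟩, zero_dotProduct, sub_sub_cancel]
        at this
      exact this.symm
    have h6 := Matrix.vecMul_eq_zero_of_rank_le (X := (1 : Matrix (Fin p) (Fin p) ℝ))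
      (Y := C * ctrbMatrix A B) (fun w hw => by
        rw [Matrix.vecMul_one] at hw
        rw [hw, Matrix.zero_vecMul]) (by rw [h, Matrix.rank_one, Fintype.card_fin])
      (vecMul_mul_ctrbMatrix_eq_zero_iff.2 h5)
    rwa [Matrix.vecMul_one] at h6
  obtain ⟨ξ, hξ⟩ := LinearMap.injective_iff_surjective.1 hW (y₁ - C.mulVec (A.flow 1 x₀))
  obtain ⟨x, hx, hx0, hx1⟩ := exists_isTrajectory A B 1 (hgc ξ) x₀
  refine ⟨1, fun s => g s ξ, x, one_pos, hx, hx0, ?_⟩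
  change C.mulVec (∫ s in (0 : ℝ)..1, A.flow (1 - s) (B.mulVec (g s ξ))) = _ at hξ
  rw [hx1, Matrix.mulVec_add, hξ]
  abel

/-- Output controllability is full row rank of `C Q(A,B)`. -/
theorem outputControllable_iff {A : Matrix (Fin n) (Fin n) ℝ} {B : Matrix (Fin n) (Fin m) ℝ}
    {C : Matrix (Fin p) (Fin n) ℝ} :
    OutputControllable A B C ↔ (C * ctrbMatrix A B).rank = p :=
  ⟨OutputControllable.rank_eq, outputControllable_of_rank_eq⟩

end OutputControllability

set_option linter.unusedSimpArgs false

/-! ### A small programming language for the random access machine -/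

/-- `P` halts from `s` in `s'` within `T` steps. -/
def RunsWithin (P : RamProgram) (s : RamState) (T : ℕ) (s' : RamState) : Prop :=
  ∃ t ≤ T, RamRuns P s t s'

theorem RunsWithin.seq {P Q : RamProgram} {s s' s'' : RamState} {T T' : ℕ}
    (h : RunsWithin P s T s') (h' : RunsWithin Q s' T' s'') :
    RunsWithin (.seq P Q) s (T + T') s'' := by
  obtain ⟨t, ht, hr⟩ := h
  obtain ⟨t', ht', hr'⟩ := h'
  exact ⟨t + t', by omega, hr.seq hr'⟩

theorem RunsWithin.mono {P : RamProgram} {s s' : RamState} {T T' : ℕ}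
    (h : RunsWithin P s T s') (hT : T ≤ T') : RunsWithin P s T' s' := by
  obtain ⟨t, ht, hr⟩ := h
  exact ⟨t, ht.trans hT, hr⟩

theorem RamRuns.within {P : RamProgram} {s s' : RamState} {t : ℕ} (h : RamRuns P s t s') :
    RunsWithin P s t s' :=
  ⟨t, le_rfl, h⟩

theorem RamState.reg_setReg_self (s : RamState) (r v : ℕ) : (s.setReg r v).reg r = v :=
  Function.update_self _ _ _

theorem RamState.reg_setReg_of_ne (s : RamState) {r q : ℕ} (v : ℕ) (h : q ≠ r) :
    (s.setReg r v).reg q = s.reg q :=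
  Function.update_of_ne h _ _

@[simp]
theorem RamState.arr_setReg (s : RamState) (r v : ℕ) : (s.setReg r v).arr = s.arr := rfl

@[simp]
theorem RamState.reg_setArr (s : RamState) (a k v : ℕ) : (s.setArr a k v).reg = s.reg := rfl

/-- A loop whose counter decreases by one in each round. -/
theorem RunsWithin.loop {r : ℕ} {P : RamProgram} {T : ℕ} {I : ℕ → RamState → Prop}
    (hr : ∀ c s, I c s → s.reg r = c)
    (hstep : ∀ c s, I (c + 1) s → ∃ s', RunsWithin P s T s' ∧ I c s') :
    ∀ c s, I c s → ∃ s', RunsWithin (.loop r P) s (c * (T + 1) + 1) s' ∧ I 0 s' := by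
  intro c
  induction c with
  | zero =>
    intro s hs
    exact ⟨s, (RamRuns.loop_stop (hr 0 s hs)).within.mono (by omega), hs⟩
  | succ c ih =>
    intro s hs
    obtain ⟨s', ⟨t, ht, h1⟩, hs'⟩ := hstep c s hs
    obtain ⟨s'', ⟨t', ht', h2⟩, hs''⟩ := ih s' hs'
    refine ⟨s'', ⟨t + t' + 1, ?_, RamRuns.loop_step ?_ h1 h2⟩, hs''⟩
    · rw [add_mul]; omega
    · rw [hr _ s hs]; omega

/-- Expressions with eight parameters, eight variables and bounded sums. -/
inductive RamExpr : Type
  | lit (c : ℕ)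
  | par (k : Fin 8)
  | var (v : Fin 8)
  | arr (a : ℕ) (e : RamExpr)
  | add (e f : RamExpr)
  | sub (e f : RamExpr)
  | ite (c e f : RamExpr)
  | sum (v k : Fin 8) (e : RamExpr)

namespace RamExpr

/-- The value of an expression at given parameters, variables and arrays. -/
def val (π : Fin 8 → ℕ) : RamExpr → (Fin 8 → ℕ) → (ℕ → ℕ → ℕ) → ℕ
  | lit c, _, _ => c
  | par k, _, _ => π k
  | var v, ρ, _ => ρ v
  | arr a e, ρ, α => α a (e.val π ρ α)
  | add e f, ρ, α => e.val π ρ α + f.val π ρ α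
  | sub e f, ρ, α => e.val π ρ α - f.val π ρ α
  | ite c e f, ρ, α => if c.val π ρ α ≠ 0 then e.val π ρ α else f.val π ρ α
  | sum v k e, ρ, α => ∑ x ∈ Finset.range (π k), e.val π (Function.update ρ v x) α

/-- A program that evaluates an expression into the register `d` and leaves the lower registers
unchanged. The parameters are in the registers `0, …, 7`, the variables in `8, …, 15`. -/
def compile : RamExpr → ℕ → RamProgram
  | lit c, d => .const d c
  | par k, d => .copy d k
  | var v, d => .copy d (8 + v)
  | arr a e, d => .seq (e.compile d) (.load d a d)
  | add e f, d => .seq (e.compile d) (.seq (f.compile (d + 1)) (.plus d d (d + 1)))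
  | sub e f, d => .seq (e.compile d) (.seq (f.compile (d + 1)) (.minus d d (d + 1)))
  | ite c e f, d => .seq (c.compile d) (.branch d (e.compile d) (f.compile d))
  | sum v k e, d =>
    -- `d` saves the old value of the variable until the end, `d + 1` accumulates, `d + 2` counts
    -- down, and `d + 3` holds the summand and then the constant one.
    .seq (.copy d (8 + v)) <| .seq (.const (d + 1) 0) <| .seq (.copy (d + 2) k) <|
    .seq (.const (8 + v) 0) <|
    .seq (.loop (d + 2) <| .seq (e.compile (d + 3)) <| .seq (.plus (d + 1) (d + 1) (d + 3)) <|
      .seq (.const (d + 3) 1) <| .seq (.plus (8 + v) (8 + v) (d + 3))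
        (.minus (d + 2) (d + 2) (d + 3))) <|
    .seq (.copy (8 + v) d) (.copy d (d + 1))

open Polynomial in
/-- A bound of the running time in terms of a bound of the parameters. -/
noncomputable def cost : RamExpr → ℕ[X]
  | lit _ => 1
  | par _ => 1
  | var _ => 1
  | arr _ e => e.cost + 1
  | add e f => e.cost + f.cost + 1
  | sub e f => e.cost + f.cost + 1
  | ite c e f => c.cost + e.cost + f.cost + 1
  -- A round costs the summand, four instructions and the test; the remaining seven steps are four
  -- instructions before the loop, the last test and two instructions after it.
  | sum _ _ e => X * (e.cost + 5) + 7

end RamExpr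

/-- The parameters, variables and arrays are stored in a machine state. -/
structure Represents (π ρ : Fin 8 → ℕ) (α : ℕ → ℕ → ℕ) (s : RamState) : Prop where
  par : ∀ k : Fin 8, s.reg k = π k
  var : ∀ v : Fin 8, s.reg (8 + v) = ρ v
  arr : s.arr = α

theorem Represents.congr {π ρ : Fin 8 → ℕ} {α : ℕ → ℕ → ℕ} {s s' : RamState}
    (h : Represents π ρ α s) (hr : ∀ q < 16, s'.reg q = s.reg q) (ha : s'.arr = s.arr) :
    Represents π ρ α s' :=
  ⟨fun k => by rw [hr _ (by omega), h.par], fun v => by rw [hr _ (by omega), h.var],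
    by rw [ha, h.arr]⟩

/-- The preservation of all registers below `d` makes the induction work: partial results survive
the evaluation of later subexpressions, and `16 ≤ d` protects parameters and variables. -/
theorem RamExpr.runsWithin_compile {π : Fin 8 → ℕ} {M : ℕ} (hM : ∀ k, π k ≤ M) (e : RamExpr) :
    ∀ (ρ : Fin 8 → ℕ) (α : ℕ → ℕ → ℕ) (d : ℕ) (s : RamState), 16 ≤ d → Represents π ρ α s →
      ∃ s', RunsWithin (e.compile d) s (e.cost.eval M) s' ∧ s'.arr = s.arr ∧
        (∀ q < d, s'.reg q = s.reg q) ∧ s'.reg d = e.val π ρ α := by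
  induction e with
  | lit c =>
    intro ρ α d s hd hs
    refine ⟨_, (RamRuns.const s d c).within.mono (by simp [cost]), rfl, fun q hq => ?_, ?_⟩
    · simp (disch := omega) only [RamState.reg_setReg_self, RamState.reg_setReg_of_ne]
    · simp (disch := omega) only [RamState.reg_setReg_self, RamState.reg_setReg_of_ne]
      rw [val]
  | par k =>
    intro ρ α d s hd hs
    refine ⟨_, (RamRuns.copy s d k).within.mono (by simp [cost]), rfl, fun q hq => ?_, ?_⟩
    · simp (disch := omega) only [RamState.reg_setReg_self, RamState.reg_setReg_of_ne]
    · simp (disch := omega) only [RamState.reg_setReg_self, RamState.reg_setReg_of_ne]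
      rw [val, hs.par]
  | var v =>
    intro ρ α d s hd hs
    refine ⟨_, (RamRuns.copy s d (8 + v)).within.mono (by simp [cost]), rfl, fun q hq => ?_, ?_⟩
    · simp (disch := omega) only [RamState.reg_setReg_self, RamState.reg_setReg_of_ne]
    · simp (disch := omega) only [RamState.reg_setReg_self, RamState.reg_setReg_of_ne]
      rw [val, hs.var]
  | arr a e ih =>
    intro ρ α d s hd hs
    obtain ⟨s₁, h₁, ha₁, hq₁, hv₁⟩ := ih ρ α d s hd hs
    refine ⟨_, (h₁.seq (RamRuns.load s₁ d a d).within).mono (by simp [cost]), ha₁,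
      fun q hq => ?_, ?_⟩
    · simp (disch := omega) only [RamState.reg_setReg_self, RamState.reg_setReg_of_ne]
      rw [hq₁ q hq]
    · simp (disch := omega) only [RamState.reg_setReg_self, RamState.reg_setReg_of_ne]
      rw [val, hv₁, ha₁, hs.arr]
  | add e f ihe ihf =>
    intro ρ α d s hd hs
    obtain ⟨s₁, h₁, ha₁, hq₁, hv₁⟩ := ihe ρ α d s hd hs
    obtain ⟨s₂, h₂, ha₂, hq₂, hv₂⟩ := ihf ρ α (d + 1) s₁ (by omega)
      (hs.congr (fun q hq => hq₁ q (by omega)) ha₁)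
    refine ⟨_, (h₁.seq (h₂.seq (RamRuns.plus s₂ d d (d + 1)).within)).mono
      (by simp [cost, add_assoc]), ha₂.trans ha₁, fun q hq => ?_, ?_⟩
    · simp (disch := omega) only [RamState.reg_setReg_self, RamState.reg_setReg_of_ne]
      rw [hq₂ q (by omega), hq₁ q hq]
    · simp (disch := omega) only [RamState.reg_setReg_self, RamState.reg_setReg_of_ne]
      rw [val, hv₂, hq₂ d (by omega), hv₁]
  | sub e f ihe ihf =>
    intro ρ α d s hd hs
    obtain ⟨s₁, h₁, ha₁, hq₁, hv₁⟩ := ihe ρ α d s hd hs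
    obtain ⟨s₂, h₂, ha₂, hq₂, hv₂⟩ := ihf ρ α (d + 1) s₁ (by omega)
      (hs.congr (fun q hq => hq₁ q (by omega)) ha₁)
    refine ⟨_, (h₁.seq (h₂.seq (RamRuns.minus s₂ d d (d + 1)).within)).mono
      (by simp [cost, add_assoc]), ha₂.trans ha₁, fun q hq => ?_, ?_⟩
    · simp (disch := omega) only [RamState.reg_setReg_self, RamState.reg_setReg_of_ne]
      rw [hq₂ q (by omega), hq₁ q hq]
    · simp (disch := omega) only [RamState.reg_setReg_self, RamState.reg_setReg_of_ne]
      rw [val, hv₂, hq₂ d (by omega), hv₁]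
  | ite c e f ihc ihe ihf =>
    intro ρ α d s hd hs
    obtain ⟨s₁, h₁, ha₁, hq₁, hv₁⟩ := ihc ρ α d s hd hs
    have hs₁ := hs.congr (fun q hq => hq₁ q (by omega)) ha₁
    by_cases hc : c.val π ρ α ≠ 0
    · obtain ⟨s₂, ⟨t, ht, h₂⟩, ha₂, hq₂, hv₂⟩ := ihe ρ α d s₁ hd hs₁
      refine ⟨s₂, (h₁.seq (RamRuns.branch_pos (by rwa [hv₁]) h₂).within).mono ?_, ha₂.trans ha₁,
        fun q hq => by rw [hq₂ q hq, hq₁ q hq], ?_⟩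
      · simp only [cost, Polynomial.eval_add, Polynomial.eval_one]; omega
      · rw [hv₂, val, if_pos hc]
    · obtain ⟨s₂, ⟨t, ht, h₂⟩, ha₂, hq₂, hv₂⟩ := ihf ρ α d s₁ hd hs₁
      refine ⟨s₂, (h₁.seq (RamRuns.branch_zero (by rw [hv₁]; exact not_not.1 hc) h₂).within).mono ?_,
        ha₂.trans ha₁, fun q hq => by rw [hq₂ q hq, hq₁ q hq], ?_⟩
      · simp only [cost, Polynomial.eval_add, Polynomial.eval_one]; omega
      · rw [hv₂, val, if_neg hc]
  | sum v k e ih =>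
    intro ρ α d s hd hs
    -- Here `c` is the number of remaining rounds, so `π k - c` is the current value of the
    -- summation variable, whose register is exempt from preservation.
    let I : ℕ → RamState → Prop := fun c s' => c ≤ π k ∧ s'.reg (d + 2) = c ∧
      s'.reg (8 + v) = π k - c ∧
      s'.reg (d + 1) = ∑ x ∈ Finset.range (π k - c), e.val π (Function.update ρ v x) α ∧
      s'.reg d = s.reg (8 + v) ∧ s'.arr = s.arr ∧ ∀ q < d, q ≠ 8 + v → s'.reg q = s.reg q
    have hstep : ∀ c s', I (c + 1) s' → ∃ s'', RunsWithin (.seq (e.compile (d + 3)) <|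
        .seq (.plus (d + 1) (d + 1) (d + 3)) <| .seq (.const (d + 3) 1) <|
        .seq (.plus (8 + v) (8 + v) (d + 3)) (.minus (d + 2) (d + 2) (d + 3))) s'
        (e.cost.eval M + 4) s'' ∧ I c s'' := by
      rintro c s' ⟨hc, h1, h2, h3, h4, h5, h6⟩
      have hrep : Represents π (Function.update ρ v (π k - (c + 1))) α s' := by
        refine ⟨fun l => ?_, fun w => ?_, by rw [h5, hs.arr]⟩
        · rw [h6 _ (by omega) (by omega), hs.par]
        · by_cases hw : w = v
          · subst hw
            rw [h2, Function.update_self]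
          · have : (w : ℕ) ≠ v := fun h => hw (Fin.ext h)
            rw [h6 _ (by omega) (by omega), hs.var, Function.update_of_ne hw]
      obtain ⟨s₁, hr₁, ha₁, hq₁, hv₁⟩ := ih _ α (d + 3) s' (by omega) hrep
      refine ⟨_, (hr₁.seq ((RamRuns.plus _ _ _ _).within.seq ((RamRuns.const _ _ _).within.seq
        ((RamRuns.plus _ _ _ _).within.seq (RamRuns.minus _ _ _ _).within)))).mono le_rfl,
        by omega, ?_, ?_, ?_, ?_, ?_, fun q hq hqv => ?_⟩
      · simp (disch := omega) only [RamState.reg_setReg_self, RamState.reg_setReg_of_ne]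
        rw [hq₁ _ (by omega), h1]
        omega
      · simp (disch := omega) only [RamState.reg_setReg_self, RamState.reg_setReg_of_ne]
        rw [hq₁ _ (by omega), h2]
        omega
      · have hsucc : π k - c = (π k - (c + 1)) + 1 := by omega
        simp (disch := omega) only [RamState.reg_setReg_self, RamState.reg_setReg_of_ne]
        rw [hq₁ _ (by omega), h3, hv₁, hsucc, Finset.sum_range_succ]
      · simp (disch := omega) only [RamState.reg_setReg_self, RamState.reg_setReg_of_ne]
        rw [hq₁ _ (by omega), h4]
      · simp only [RamState.arr_setReg]
        rw [ha₁, h5]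
      · simp (disch := omega) only [RamState.reg_setReg_self, RamState.reg_setReg_of_ne]
        rw [hq₁ _ (by omega), h6 q hq hqv]
    obtain ⟨s₁, hr₁, -, -, hv₁, hsum₁, hd₁, ha₁, hq₁⟩ := RunsWithin.loop (I := I) (r := d + 2)
      (fun c s' h => h.2.1) hstep (π k)
      ((((s.setReg d (s.reg (8 + v))).setReg (d + 1) 0).setReg (d + 2) (π k)).setReg (8 + v) 0) (by
        refine ⟨le_rfl, ?_, ?_, ?_, ?_, rfl, fun q hq hqv => ?_⟩ <;>
          simp (disch := omega) only [RamState.reg_setReg_self, RamState.reg_setReg_of_ne]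
        · rw [Nat.sub_self]
        · rw [Nat.sub_self, Finset.sum_range_zero])
    have hk : ((s.setReg d (s.reg (8 + v))).setReg (d + 1) 0).reg k = π k := by
      simp (disch := omega) only [RamState.reg_setReg_self, RamState.reg_setReg_of_ne]
      rw [hs.par]
    refine ⟨_, ((RamRuns.copy _ _ _).within.seq ((RamRuns.const _ _ _).within.seq
      ((RamRuns.copy _ _ _).within.seq ((RamRuns.const _ _ _).within.seq (RunsWithin.seq
        (by rw [hk]; exact hr₁) ((RamRuns.copy _ _ _).within.seq
          (RamRuns.copy _ _ _).within)))))).mono ?_, ?_, fun q hq => ?_, ?_⟩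
    · simp only [cost, Polynomial.eval_add, Polynomial.eval_mul, Polynomial.eval_X,
        Polynomial.eval_ofNat]
      have : π k * (Polynomial.eval M e.cost + 4 + 1) ≤ M * (Polynomial.eval M e.cost + 5) :=
        Nat.mul_le_mul_right _ (hM k)
      omega
    · simp only [RamState.arr_setReg]
      exact ha₁
    · by_cases hqv : q = 8 + v
      · subst hqv
        simp (disch := omega) only [RamState.reg_setReg_self, RamState.reg_setReg_of_ne]
        rw [hd₁]
      · simp (disch := omega) only [RamState.reg_setReg_self, RamState.reg_setReg_of_ne]
        exact hq₁ q hq hqv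
    · simp (disch := omega) only [RamState.reg_setReg_self, RamState.reg_setReg_of_ne]
      rw [hsum₁, val, Nat.sub_zero]

/-- Statements: assignments, conditionals and bounded loops. -/
inductive RamStmt : Type
  | set (v : Fin 8) (e : RamExpr)
  | store (a : ℕ) (i e : RamExpr)
  | seq (S T : RamStmt)
  | ite (c : RamExpr) (S T : RamStmt)
  | loop (v k : Fin 8) (S : RamStmt)

namespace RamStmt

/-- The effect of a statement on the variables and arrays. -/
def run (π : Fin 8 → ℕ) : RamStmt → (Fin 8 → ℕ) × (ℕ → ℕ → ℕ) → (Fin 8 → ℕ) × (ℕ → ℕ → ℕ)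
  | set v e, x => (Function.update x.1 v (e.val π x.1 x.2), x.2)
  | store a i e, x => (x.1, Function.update x.2 a
      (Function.update (x.2 a) (i.val π x.1 x.2) (e.val π x.1 x.2)))
  | seq S T, x => T.run π (S.run π x)
  | ite c S T, x => if c.val π x.1 x.2 ≠ 0 then S.run π x else T.run π x
  | loop v k S, x => Nat.rec x (fun i y => S.run π (Function.update y.1 v i, y.2)) (π k)

/-- The compiled program, which uses temporary registers from `d` on. -/
def compile : RamStmt → ℕ → RamProgram
  | set v e, d => .seq (e.compile d) (.copy (8 + v) d)
  | store a i e, d => .seq (i.compile d) (.seq (e.compile (d + 1)) (.store a d (d + 1)))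
  | seq S T, d => .seq (S.compile d) (T.compile d)
  | ite c S T, d => .seq (c.compile d) (.branch d (S.compile d) (T.compile d))
  | loop v k S, d =>
    .seq (.copy d k) <| .seq (.const (d + 1) 0) <|
    .loop d <| .seq (.copy (8 + v) (d + 1)) <| .seq (S.compile (d + 2)) <|
      .seq (.const (d + 2) 1) <| .seq (.plus (d + 1) (d + 1) (d + 2)) (.minus d d (d + 2))

open Polynomial in
/-- A bound of the running time in terms of a bound of the parameters. -/
noncomputable def cost : RamStmt → ℕ[X]
  | set _ e => e.cost + 1
  | store _ i e => i.cost + e.cost + 1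
  | seq S T => S.cost + T.cost
  | ite c S T => c.cost + S.cost + T.cost + 1
  -- A round costs the body, four instructions and the test; two instructions and the last test
  -- remain.
  | loop _ _ S => X * (S.cost + 5) + 3

end RamStmt

/-- Statements may change variables, so only the temporary registers from `16` to `d - 1` are
claimed to be preserved; the counters of enclosing loops live there. -/
theorem RamStmt.runsWithin_compile {π : Fin 8 → ℕ} {M : ℕ} (hM : ∀ k, π k ≤ M) (S : RamStmt) :
    ∀ (x : (Fin 8 → ℕ) × (ℕ → ℕ → ℕ)) (d : ℕ) (s : RamState), 16 ≤ d →
      Represents π x.1 x.2 s →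
      ∃ s', RunsWithin (S.compile d) s (S.cost.eval M) s' ∧
        Represents π (S.run π x).1 (S.run π x).2 s' ∧
        ∀ q, 16 ≤ q → q < d → s'.reg q = s.reg q := by
  induction S with
  | set v e =>
    intro x d s hd hs
    obtain ⟨s₁, h₁, ha₁, hq₁, hv₁⟩ := e.runsWithin_compile hM x.1 x.2 d s hd hs
    refine ⟨_, (h₁.seq (RamRuns.copy _ _ _).within).mono (by simp [cost]), ⟨fun k => ?_,
      fun w => ?_, ?_⟩, fun q hq hqd => ?_⟩
    · simp (disch := omega) only [RamState.reg_setReg_self, RamState.reg_setReg_of_ne]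
      rw [hq₁ _ (by omega), hs.par]
    · simp only [run]
      by_cases hw : w = v
      · subst hw
        rw [RamState.reg_setReg_self, hv₁, Function.update_self]
      · have : (w : ℕ) ≠ v := fun h => hw (Fin.ext h)
        rw [RamState.reg_setReg_of_ne _ _ (by omega), hq₁ _ (by omega), hs.var,
          Function.update_of_ne hw]
    · rw [RamState.arr_setReg, ha₁, hs.arr, run]
    · simp (disch := omega) only [RamState.reg_setReg_self, RamState.reg_setReg_of_ne]
      rw [hq₁ q hqd]
  | store a i e =>
    intro x d s hd hs
    obtain ⟨s₁, h₁, ha₁, hq₁, hv₁⟩ := i.runsWithin_compile hM x.1 x.2 d s hd hs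
    have hs₁ := hs.congr (fun q hq => hq₁ q (by omega)) ha₁
    obtain ⟨s₂, h₂, ha₂, hq₂, hv₂⟩ := e.runsWithin_compile hM x.1 x.2 (d + 1) s₁ (by omega) hs₁
    refine ⟨_, (h₁.seq (h₂.seq (RamRuns.store _ _ _ _).within)).mono
      (by simp [cost, add_assoc]), ⟨fun k => ?_, fun w => ?_, ?_⟩, fun q hq hqd => ?_⟩
    · rw [RamState.reg_setArr, hq₂ _ (by omega), hq₁ _ (by omega), hs.par]
    · rw [RamState.reg_setArr, hq₂ _ (by omega), hq₁ _ (by omega), hs.var, run]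
    · simp only [RamState.setArr, run]
      rw [ha₂, ha₁, hs.arr, hv₂, hq₂ d (by omega), hv₁]
    · rw [RamState.reg_setArr, hq₂ _ (by omega), hq₁ _ (by omega)]
  | seq S T ihS ihT =>
    intro x d s hd hs
    obtain ⟨s₁, h₁, hs₁, hq₁⟩ := ihS x d s hd hs
    obtain ⟨s₂, h₂, hs₂, hq₂⟩ := ihT _ d s₁ hd hs₁
    exact ⟨s₂, (h₁.seq h₂).mono (by simp [cost]), hs₂,
      fun q hq hqd => by rw [hq₂ q hq hqd, hq₁ q hq hqd]⟩
  | ite c S T ihS ihT =>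
    intro x d s hd hs
    obtain ⟨s₁, h₁, ha₁, hq₁, hv₁⟩ := c.runsWithin_compile hM x.1 x.2 d s hd hs
    have hs₁ := hs.congr (fun q hq => hq₁ q (by omega)) ha₁
    by_cases hc : c.val π x.1 x.2 ≠ 0
    · obtain ⟨s₂, ⟨t, ht, h₂⟩, hs₂, hq₂⟩ := ihS x d s₁ hd hs₁
      refine ⟨s₂, (h₁.seq (RamRuns.branch_pos (by rwa [hv₁]) h₂).within).mono ?_, ?_,
        fun q hq hqd => by rw [hq₂ q hq hqd, hq₁ q hqd]⟩
      · simp only [cost, Polynomial.eval_add, Polynomial.eval_one]; omega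
      · rwa [run, if_pos hc]
    · obtain ⟨s₂, ⟨t, ht, h₂⟩, hs₂, hq₂⟩ := ihT x d s₁ hd hs₁
      refine ⟨s₂, (h₁.seq (RamRuns.branch_zero (by rw [hv₁]; exact not_not.1 hc) h₂).within).mono ?_,
        ?_, fun q hq hqd => by rw [hq₂ q hq hqd, hq₁ q hqd]⟩
      · simp only [cost, Polynomial.eval_add, Polynomial.eval_one]; omega
      · rwa [run, if_neg hc]
  | loop v k S ih =>
    intro x d s hd hs
    let y : ℕ → (Fin 8 → ℕ) × (ℕ → ℕ → ℕ) := fun i =>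
      Nat.rec x (fun i y => S.run π (Function.update y.1 v i, y.2)) i
    let I : ℕ → RamState → Prop := fun c s' => c ≤ π k ∧ s'.reg d = c ∧
      s'.reg (d + 1) = π k - c ∧ Represents π (y (π k - c)).1 (y (π k - c)).2 s' ∧
      ∀ q, 16 ≤ q → q < d → s'.reg q = s.reg q
    have hstep : ∀ c s', I (c + 1) s' → ∃ s'', RunsWithin (.seq (.copy (8 + v) (d + 1)) <|
        .seq (S.compile (d + 2)) <| .seq (.const (d + 2) 1) <|
        .seq (.plus (d + 1) (d + 1) (d + 2)) (.minus d d (d + 2))) s' (S.cost.eval M + 4) s'' ∧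
        I c s'' := by
      rintro c s' ⟨hc, h1, h2, h3, h4⟩
      have hrep : Represents π (Function.update (y (π k - (c + 1))).1 v (π k - (c + 1)))
          (y (π k - (c + 1))).2 (s'.setReg (8 + v) (s'.reg (d + 1))) := by
        refine ⟨fun l => ?_, fun w => ?_, h3.arr⟩
        · simp (disch := omega) only [RamState.reg_setReg_self, RamState.reg_setReg_of_ne]
          rw [h3.par]
        · by_cases hw : w = v
          · subst hw
            rw [RamState.reg_setReg_self, h2, Function.update_self]
          · have : (w : ℕ) ≠ v := fun h => hw (Fin.ext h)
            rw [RamState.reg_setReg_of_ne _ _ (by omega), h3.var, Function.update_of_ne hw]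
      obtain ⟨s₁, hr₁, hs₁, hq₁⟩ := ih (_, _) (d + 2) _ (by omega) hrep
      have hsucc : π k - c = (π k - (c + 1)) + 1 := by omega
      refine ⟨_, ((RamRuns.copy _ _ _).within.seq (hr₁.seq ((RamRuns.const _ _ _).within.seq
        ((RamRuns.plus _ _ _ _).within.seq (RamRuns.minus _ _ _ _).within)))).mono (by omega),
        by omega, ?_, ?_, ?_, fun q hq hqd => ?_⟩
      · simp (disch := omega) only [RamState.reg_setReg_self, RamState.reg_setReg_of_ne]
        rw [hq₁ _ (by omega) (by omega)]
        simp (disch := omega) only [RamState.reg_setReg_self, RamState.reg_setReg_of_ne]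
        rw [h1]
        omega
      · simp (disch := omega) only [RamState.reg_setReg_self, RamState.reg_setReg_of_ne]
        rw [hq₁ _ (by omega) (by omega)]
        simp (disch := omega) only [RamState.reg_setReg_self, RamState.reg_setReg_of_ne]
        rw [h2]
        omega
      · rw [hsucc]
        refine hs₁.congr (fun q hq => ?_) rfl
        simp (disch := omega) only [RamState.reg_setReg_self, RamState.reg_setReg_of_ne]
      · simp (disch := omega) only [RamState.reg_setReg_self, RamState.reg_setReg_of_ne]
        rw [hq₁ _ (by omega) (by omega)]
        simp (disch := omega) only [RamState.reg_setReg_self, RamState.reg_setReg_of_ne]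
        rw [h4 q hq hqd]
    obtain ⟨s₁, hr₁, -, -, -, hs₁, hq₁⟩ := RunsWithin.loop (I := I) (r := d)
      (fun c s' h => h.2.1) hstep (π k) ((s.setReg d (π k)).setReg (d + 1) 0) (by
        refine ⟨le_rfl, ?_, ?_, ?_, fun q hq hqd => ?_⟩
        · simp (disch := omega) only [RamState.reg_setReg_self, RamState.reg_setReg_of_ne]
        · simp (disch := omega) only [RamState.reg_setReg_self, RamState.reg_setReg_of_ne]
          rw [Nat.sub_self]
        · rw [Nat.sub_self]
          refine hs.congr (fun q hq => ?_) rfl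
          simp (disch := omega) only [RamState.reg_setReg_self, RamState.reg_setReg_of_ne]
        · simp (disch := omega) only [RamState.reg_setReg_self, RamState.reg_setReg_of_ne])
    refine ⟨s₁, ((RamRuns.copy _ _ _).within.seq ((RamRuns.const _ _ _).within.seq
      (by rw [hs.par]; exact hr₁))).mono ?_, hs₁, hq₁⟩
    simp only [cost, Polynomial.eval_add, Polynomial.eval_mul, Polynomial.eval_X,
        Polynomial.eval_ofNat]
    have : π k * (Polynomial.eval M S.cost + 4 + 1) ≤ M * (Polynomial.eval M S.cost + 5) :=
      Nat.mul_le_mul_right _ (hM k)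
    omega

/-! ### An auction algorithm for bipartite matching

The rows are `0, …, N - 1` and the columns `0, …, L - 1`. `own j = i + 1` means that the column `j`
is assigned to the row `i`, and `own j = 0` that it is not assigned. `lam (i + 1)` is the bid of the
row `i`, and `lam 0 = 0`; hence `lam (own j)` is the price of the column `j`. -/

section Auction

variable (N L : ℕ) (adj : ℕ → ℕ → Prop)

/-- There is a matching that saturates all rows. -/
def HasRowMatching : Prop :=
  ∃ μ : ℕ → ℕ, (∀ i < N, μ i < L ∧ adj i (μ i)) ∧ ∀ i < N, ∀ i' < N, μ i = μ i' → i = i'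

/-- The row `i` has no column. -/
def IsFreeRow (own : ℕ → ℕ) (i : ℕ) : Prop :=
  ∀ j < L, own j ≠ i + 1

/-- The invariant of the auction. -/
structure AuctionInv (own lam : ℕ → ℕ) : Prop where
  lam_zero : lam 0 = 0
  own_le : ∀ j < L, own j ≤ N
  own_adj : ∀ j < L, ∀ i, own j = i + 1 → adj i j
  own_inj : ∀ j < L, ∀ j' < L, own j = own j' → own j ≠ 0 → j = j'
  lam_le : ∀ i < N, ∀ j < L, adj i j → lam (i + 1) ≤ lam (own j) + 1

/-- A free row takes a column that is cheaper than its bid, or it raises its bid. -/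
def AuctionStep (own lam own' lam' : ℕ → ℕ) : Prop :=
  ((∀ i < N, ¬ IsFreeRow L own i) ∧ own' = own ∧ lam' = lam) ∨
  ∃ i < N, IsFreeRow L own i ∧
    ((∃ j < L, adj i j ∧ lam (own j) < lam (i + 1) ∧
        own' = Function.update own j (i + 1) ∧ lam' = lam) ∨
      ((∀ j < L, adj i j → lam (i + 1) ≤ lam (own j)) ∧ own' = own ∧
        lam' = Function.update lam (i + 1) (lam (i + 1) + 1)))

/-- The sum of all bids and prices. -/
def auctionPotential (own lam : ℕ → ℕ) : ℕ :=
  ∑ i ∈ Finset.range N, lam (i + 1) + ∑ j ∈ Finset.range L, lam (own j)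

variable {N L adj} {own lam own' lam' : ℕ → ℕ}

theorem update_bid_own {i j : ℕ} (hi : IsFreeRow L own i) (hj : j < L) (x : ℕ) :
    Function.update lam (i + 1) x (own j) = lam (own j) :=
  Function.update_of_ne (hi j hj) _ _

/-- A reassigned column becomes strictly more expensive, as its new owner outbids the old one. A
raised bid changes no price, as a free row owns no column. So prices never fall, and while some row
is free, every step increases the potential. -/
theorem AuctionInv.step (h : AuctionInv N L adj own lam)
    (hs : AuctionStep N L adj own lam own' lam') :
    AuctionInv N L adj own' lam' ∧ ((∀ i < N, ¬ IsFreeRow L own' i) ∨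
      auctionPotential N L own lam + 1 ≤ auctionPotential N L own' lam') := by
  rcases hs with ⟨hno, rfl, rfl⟩ | ⟨i, hi, hfree, ⟨j, hj, hadj, hlt, rfl, rfl⟩ | ⟨hle, rfl, rfl⟩⟩
  · exact ⟨h, Or.inl hno⟩
  · have hprice : ∀ j', lam' (own j') ≤ lam' (Function.update own j (i + 1) j') := by
      intro j'
      rcases eq_or_ne j' j with rfl | hne
      · rw [Function.update_self]; exact hlt.le
      · rw [Function.update_of_ne hne]
    refine ⟨⟨h.lam_zero, fun j' hj' => ?_, fun j' hj' i' hi' => ?_, fun j₁ h₁ j₂ h₂ heq hne => ?_,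
      fun i' hi' j' hj' ha => (h.lam_le i' hi' j' hj' ha).trans (Nat.succ_le_succ (hprice j'))⟩,
      Or.inr ?_⟩
    · rcases eq_or_ne j' j with rfl | hne
      · rw [Function.update_self]; exact hi
      · rw [Function.update_of_ne hne]; exact h.own_le j' hj'
    · rcases eq_or_ne j' j with rfl | hne
      · rw [Function.update_self] at hi'
        rw [← Nat.succ_injective hi']
        exact hadj
      · rw [Function.update_of_ne hne] at hi'
        exact h.own_adj j' hj' i' hi'
    · rcases eq_or_ne j₁ j with e₁ | hne₁ <;> rcases eq_or_ne j₂ j with e₂ | hne₂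
      · rw [e₁, e₂]
      · rw [e₁, Function.update_self, Function.update_of_ne hne₂] at heq
        exact absurd heq.symm (hfree j₂ h₂)
      · rw [e₂, Function.update_self, Function.update_of_ne hne₁] at heq
        exact absurd heq (hfree j₁ h₁)
      · rw [Function.update_of_ne hne₁] at hne
        rw [Function.update_of_ne hne₁, Function.update_of_ne hne₂] at heq
        exact h.own_inj j₁ h₁ j₂ h₂ heq hne
    · have : ∑ j' ∈ Finset.range L, lam' (own j') <
          ∑ j' ∈ Finset.range L, lam' (Function.update own j (i + 1) j') :=
        Finset.sum_lt_sum (fun j' _ => hprice j') ⟨j, Finset.mem_range.2 hj, by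
          rw [Function.update_self]; exact hlt⟩
      simp only [auctionPotential]
      omega
  · refine ⟨⟨?_, h.own_le, h.own_adj, h.own_inj, fun i' hi' j hj ha => ?_⟩, Or.inr ?_⟩
    · rw [Function.update_of_ne (Nat.succ_ne_zero i).symm, h.lam_zero]
    · rw [update_bid_own hfree hj]
      rcases eq_or_ne i' i with rfl | hne
      · rw [Function.update_self]
        exact Nat.succ_le_succ (hle j hj ha)
      · rw [Function.update_of_ne (by omega)]
        exact h.lam_le i' hi' j hj ha
    · have h1 : ∑ i' ∈ Finset.range N, lam (i' + 1) <
          ∑ i' ∈ Finset.range N, Function.update lam (i + 1) (lam (i + 1) + 1) (i' + 1) := by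
        refine Finset.sum_lt_sum (fun i' _ => ?_) ⟨i, Finset.mem_range.2 hi, by simp⟩
        rcases eq_or_ne i' i with rfl | hne
        · rw [Function.update_self]; omega
        · rw [Function.update_of_ne (by omega)]
      have h2 : ∑ j ∈ Finset.range L, Function.update lam (i + 1) (lam (i + 1) + 1) (own' j) =
          ∑ j ∈ Finset.range L, lam (own' j) :=
        Finset.sum_congr rfl fun j hj =>
          update_bid_own hfree (Finset.mem_range.1 hj) _
      simp only [auctionPotential]
      omega

open Classical in
/-- If all rows can be matched, then a free row without affordable columns has a bid below `N`. -/
theorem AuctionInv.bid_lt (h : AuctionInv N L adj own lam) (hμ : HasRowMatching N L adj) {i : ℕ}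
    (hi : i < N) (hfree : IsFreeRow L own i)
    (hle : ∀ j < L, adj i j → lam (i + 1) ≤ lam (own j)) : lam (i + 1) < N := by
  obtain ⟨μ, hμ, hinj⟩ := hμ
  -- `R k` consists of the matched rows with bid at least `k`.
  let R : ℕ → Finset ℕ := fun k =>
    (Finset.range N).filter fun i' => ¬ IsFreeRow L own i' ∧ k ≤ lam (i' + 1)
  have hiR : ∀ k, i ∉ R k := fun k hk => (Finset.mem_filter.1 hk).2.1 hfree
  -- The hypothetical matching sends `i` and the rows of `R (k + 1)` to columns of price at least `k
  -- ≥ 1`. These are owned, and their distinct owners lie in `R k`; so `R k` is strictly larger than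
  -- `R (k + 1)`.
  have hstep : ∀ k, 1 ≤ k → k ≤ lam (i + 1) → (R (k + 1)).card + 1 ≤ (R k).card := by
    intro k hk1 hk
    rw [← Finset.card_insert_of_notMem (hiR (k + 1))]
    have key : ∀ i' ∈ insert i (R (k + 1)), i' < N ∧ k ≤ lam (own (μ i')) ∧
        own (μ i') ≠ 0 := by
      intro i' hi'
      have h1 : i' < N ∧ k ≤ lam (own (μ i')) := by
        rcases Finset.mem_insert.1 hi' with rfl | hi'
        · exact ⟨hi, hk.trans (hle _ (hμ _ hi).1 (hμ _ hi).2)⟩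
        · obtain ⟨h1, -, h2⟩ := Finset.mem_filter.1 hi'
          have h3 := Finset.mem_range.1 h1
          have h4 := h.lam_le i' h3 _ (hμ _ h3).1 (hμ _ h3).2
          exact ⟨h3, by omega⟩
      refine ⟨h1.1, h1.2, fun h0 => ?_⟩
      have := h1.2
      rw [h0, h.lam_zero] at this
      omega
    refine Finset.card_le_card_of_injOn (fun i' => own (μ i') - 1) (fun i' hi' => ?_)
      fun i₁ h₁ i₂ h₂ heq => ?_
    · obtain ⟨h1, h2, h3⟩ := key i' hi'
      have h4 := h.own_le _ (hμ i' h1).1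
      have h5 : own (μ i') - 1 + 1 = own (μ i') := by omega
      have h6 : own (μ i') - 1 < N := by omega
      refine Finset.mem_coe.2 (Finset.mem_filter.2 ⟨Finset.mem_range.2 h6, fun hf =>
        hf _ (hμ i' h1).1 h5.symm, ?_⟩)
      rw [h5]
      exact h2
    · obtain ⟨h1, -, h3⟩ := key i₁ h₁
      obtain ⟨h1', -, h3'⟩ := key i₂ h₂
      have heq' : own (μ i₁) = own (μ i₂) := by
        simp only at heq
        omega
      exact hinj _ h1 _ h1' (h.own_inj _ (hμ _ h1).1 _ (hμ _ h1').1 heq' h3)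
  have hcount : ∀ q, q ≤ lam (i + 1) → q ≤ (R (lam (i + 1) + 1 - q)).card := by
    intro q
    induction q with
    | zero => intro _; exact Nat.zero_le _
    | succ q ih =>
      intro hq
      have h1 := ih (by omega)
      have h2 := hstep (lam (i + 1) - q) (by omega) (by omega)
      have h3 : lam (i + 1) - q + 1 = lam (i + 1) + 1 - q := by omega
      have h4 : lam (i + 1) + 1 - (q + 1) = lam (i + 1) - q := by omega
      rw [h3] at h2
      rw [h4]
      omega
  -- At the end of the count, `R 1` has at least `lam (i + 1)` elements, all different from `i`.
  have h1 := hcount _ le_rfl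
  have h2 : R (lam (i + 1) + 1 - lam (i + 1)) ⊆ (Finset.range N).erase i := fun i' hi' =>
    Finset.mem_erase.2 ⟨fun h0 => hiR _ (h0 ▸ hi'), (Finset.mem_filter.1 hi').1⟩
  have h3 := Finset.card_le_card h2
  rw [Finset.card_erase_of_mem (Finset.mem_range.2 hi), Finset.card_range] at h3
  omega

/-- What is known after `t` steps of the auction. -/
structure AuctionState (N L : ℕ) (adj : ℕ → ℕ → Prop) (t : ℕ) (own lam : ℕ → ℕ) : Prop where
  inv : AuctionInv N L adj own lam
  progress : (∀ i < N, ¬ IsFreeRow L own i) ∨ t ≤ auctionPotential N L own lam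
  bid_le : HasRowMatching N L adj → ∀ i < N, lam (i + 1) ≤ N

theorem auctionState_zero : AuctionState N L adj 0 (fun _ => 0) fun _ => 0 :=
  ⟨⟨rfl, fun _ _ => Nat.zero_le _, fun _ _ _ h => absurd h (Nat.succ_ne_zero _).symm,
    fun _ _ _ _ _ h => absurd rfl h, fun _ _ _ _ _ => Nat.zero_le _⟩,
    Or.inr (Nat.zero_le _), fun _ _ _ => Nat.zero_le _⟩

/-- The bound `N` on the bids survives because a bid is raised only when it is below `N`, by
`AuctionInv.bid_lt`. -/
theorem AuctionState.step {t : ℕ} (h : AuctionState N L adj t own lam)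
    (hs : AuctionStep N L adj own lam own' lam') : AuctionState N L adj (t + 1) own' lam' := by
  obtain ⟨h1, h2⟩ := h.inv.step hs
  refine ⟨h1, ?_, fun hμ i' hi' => ?_⟩
  · rcases h2 with h2 | h2
    · exact Or.inl h2
    · rcases h.progress with h3 | h3
      · rcases hs with ⟨-, rfl, rfl⟩ | ⟨i, hi, hfree, -⟩
        · exact Or.inl h3
        · exact absurd hfree (h3 i hi)
      · exact Or.inr (by omega)
  · rcases hs with ⟨-, rfl, rfl⟩ | ⟨i, hi, hfree, ⟨j, hj, -, -, rfl, rfl⟩ | ⟨hle, rfl, rfl⟩⟩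
    · exact h.bid_le hμ i' hi'
    · exact h.bid_le hμ i' hi'
    · rcases eq_or_ne i' i with rfl | hne
      · rw [Function.update_self]
        exact h.inv.bid_lt hμ hi hfree hle
      · rw [Function.update_of_ne (by omega)]
        exact h.bid_le hμ i' hi'

/-- After sufficiently many steps all rows are matched, if that is possible at all. -/
theorem AuctionState.forall_not_isFreeRow_iff
    (h : AuctionState N L adj (N * (N + L + 1)) own lam) :
    (∀ i < N, ¬ IsFreeRow L own i) ↔ HasRowMatching N L adj := by
  constructor
  · intro hno
    have : ∀ i, ∃ j, i < N → j < L ∧ own j = i + 1 := by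
      intro i
      by_cases hi : i < N
      · have := hno i hi
        simp only [IsFreeRow, not_forall, not_not] at this
        obtain ⟨j, hj, hij⟩ := this
        exact ⟨j, fun _ => ⟨hj, hij⟩⟩
      · exact ⟨0, fun h => absurd h hi⟩
    choose μ hμ using this
    refine ⟨μ, fun i hi => ⟨(hμ i hi).1, h.inv.own_adj _ (hμ i hi).1 _ (hμ i hi).2⟩,
      fun i hi i' hi' heq => ?_⟩
    have h1 := (hμ i hi).2
    rw [heq, (hμ i' hi').2] at h1
    omega
  · intro hμ
    rcases h.progress with h1 | h1
    · exact h1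
    · intro i hi
      exfalso
      have hb := h.bid_le hμ
      -- All bids and prices are at most `N`, so the potential is at most `N * N + L * N`, which is
      -- less than the number of steps because `N > 0`.
      have h2 : ∑ i ∈ Finset.range N, lam (i + 1) ≤ N * N := by
        simpa using Finset.sum_le_card_nsmul (Finset.range N) (fun i => lam (i + 1)) N
          fun i hi => hb i (Finset.mem_range.1 hi)
      have h3 : ∑ j ∈ Finset.range L, lam (own j) ≤ L * N := by
        have := Finset.sum_le_card_nsmul (Finset.range L) (fun j => lam (own j)) N fun j hj => by
          have h4 := h.inv.own_le j (Finset.mem_range.1 hj)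
          rcases h5 : own j with - | k
          · rw [h.inv.lam_zero]; exact Nat.zero_le _
          · exact hb k (by omega)
        simpa using this
      simp only [auctionPotential] at h1
      have h4 : N * (N + L + 1) = N * N + L * N + N := by ring
      omega

end Auction

/-! ### Linkings as row matchings -/

section LinkingMatching

variable {n m p : ℕ}

/-- The rows are the vertices `x_i^1` and `y_k`, the columns are `x_i^2`, `u_k` and copies of the
`x_i^1`. A vertex `x_i^1` that is not used by a linking is matched to its own copy. -/
inductive LinkingAdj (A : StructMatrix (Fin n) (Fin n)) (B : StructMatrix (Fin n) (Fin m))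
    (C : StructMatrix (Fin p) (Fin n)) : ℕ → ℕ → Prop
  | state (a b : Fin n) (hb : InputReachable A B b) (h : A a b = true) : LinkingAdj A B C a b
  | input (a : Fin n) (k : Fin m) (h : B a k = true) : LinkingAdj A B C a (n + k)
  | self (a : Fin n) : LinkingAdj A B C a (n + m + a)
  | output (k : Fin p) (a : Fin n) (h : C k a = true) : LinkingAdj A B C (n + k) (n + m + a)

variable {A : StructMatrix (Fin n) (Fin n)} {B : StructMatrix (Fin n) (Fin m)}
  {C : StructMatrix (Fin p) (Fin n)}

theorem linkingAdj_output_iff {k : Fin p} {j : ℕ} :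
    LinkingAdj A B C (n + k) j ↔ ∃ a, C k a = true ∧ j = n + m + a := by
  constructor
  · intro h
    generalize hi : n + (k : ℕ) = i at h
    cases h with
    | state a b _ _ => omega
    | input a k' _ => omega
    | self a => omega
    | output k' a h =>
      have : k' = k := Fin.ext (by omega)
      exact ⟨a, this ▸ h, rfl⟩
  · rintro ⟨a, h, rfl⟩
    exact .output k a h

theorem linkingAdj_state_iff {a : Fin n} {j : ℕ} :
    LinkingAdj A B C a j ↔ (∃ g, Matrix.fromCols (reachablePart A B) B a g = true ∧
      j = (finSumFinEquiv g : Fin (n + m))) ∨ j = n + m + a := by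
  constructor
  · intro h
    generalize hi : (a : ℕ) = i at h
    cases h with
    | state a' b hb h =>
      obtain rfl : a = a' := Fin.ext hi
      exact Or.inl ⟨Sum.inl b, (reachablePart_eq_true A B).2 ⟨hb, h⟩, by simp⟩
    | input a' k h =>
      obtain rfl : a = a' := Fin.ext hi
      exact Or.inl ⟨Sum.inr k, h, by simp⟩
    | self a' => exact Or.inr rfl
    | output k a' h => omega
  · rintro (⟨b | k, h, rfl⟩ | rfl)
    · obtain ⟨hb, h⟩ := (reachablePart_eq_true A B).1 h
      simpa using LinkingAdj.state (C := C) a b hb h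
    · simpa using LinkingAdj.input (A := A) (C := C) a k h
    · exact .self a

theorem linkingAdj_state_state_iff {a b : Fin n} :
    LinkingAdj A B C a b ↔ InputReachable A B b ∧ A a b = true := by
  rw [linkingAdj_state_iff]
  constructor
  · rintro (⟨c | k, h, hg⟩ | hg)
    · obtain rfl : b = c := Fin.ext (by simpa using hg)
      exact (reachablePart_eq_true A B).1 h
    · simp only [finSumFinEquiv_apply_right, Fin.val_natAdd] at hg
      omega
    · omega
  · exact fun h => Or.inl ⟨Sum.inl b, (reachablePart_eq_true A B).2 h, by simp⟩

theorem linkingAdj_state_input_iff {a : Fin n} {k : Fin m} :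
    LinkingAdj A B C a (n + k) ↔ B a k = true := by
  rw [linkingAdj_state_iff]
  constructor
  · rintro (⟨c | l, h, hg⟩ | hg)
    · simp only [finSumFinEquiv_apply_left, Fin.val_castAdd] at hg
      omega
    · obtain rfl : k = l := Fin.ext (by simpa using hg)
      exact h
    · omega
  · exact fun h => Or.inl ⟨Sum.inr k, h, by simp⟩

/-- The row of `y_k` must take the copy of some `x_a^1`. This bars the row of `x_a^1` from its own
copy and forces it to a source column, so the rows of the outputs trace the paths of a linking. -/
theorem hasRowMatching_linkingAdj_iff :
    HasRowMatching (n + p) (n + m + n) (LinkingAdj A B C) ↔ HasFullLinking A B C := by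
  classical
  rw [hasFullLinking_iff]
  constructor
  · rintro ⟨μ, hμ, hinj⟩
    have h1 : ∀ k : Fin p, ∃ a, C k a = true ∧ μ (n + k) = n + m + a := fun k =>
      linkingAdj_output_iff.1 (hμ (n + k) (by omega)).2
    choose f hf hfμ using h1
    have h2 : ∀ k, ∃ g, Matrix.fromCols (reachablePart A B) B (f k) g = true ∧
        μ (f k) = (finSumFinEquiv g : Fin (n + m)) := by
      intro k
      rcases linkingAdj_state_iff.1 (hμ (f k) (by omega)).2 with h | h
      · exact h
      · have := hinj (f k) (by omega) (n + k) (by omega) (by rw [h, hfμ])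
        omega
    choose g hg hgμ using h2
    have hfinj : Function.Injective f := fun k k' h => Fin.ext (by
      have := hinj (n + k) (by omega) (n + k') (by omega) (by rw [hfμ, hfμ, h])
      omega)
    exact ⟨f, g, hfinj, fun k k' h => hfinj (Fin.ext
      (hinj _ (by omega) _ (by omega) (by rw [hgμ, hgμ, h]))), hf, hg⟩
  · rintro ⟨f, g, hf, hg, hC, hg'⟩
    have key : ∀ i, ∃ j, (∀ k : Fin p, i = n + k → j = n + m + f k) ∧
        (∀ k, i = f k → j = (finSumFinEquiv (g k) : Fin (n + m))) ∧
        (i < n → (∀ k, i ≠ f k) → j = n + m + i) := by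
      intro i
      by_cases h1 : ∃ k : Fin p, i = n + k
      · obtain ⟨k, rfl⟩ := h1
        refine ⟨n + m + f k, fun k' hk' => ?_, fun k' hk' => by omega, fun h => by omega⟩
        rw [show k = k' from Fin.ext (by omega)]
      · by_cases h2 : ∃ k, i = f k
        · obtain ⟨k, rfl⟩ := h2
          refine ⟨(finSumFinEquiv (g k) : Fin (n + m)), fun k' hk' => absurd ⟨k', hk'⟩ h1,
            fun k' hk' => ?_, fun _ h => absurd rfl (h k)⟩
          rw [hf (Fin.ext hk')]
        · exact ⟨n + m + i, fun k' hk' => absurd ⟨k', hk'⟩ h1, fun k' hk' => absurd ⟨k', hk'⟩ h2,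
            fun _ _ => rfl⟩
    choose μ hμ1 hμ2 hμ3 using key
    have hcases : ∀ i < n + p, (∃ k : Fin p, i = n + k ∧ μ i = n + m + f k) ∨
        (∃ k, i = f k ∧ μ i = (finSumFinEquiv (g k) : Fin (n + m))) ∨
        (i < n ∧ (∀ k, i ≠ f k) ∧ μ i = n + m + i) := by
      intro i hi
      by_cases h1 : i < n
      · by_cases h2 : ∃ k, i = f k
        · obtain ⟨k, hk⟩ := h2
          exact Or.inr (Or.inl ⟨k, hk, hμ2 i k hk⟩)
        · push Not at h2
          exact Or.inr (Or.inr ⟨h1, h2, hμ3 i h1 h2⟩)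
      · have hk : i = n + (⟨i - n, by omega⟩ : Fin p) := by simp only; omega
        exact Or.inl ⟨_, hk, hμ1 i _ hk⟩
    refine ⟨μ, fun i hi => ?_, fun i hi i' hi' h => ?_⟩
    · rcases hcases i hi with ⟨k, rfl, h⟩ | ⟨k, rfl, h⟩ | ⟨h1, -, h⟩
      · rw [h]; exact ⟨by omega, .output k _ (hC k)⟩
      · exact ⟨by rw [h]; omega, linkingAdj_state_iff.2 (Or.inl ⟨_, hg' k, h⟩)⟩
      · rw [h]; exact ⟨by omega, .self ⟨i, h1⟩⟩
    · rcases hcases i hi with ⟨k, h1, h2⟩ | ⟨k, h1, h2⟩ | ⟨h1, h1', h2⟩ <;>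
        rcases hcases i' hi' with ⟨k', h3, h4⟩ | ⟨k', h3, h4⟩ | ⟨h3, h3', h4⟩ <;>
        rw [h2, h4] at h
      · rw [h1, h3, hf (Fin.ext (by omega) : f k = f k')]
      · omega
      · exact absurd (by omega) (h3' k)
      · omega
      · rw [h1, h3, hg (finSumFinEquiv.injective (Fin.ext h))]
      · omega
      · exact absurd (by omega) (h1' k')
      · omega
      · omega

end LinkingMatching

/-! ### The program -/

theorem encodeStruct_apply {a b : ℕ} (M : StructMatrix (Fin a) (Fin b)) (i : Fin a) (j : Fin b) :
    encodeStruct M (b * i + j) = (M i j).toNat := by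
  have h : (finProdFinEquiv (i, j) : ℕ) = b * i + j := by
    simp [add_comm]
  have hlt : b * (i : ℕ) + j < a * b := h ▸ (finProdFinEquiv (i, j)).2
  have h' : (⟨b * i + j, hlt⟩ : Fin (a * b)) = finProdFinEquiv (i, j) := Fin.ext h.symm
  rw [encodeStruct, dif_pos hlt, h', Equiv.symm_apply_apply]

theorem RamStmt.run_loop_induction {π : Fin 8 → ℕ} {v k : Fin 8} {S : RamStmt}
    (I : ℕ → (Fin 8 → ℕ) × (ℕ → ℕ → ℕ) → Prop) {x : (Fin 8 → ℕ) × (ℕ → ℕ → ℕ)} (h0 : I 0 x)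
    (hstep : ∀ i < π k, ∀ y, I i y → I (i + 1) (S.run π (Function.update y.1 v i, y.2))) :
    I (π k) ((loop v k S).run π x) := by
  have : ∀ i ≤ π k, I i (Nat.rec x (fun i y => S.run π (Function.update y.1 v i, y.2)) i) := by
    intro i
    induction i with
    | zero => intro _; exact h0
    | succ i ih => intro hi; exact hstep i hi _ (ih (by omega))
  exact this _ le_rfl

namespace RamExpr

theorem val_ite_ne_zero {π : Fin 8 → ℕ} {c e f : RamExpr} {ρ : Fin 8 → ℕ} {α : ℕ → ℕ → ℕ} :
    (ite c e f).val π ρ α ≠ 0 ↔ (c.val π ρ α ≠ 0 ∧ e.val π ρ α ≠ 0) ∨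
      (c.val π ρ α = 0 ∧ f.val π ρ α ≠ 0) := by
  rw [val]
  by_cases h : c.val π ρ α = 0 <;> simp [h]

theorem val_sum_ne_zero {π : Fin 8 → ℕ} {v k : Fin 8} {e : RamExpr} {ρ : Fin 8 → ℕ}
    {α : ℕ → ℕ → ℕ} :
    (sum v k e).val π ρ α ≠ 0 ↔ ∃ i < π k, e.val π (Function.update ρ v i) α ≠ 0 := by
  rw [val, Ne, Finset.sum_eq_zero_iff]
  simp

/-- The comparison `e = f`. -/
def eq (e f : RamExpr) : RamExpr :=
  ite (sub e f) (lit 0) (ite (sub f e) (lit 0) (lit 1))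

theorem val_eq_ne_zero {π : Fin 8 → ℕ} {e f : RamExpr} {ρ : Fin 8 → ℕ} {α : ℕ → ℕ → ℕ} :
    (eq e f).val π ρ α ≠ 0 ↔ e.val π ρ α = f.val π ρ α := by
  rw [eq, val_ite_ne_zero, val_ite_ne_zero]
  simp only [val]
  omega

end RamExpr

/-- Set the variable `r` to a value of the variable `v` below the parameter `k` at which `c` is not
zero, or to `k` if there is no such value. -/
def RamStmt.search (v k r : Fin 8) (c : RamExpr) : RamStmt :=
  .seq (.set r (.par k)) (.loop v k (.set r (.ite c (.var v) (.var r))))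

/-- The condition is evaluated while `v` and `r` vary, so its meaning must depend only on `v` and on
variables that keep their initial values. -/
theorem RamStmt.run_search {π : Fin 8 → ℕ} {v k r : Fin 8} (hvr : r ≠ v) {c : RamExpr}
    {P : ℕ → Prop} (x : (Fin 8 → ℕ) × (ℕ → ℕ → ℕ))
    (hc : ∀ i < π k, ∀ ρ : Fin 8 → ℕ, ρ v = i → (∀ w, w ≠ r → w ≠ v → ρ w = x.1 w) →
      (c.val π ρ x.2 ≠ 0 ↔ P i)) :
    ∃ ρ, (search v k r c).run π x = (ρ, x.2) ∧ (∀ w, w ≠ r → w ≠ v → ρ w = x.1 w) ∧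
      ((ρ r < π k ∧ P (ρ r)) ∨ (ρ r = π k ∧ ∀ i < π k, ¬ P i)) := by
  have key := run_loop_induction (π := π) (v := v) (k := k)
    (S := .set r (.ite c (.var v) (.var r)))
    (fun t y => y.2 = x.2 ∧ (∀ w, w ≠ r → w ≠ v → y.1 w = x.1 w) ∧
      ((y.1 r < π k ∧ P (y.1 r)) ∨ (y.1 r = π k ∧ ∀ i < t, ¬ P i)))
    (x := (Function.update x.1 r (π k), x.2))
    ⟨rfl, fun w hw _ => Function.update_of_ne hw _ _, Or.inr ⟨Function.update_self _ _ _,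
      fun i hi => absurd hi (Nat.not_lt_zero i)⟩⟩ (by
      rintro t ht y ⟨h1, h2, h3⟩
      have hρ : ∀ w, w ≠ r → w ≠ v → Function.update y.1 v t w = x.1 w := fun w hr hv => by
        rw [Function.update_of_ne hv, h2 w hr hv]
      have hct := hc t ht (Function.update y.1 v t) (Function.update_self _ _ _) hρ
      refine ⟨h1, fun w hr hv => ?_, ?_⟩
      · simp only [run]
        rw [Function.update_of_ne hr, hρ w hr hv]
      · simp only [run, RamExpr.val, Function.update_self, Function.update_of_ne hvr]
        rw [h1]
        by_cases hP : P t
        · rw [if_pos (hct.2 hP)]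
          exact Or.inl ⟨ht, hP⟩
        · rw [if_neg (fun h => hP (hct.1 h))]
          refine h3.imp_right fun h => ⟨h.1, fun i hi => ?_⟩
          rcases Nat.lt_succ_iff_lt_or_eq.1 hi with h' | rfl
          · exact h.2 i h'
          · exact hP)
  exact ⟨_, Prod.ext rfl key.1, key.2⟩

/-- The parameters of the linking program: `n`, `m`, `p`, the number `n + m` of sources, the numbers
of columns and of rows, and a bound for the number of auction steps per row. -/
def linkingParams (n m p : ℕ) : Fin 8 → ℕ :=
  ![n, m, p, n + m, n + m + n, n + p, n + p + (n + m + n) + 1, 0]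

/-- The arrays `0`, `1`, `2` hold the three matrices. -/
structure HoldsInput {n m p : ℕ} (A : StructMatrix (Fin n) (Fin n))
    (B : StructMatrix (Fin n) (Fin m)) (C : StructMatrix (Fin p) (Fin n)) (α : ℕ → ℕ → ℕ) :
    Prop where
  state : α 0 = encodeStruct A
  input : α 1 = encodeStruct B
  output : α 2 = encodeStruct C

namespace RamExpr

/-- The row `var 2` is adjacent to the column `var 4`; the input-reachable states are in the
array `3`. -/
def linkingAdj : RamExpr :=
  -- A nonzero truncated difference tests `var 2 < n`. The sums of constant terms below are
  -- products, which the machine lacks as instructions; they compute row offsets.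
  ite (sub (par 0) (var 2))
    (ite (sub (par 0) (var 4))
      (ite (arr 3 (var 4)) (arr 0 (add (sum 5 0 (var 2)) (var 4))) (lit 0))
      (ite (sub (par 3) (var 4))
        (arr 1 (add (sum 5 1 (var 2)) (sub (var 4) (par 0))))
        (eq (sub (var 4) (par 3)) (var 2))))
    (ite (sub (par 3) (var 4)) (lit 0)
      (arr 2 (add (sum 5 0 (sub (var 2) (par 0))) (sub (var 4) (par 3)))))

/-- The row `var 4` is free. -/
def isFreeRow : RamExpr :=
  ite (sum 6 4 (eq (arr 4 (var 6)) (add (var 4) (lit 1)))) (lit 0) (lit 1)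

/-- The row `var 2` can afford the column `var 4`. -/
def canAfford : RamExpr :=
  ite linkingAdj (sub (arr 5 (add (var 2) (lit 1))) (arr 5 (arr 4 (var 4)))) (lit 0)

/-- The state `var 1` is known to be input-reachable, or is a successor of an input or of a state
that is known to be input-reachable. -/
def reachStep : RamExpr :=
  ite (arr 3 (var 1)) (lit 1)
    (ite (sum 4 1 (arr 1 (add (sum 5 1 (var 1)) (var 4)))) (lit 1)
      (sum 4 0 (ite (arr 3 (var 4)) (arr 0 (add (sum 5 0 (var 1)) (var 4))) (lit 0))))

end RamExpr

/-! ### Correctness of the reachability search and of the matching program -/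

section

variable {n m p : ℕ} {A : StructMatrix (Fin n) (Fin n)} {B : StructMatrix (Fin n) (Fin m)}
  {C : StructMatrix (Fin p) (Fin n)} {α : ℕ → ℕ → ℕ} {ρ : Fin 8 → ℕ}

theorem HoldsInput.state_ne_zero (h : HoldsInput A B C α) (a b : Fin n) :
    α 0 (n * a + b) ≠ 0 ↔ A a b = true := by
  rw [h.state, encodeStruct_apply]; simp

theorem HoldsInput.input_ne_zero (h : HoldsInput A B C α) (a : Fin n) (k : Fin m) :
    α 1 (m * a + k) ≠ 0 ↔ B a k = true := by
  rw [h.input, encodeStruct_apply]; simp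

theorem HoldsInput.output_ne_zero (h : HoldsInput A B C α) (k : Fin p) (a : Fin n) :
    α 2 (n * k + a) ≠ 0 ↔ C k a = true := by
  rw [h.output, encodeStruct_apply]; simp

theorem RamExpr.linkingAdj_ne_zero (h : HoldsInput A B C α)
    (hR : ∀ b : Fin n, α 3 b ≠ 0 ↔ InputReachable A B b) (h2 : ρ 2 < n + p)
    (h4 : ρ 4 < n + m + n) :
    linkingAdj.val (linkingParams n m p) ρ α ≠ 0 ↔ LinkingAdj A B C (ρ 2) (ρ 4) := by
  have e1 : (sum 5 0 (var 2)).val (linkingParams n m p) ρ α = n * ρ 2 := by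
    simp [val, linkingParams]
  have e2 : (sum 5 1 (var 2)).val (linkingParams n m p) ρ α = m * ρ 2 := by
    simp [val, linkingParams]
  have e3 : (sum 5 0 (sub (var 2) (par 0))).val (linkingParams n m p) ρ α = n * (ρ 2 - n) := by
    simp [val, linkingParams]
  have p0 : linkingParams n m p 0 = n := rfl
  have p3 : linkingParams n m p 3 = n + m := rfl
  simp only [linkingAdj, val_ite_ne_zero, val_eq_ne_zero]
  simp only [val] at e1 e2 e3 ⊢
  rw [e1, e2, e3, p0, p3]
  clear e1 e2 e3
  by_cases hi : ρ 2 < n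
  · obtain ⟨a, ha⟩ : ∃ a : Fin n, ρ 2 = a := ⟨⟨_, hi⟩, rfl⟩
    have h0 : n - (a : ℕ) ≠ 0 := by omega
    rw [ha]
    by_cases hv : ρ 4 < n
    · obtain ⟨b, hb⟩ : ∃ b : Fin n, ρ 4 = b := ⟨⟨_, hv⟩, rfl⟩
      have h1 : n - (b : ℕ) ≠ 0 := by omega
      rw [hb, h.state_ne_zero, hR, linkingAdj_state_state_iff]
      tauto
    · have h1 : n - ρ 4 = 0 := by omega
      by_cases hv' : ρ 4 < n + m
      · obtain ⟨k, hk⟩ : ∃ k : Fin m, ρ 4 = n + k := ⟨⟨ρ 4 - n, by omega⟩, by simp only; omega⟩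
        have e : n + (k : ℕ) - n = k := by omega
        have h5 : n + m - (n + k) ≠ 0 := by omega
        rw [hk] at h1
        rw [hk, e, h.input_ne_zero, linkingAdj_state_input_iff]
        tauto
      · have h5 : n + m - ρ 4 = 0 := by omega
        have h6 : LinkingAdj A B C a (ρ 4) ↔ ρ 4 - (n + m) = a := by
          rw [linkingAdj_state_iff]
          constructor
          · rintro (⟨g, -, hg⟩ | hg) <;> omega
          · intro hg
            right
            omega
        rw [h6]
        tauto
  · obtain ⟨k, hk⟩ : ∃ k : Fin p, ρ 2 = n + k := ⟨⟨ρ 2 - n, by omega⟩, by simp only; omega⟩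
    have e : n + (k : ℕ) - n = k := by omega
    have h0 : n - (n + (k : ℕ)) = 0 := by omega
    rw [hk, linkingAdj_output_iff, e]
    by_cases hv : ρ 4 < n + m
    · have h1 : n + m - ρ 4 ≠ 0 := by omega
      constructor
      · tauto
      · rintro ⟨a, -, ha⟩
        omega
    · obtain ⟨a, ha⟩ : ∃ a : Fin n, ρ 4 = n + m + a :=
        ⟨⟨ρ 4 - (n + m), by omega⟩, by simp only; omega⟩
      have e' : n + m + (a : ℕ) - (n + m) = a := by omega
      have h1 : n + m - (n + m + (a : ℕ)) = 0 := by omega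
      have h6 : (∃ b, C k b = true ∧ n + m + (a : ℕ) = n + m + b) ↔ C k a = true :=
        ⟨fun ⟨b, hb, hab⟩ => (Fin.ext (by omega) : b = a) ▸ hb, fun hC => ⟨a, hC, rfl⟩⟩
      rw [ha, e', h.output_ne_zero, h6]
      tauto

theorem RamExpr.isFreeRow_ne_zero :
    isFreeRow.val (linkingParams n m p) ρ α ≠ 0 ↔ IsFreeRow (n + m + n) (α 4) (ρ 4) := by
  have p4 : linkingParams n m p 4 = n + m + n := rfl
  rw [isFreeRow, val_ite_ne_zero]
  have : (sum 6 4 (eq (arr 4 (var 6)) (add (var 4) (lit 1)))).val (linkingParams n m p) ρ α ≠ 0 ↔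
      ¬ IsFreeRow (n + m + n) (α 4) (ρ 4) := by
    rw [val_sum_ne_zero, p4]
    simp only [val_eq_ne_zero]
    simp [val, IsFreeRow]
  simp only [val]
  tauto

theorem RamExpr.canAfford_ne_zero (h : HoldsInput A B C α)
    (hR : ∀ b : Fin n, α 3 b ≠ 0 ↔ InputReachable A B b) (h2 : ρ 2 < n + p)
    (h4 : ρ 4 < n + m + n) :
    canAfford.val (linkingParams n m p) ρ α ≠ 0 ↔
      LinkingAdj A B C (ρ 2) (ρ 4) ∧ α 5 (α 4 (ρ 4)) < α 5 (ρ 2 + 1) := by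
  rw [canAfford, val_ite_ne_zero, linkingAdj_ne_zero h hR h2 h4]
  simp only [val, Nat.sub_ne_zero_iff_lt, ne_eq, not_true_eq_false, and_false, or_false]

theorem RamExpr.reachStep_ne_zero (h : HoldsInput A B C α) {a : Fin n} (h1 : ρ 1 = a) :
    reachStep.val (linkingParams n m p) ρ α ≠ 0 ↔ α 3 a ≠ 0 ∨ (∃ k, B a k = true) ∨
      ∃ b : Fin n, α 3 b ≠ 0 ∧ A a b = true := by
  have p0 : linkingParams n m p 0 = n := rfl
  have p1 : linkingParams n m p 1 = m := rfl
  have e0 : ∀ v, (sum 5 0 (var 1)).val (linkingParams n m p) (Function.update ρ 4 v) α = n * a := by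
    intro v
    simp [val, p0, h1]
  have e1 : ∀ v, (sum 5 1 (var 1)).val (linkingParams n m p) (Function.update ρ 4 v) α = m * a := by
    intro v
    simp [val, p1, h1]
  have hB : (∃ k < m, (arr 1 (add (sum 5 1 (var 1)) (var 4))).val (linkingParams n m p)
      (Function.update ρ 4 k) α ≠ 0) ↔ ∃ k, B a k = true := by
    constructor
    · rintro ⟨k, hk, hB⟩
      rw [val, val, e1, val, Function.update_self] at hB
      exact ⟨⟨k, hk⟩, (h.input_ne_zero a ⟨k, hk⟩).1 hB⟩
    · rintro ⟨k, hk⟩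
      refine ⟨k, k.2, ?_⟩
      rw [val, val, e1, val, Function.update_self, h.input_ne_zero]
      exact hk
  have hA : (∃ b < n, (ite (arr 3 (var 4)) (arr 0 (add (sum 5 0 (var 1)) (var 4))) (lit 0)).val
      (linkingParams n m p) (Function.update ρ 4 b) α ≠ 0) ↔
      ∃ b : Fin n, α 3 b ≠ 0 ∧ A a b = true := by
    have : ∀ b : Fin n, (ite (arr 3 (var 4)) (arr 0 (add (sum 5 0 (var 1)) (var 4))) (lit 0)).val
        (linkingParams n m p) (Function.update ρ 4 b) α ≠ 0 ↔ α 3 b ≠ 0 ∧ A a b = true := by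
      intro b
      rw [val_ite_ne_zero, val, val, val, val, val, e0, val, Function.update_self,
        h.state_ne_zero]
      tauto
    exact ⟨fun ⟨b, hb, h0⟩ => ⟨⟨b, hb⟩, (this ⟨b, hb⟩).1 h0⟩, fun ⟨b, h0⟩ =>
      ⟨b, b.2, (this b).2 h0⟩⟩
  have hB' : (sum 4 1 (arr 1 (add (sum 5 1 (var 1)) (var 4)))).val (linkingParams n m p) ρ α ≠ 0 ↔
      ∃ k, B a k = true := val_sum_ne_zero.trans hB
  have hA' : (sum 4 0 (ite (arr 3 (var 4)) (arr 0 (add (sum 5 0 (var 1)) (var 4))) (lit 0))).val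
      (linkingParams n m p) ρ α ≠ 0 ↔ ∃ b : Fin n, α 3 b ≠ 0 ∧ A a b = true :=
    val_sum_ne_zero.trans hA
  have h3 : (arr 3 (var 1)).val (linkingParams n m p) ρ α = α 3 a := by rw [val, val, h1]
  have h4 : (lit 1).val (linkingParams n m p) ρ α ≠ 0 := by rw [val]; exact Nat.one_ne_zero
  rw [reachStep, val_ite_ne_zero, val_ite_ne_zero, hA', h3]
  by_cases h5 : α 3 a = 0
  · by_cases h6 : (sum 4 1 (arr 1 (add (sum 5 1 (var 1)) (var 4)))).val (linkingParams n m p) ρ α = 0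
    · have h7 : ¬ ∃ k, B a k = true := fun h7 => hB'.2 h7 h6
      simp [h5, h6, h7]
    · simp [h5, h6, h4, hB'.1 h6]
  · simp [h5, h4]

/-- Successors of inputs and of the states in `R`. -/
def IsReachStep (A : StructMatrix (Fin n) (Fin n)) (B : StructMatrix (Fin n) (Fin m)) (R : ℕ → ℕ)
    (a : Fin n) : Prop :=
  (∃ k, B a k = true) ∨ ∃ b : Fin n, R b ≠ 0 ∧ A a b = true

theorem IsReachStep.inputReachable {R : ℕ → ℕ} (hR : ∀ b : Fin n, R b ≠ 0 → InputReachable A B b)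
    {a : Fin n} (h : IsReachStep A B R a) : InputReachable A B a := by
  rcases h with ⟨k, h⟩ | ⟨b, hb, h⟩
  · exact inputReachable_of_input h
  · exact inputReachable_of_edge (hR b hb) h

theorem InputReachable.ne_zero_of_closed {R : ℕ → ℕ} (hR : ∀ a, IsReachStep A B R a → R a ≠ 0)
    {a : Fin n} (h : InputReachable A B a) : R a ≠ 0 := by
  obtain ⟨k, h⟩ := h
  have key : ∀ v, Relation.ReflTransGen (systemDigraph A B).Adj (Sum.inr k) v →
      ∀ a, v = Sum.inl a → R a ≠ 0 := by
    intro v hv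
    induction hv with
    | refl => intro a ha; cases ha
    | tail _ hbc ih =>
      rename_i b c _
      rintro a rfl
      rcases b with b | k'
      · exact hR a (Or.inr ⟨b, ih b rfl, hbc⟩)
      · exact hR a (Or.inl ⟨k', hbc⟩)
  exact key _ h a rfl

/-- What is known of the array `3` after `t` rounds of the search for input-reachable states. -/
structure ReachState (A : StructMatrix (Fin n) (Fin n)) (B : StructMatrix (Fin n) (Fin m)) (t : ℕ)
    (R : ℕ → ℕ) : Prop where
  sound : ∀ b : Fin n, R b ≠ 0 → InputReachable A B b
  progress : (∀ a, IsReachStep A B R a → R a ≠ 0) ∨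
    t ≤ (Finset.univ.filter fun a : Fin n => R a ≠ 0).card

/-- If a round marks nothing new, the marked set is closed under successors. Otherwise its
cardinality grows, so `n` rounds suffice. -/
theorem ReachState.step {t : ℕ} {R R' : ℕ → ℕ} (h : ReachState A B t R)
    (hs : ∀ b : Fin n, R' b ≠ 0 → InputReachable A B b) (hle : ∀ b : Fin n, R b ≠ 0 → R' b ≠ 0)
    (hstep : ∀ a, IsReachStep A B R a → R' a ≠ 0) : ReachState A B (t + 1) R' := by
  refine ⟨hs, ?_⟩
  by_cases hle' : ∀ b : Fin n, R' b ≠ 0 → R b ≠ 0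
  · exact Or.inl fun a ha => hstep a (ha.imp_right fun ⟨b, hb, hab⟩ => ⟨b, hle' b hb, hab⟩)
  · push Not at hle'
    obtain ⟨b, hb, hb'⟩ := hle'
    rcases h.progress with h1 | h1
    · have h2 := (hs b hb).ne_zero_of_closed h1
      exact absurd hb' h2
    · refine Or.inr (Nat.succ_le_of_lt (lt_of_le_of_lt h1 (Finset.card_lt_card ?_)))
      refine Finset.ssubset_iff_subset_ne.2 ⟨fun a ha => ?_, fun heq => ?_⟩
      · simp only [Finset.mem_filter, Finset.mem_univ, true_and] at ha ⊢
        exact hle a ha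
      · have : b ∈ Finset.univ.filter fun a : Fin n => R' a ≠ 0 := by simpa using hb
        rw [← heq] at this
        simp [hb'] at this

theorem ReachState.ne_zero_iff {R : ℕ → ℕ} (h : ReachState A B n R) (b : Fin n) :
    R b ≠ 0 ↔ InputReachable A B b := by
  refine ⟨h.sound b, fun hb => ?_⟩
  rcases h.progress with h1 | h1
  · exact hb.ne_zero_of_closed h1
  · have : (Finset.univ.filter fun a : Fin n => R a ≠ 0) = Finset.univ :=
      Finset.eq_univ_of_card _ (le_antisymm (Finset.card_le_univ _) (by simpa using h1))
    simpa using Finset.ext_iff.1 this b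

namespace RamStmt

/-- Compute the input-reachable states in the array `3`. -/
def reach : RamStmt :=
  .loop 0 0 (.loop 1 0 (.store 3 (.var 1) .reachStep))

/-- One step of the auction, with the owners in the array `4` and the bids in the array `5`. -/
def auctionStep : RamStmt :=
  .seq (search 4 5 2 .isFreeRow) <|
    .ite (.sub (.par 5) (.var 2))
      (.seq (search 4 4 3 .canAfford) <|
        .ite (.sub (.par 4) (.var 3))
          (.store 4 (.var 3) (.add (.var 2) (.lit 1)))
          (.store 5 (.add (.var 2) (.lit 1)) (.add (.arr 5 (.add (.var 2) (.lit 1))) (.lit 1))))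
      -- This assignment does nothing; it is the step without free rows.
      (.set 2 (.var 2))

/-- The search for a row matching. -/
def linking : RamStmt :=
  -- With `N = n + p` rows and `L = n + m + n` columns, the nested loops make `N * (N + L + 1)`
  -- auction steps.
  .seq reach (.loop 0 5 (.loop 1 6 auctionStep))

theorem run_reach (ρ : Fin 8 → ℕ) (h : HoldsInput A B C α) (h3 : α 3 = fun _ => 0) :
    let y := reach.run (linkingParams n m p) (ρ, α)
    HoldsInput A B C y.2 ∧ y.2 4 = α 4 ∧ y.2 5 = α 5 ∧
      ∀ b : Fin n, y.2 3 b ≠ 0 ↔ InputReachable A B b := by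
  have key := run_loop_induction (π := linkingParams n m p) (v := 0) (k := 0)
    (S := .loop 1 0 (.store 3 (.var 1) .reachStep))
    (fun t y => HoldsInput A B C y.2 ∧ y.2 4 = α 4 ∧ y.2 5 = α 5 ∧ ReachState A B t (y.2 3))
    (x := (ρ, α)) ⟨h, rfl, rfl, ⟨fun b hb => absurd (congrFun h3 b) hb, Or.inr (Nat.zero_le _)⟩⟩ (by
      rintro t - ⟨ρ₀, α₀⟩ ⟨h1, h4, h5, hR⟩
      have inner := run_loop_induction (π := linkingParams n m p) (v := 1) (k := 0)
        (S := .store 3 (.var 1) .reachStep)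
        -- Marks are updated in place, so a state may already use marks of the current round. Hence
        -- the invariant compares with the array `α₀` at the start of the round and records that
        -- marks are never lost.
        (fun i y => HoldsInput A B C y.2 ∧ y.2 4 = α 4 ∧ y.2 5 = α 5 ∧
          (∀ b : Fin n, y.2 3 b ≠ 0 → InputReachable A B b) ∧
          (∀ b : Fin n, α₀ 3 b ≠ 0 → y.2 3 b ≠ 0) ∧
          ∀ a : Fin n, (a : ℕ) < i → IsReachStep A B (α₀ 3) a → y.2 3 a ≠ 0)
        (x := (Function.update ρ₀ 0 t, α₀))
        ⟨h1, h4, h5, hR.sound, fun _ h => h, fun _ h => absurd h (Nat.not_lt_zero _)⟩ (by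
          rintro i hi ⟨ρ₁, α₁⟩ ⟨g1, g4, g5, gs, gle, gstep⟩
          have hi' : i < n := hi
          have hv := RamExpr.reachStep_ne_zero (ρ := Function.update ρ₁ 1 i) (a := ⟨i, hi'⟩) g1
            (Function.update_self _ _ _)
          simp only [run, RamExpr.val, Function.update_self]
          generalize hval : RamExpr.reachStep.val (linkingParams n m p) (Function.update ρ₁ 1 i) α₁
            = r at hv
          have hne : ∀ b : Fin n, Function.update (α₁ 3) i r b ≠ 0 ↔
              α₁ 3 b ≠ 0 ∨ ((b : ℕ) = i ∧ IsReachStep A B (α₁ 3) b) := by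
            intro b
            by_cases hb : (b : ℕ) = i
            · obtain rfl : b = ⟨i, hi'⟩ := Fin.ext hb
              rw [Function.update_self, hv, IsReachStep]
              simp
            · rw [Function.update_of_ne hb]
              tauto
          refine ⟨⟨?_, ?_, ?_⟩, ?_, ?_, fun b hb => ?_, fun b hb => ?_, fun a ha hs => ?_⟩
          · exact (Function.update_of_ne (by norm_num) _ _).trans g1.state
          · exact (Function.update_of_ne (by norm_num) _ _).trans g1.input
          · exact (Function.update_of_ne (by norm_num) _ _).trans g1.output
          · exact (Function.update_of_ne (by norm_num) _ _).trans g4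
          · exact (Function.update_of_ne (by norm_num) _ _).trans g5
          · rcases (hne b).1 hb with hb | ⟨-, hb⟩
            · exact gs b hb
            · exact hb.inputReachable gs
          · exact (hne b).2 (Or.inl (gle b hb))
          · refine (hne a).2 ?_
            rcases Nat.lt_succ_iff_lt_or_eq.1 ha with ha | ha
            · exact Or.inl (gstep a ha hs)
            · exact Or.inr ⟨ha, hs.imp_right fun ⟨b, hb, hab⟩ => ⟨b, gle b hb, hab⟩⟩)
      obtain ⟨g1, g4, g5, gs, gle, gstep⟩ := inner
      exact ⟨g1, g4, g5, hR.step gs gle fun a ha => gstep a a.2 ha⟩)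
  obtain ⟨g1, g4, g5, g3⟩ := key
  exact ⟨g1, g4, g5, g3.ne_zero_iff⟩

theorem run_ite_of_ne_zero {π : Fin 8 → ℕ} {c : RamExpr} {S T : RamStmt}
    {x : (Fin 8 → ℕ) × (ℕ → ℕ → ℕ)} (h : c.val π x.1 x.2 ≠ 0) :
    (ite c S T).run π x = S.run π x :=
  if_pos h

theorem run_ite_of_eq_zero {π : Fin 8 → ℕ} {c : RamExpr} {S T : RamStmt}
    {x : (Fin 8 → ℕ) × (ℕ → ℕ → ℕ)} (h : c.val π x.1 x.2 = 0) :
    (ite c S T).run π x = T.run π x :=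
  if_neg (not_not.2 h)

theorem run_auctionStep (ρ : Fin 8 → ℕ) (h : HoldsInput A B C α)
    (hR : ∀ b : Fin n, α 3 b ≠ 0 ↔ InputReachable A B b) :
    let y := auctionStep.run (linkingParams n m p) (ρ, α)
    HoldsInput A B C y.2 ∧ y.2 3 = α 3 ∧
      AuctionStep (n + p) (n + m + n) (LinkingAdj A B C) (α 4) (α 5) (y.2 4) (y.2 5) := by
  have p4 : linkingParams n m p 4 = n + m + n := rfl
  have p5 : linkingParams n m p 5 = n + p := rfl
  obtain ⟨ρ₁, h1, -, h3⟩ := run_search (π := linkingParams n m p) (v := 4) (k := 5) (r := 2)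
    (c := .isFreeRow) (P := IsFreeRow (n + m + n) (α 4)) (by decide) (ρ, α)
    fun i _ ρ' hi _ => by rw [RamExpr.isFreeRow_ne_zero, hi]
  rw [p5] at h3
  simp only [auctionStep]
  rw [run, h1]
  rcases h3 with ⟨hlt, hfree⟩ | ⟨heq, hno⟩
  · rw [run_ite_of_ne_zero (by simp only [RamExpr.val, p5]; omega), run]
    obtain ⟨ρ₂, g1, g2, g3⟩ := run_search (π := linkingParams n m p) (v := 4) (k := 4) (r := 3)
      (c := .canAfford) (P := fun j => LinkingAdj A B C (ρ₁ 2) j ∧ α 5 (α 4 j) < α 5 (ρ₁ 2 + 1))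
      (by decide) (ρ₁, α) fun j hj ρ' hj' hρ' => by
        have h2 : ρ' 2 = ρ₁ 2 := hρ' 2 (by decide) (by decide)
        rw [RamExpr.canAfford_ne_zero h hR (by rw [h2]; exact hlt) (by rw [hj']; exact hj), h2, hj']
    have h2 : ρ₂ 2 = ρ₁ 2 := g2 2 (by decide) (by decide)
    rw [p4] at g3
    rw [g1]
    rcases g3 with ⟨jlt, hadj, hprice⟩ | ⟨jeq, jno⟩
    · rw [run_ite_of_ne_zero (by simp only [RamExpr.val, p4]; omega), run]
      simp only [RamExpr.val]
      refine ⟨⟨h.state, h.input, h.output⟩, rfl, Or.inr ⟨ρ₁ 2, hlt, hfree, Or.inl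
        ⟨ρ₂ 3, jlt, hadj, hprice, ?_, rfl⟩⟩⟩
      rw [Function.update_self, h2]
    · rw [run_ite_of_eq_zero (by simp only [RamExpr.val, p4]; omega), run]
      simp only [RamExpr.val]
      refine ⟨⟨h.state, h.input, h.output⟩, rfl, Or.inr ⟨ρ₁ 2, hlt, hfree, Or.inr
        ⟨fun j hj ha => not_lt.1 fun hl => jno j hj ⟨ha, hl⟩, rfl, ?_⟩⟩⟩
      rw [Function.update_self, h2]
  · rw [run_ite_of_eq_zero (by simp only [RamExpr.val, p5]; omega), run]
    exact ⟨h, rfl, Or.inl ⟨hno, rfl, rfl⟩⟩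

theorem run_linking (ρ : Fin 8 → ℕ) (h : HoldsInput A B C α) (h3 : α 3 = fun _ => 0)
    (h4 : α 4 = fun _ => 0) (h5 : α 5 = fun _ => 0) :
    (∀ i < n + p, ¬ IsFreeRow (n + m + n) ((linking.run (linkingParams n m p) (ρ, α)).2 4) i) ↔
      HasFullLinking A B C := by
  obtain ⟨g, g4, g5, gR⟩ := run_reach ρ h h3
  rw [← hasRowMatching_linkingAdj_iff]
  have key := run_loop_induction (π := linkingParams n m p) (v := 0) (k := 5)
    (S := .loop 1 6 auctionStep)
    (fun t y => HoldsInput A B C y.2 ∧ (∀ b : Fin n, y.2 3 b ≠ 0 ↔ InputReachable A B b) ∧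
      AuctionState (n + p) (n + m + n) (LinkingAdj A B C) (t * (n + p + (n + m + n) + 1))
        (y.2 4) (y.2 5))
    (x := reach.run (linkingParams n m p) (ρ, α))
    ⟨g, gR, by rw [g4, g5, h4, h5, Nat.zero_mul]; exact auctionState_zero⟩ (by
      rintro t - ⟨ρ₀, α₀⟩ ⟨i1, iR, iA⟩
      have inner := run_loop_induction (π := linkingParams n m p) (v := 1) (k := 6)
        (S := auctionStep)
        (fun t' y => HoldsInput A B C y.2 ∧ (∀ b : Fin n, y.2 3 b ≠ 0 ↔ InputReachable A B b) ∧
          AuctionState (n + p) (n + m + n) (LinkingAdj A B C)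
            (t * (n + p + (n + m + n) + 1) + t') (y.2 4) (y.2 5))
        (x := (Function.update ρ₀ 0 t, α₀)) ⟨i1, iR, iA⟩ (by
          rintro t' - ⟨ρ₁, α₁⟩ ⟨j1, jR, jA⟩
          obtain ⟨k1, kR, kA⟩ := run_auctionStep (Function.update ρ₁ 1 t') j1 jR
          exact ⟨k1, fun b => by rw [kR]; exact jR b, jA.step kA⟩)
      rw [Nat.succ_mul]
      exact inner)
  exact key.2.2.forall_not_isFreeRow_iff

end RamStmt

/-- The sum is zero exactly when no row is free, and truncated subtraction from one turns this into
the answer. -/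
theorem RamExpr.val_answer :
    (sub (lit 1) (sum 4 5 isFreeRow)).val (linkingParams n m p) ρ α = 1 ∧
        (∀ i < n + p, ¬ IsFreeRow (n + m + n) (α 4) i) ∨
      (sub (lit 1) (sum 4 5 isFreeRow)).val (linkingParams n m p) ρ α = 0 ∧
        ¬ ∀ i < n + p, ¬ IsFreeRow (n + m + n) (α 4) i := by
  have h : (sum 4 5 isFreeRow).val (linkingParams n m p) ρ α ≠ 0 ↔
      ∃ i < n + p, IsFreeRow (n + m + n) (α 4) i := by
    rw [val_sum_ne_zero]
    simp only [isFreeRow_ne_zero, Function.update_self]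
    rfl
  rw [val, val]
  by_cases h0 : (sum 4 5 isFreeRow).val (linkingParams n m p) ρ α = 0
  · rw [h0]
    exact Or.inl ⟨rfl, fun i hi hf => h.2 ⟨i, hi, hf⟩ h0⟩
  · obtain ⟨i, hi, hf⟩ := h.1 h0
    exact Or.inr ⟨by omega, fun hall => hall i hi hf⟩

end

theorem decidableInPolyTime_hasFullLinking : DecidableInPolyTime HasFullLinking := by
  let e : RamExpr := .sub (.lit 1) (.sum 4 5 .isFreeRow)
  refine ⟨.seq (.plus 3 0 1) <| .seq (.plus 4 3 0) <| .seq (.plus 5 0 2) <| .seq (.const 16 1) <|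
      .seq (.plus 6 5 4) <| .seq (.plus 6 6 16) <| .seq (RamStmt.linking.compile 16) <|
      .seq (e.compile 16) (.copy 0 16),
    -- The summand `7` counts the six instructions that set up the parameters and the final copy; `5
    -- * X + 1` bounds every parameter in terms of `n + m + p`.
    (RamStmt.linking.cost + e.cost + 7).comp (5 * Polynomial.X + 1), fun n m p A B C => ?_⟩
  have hM : ∀ k, linkingParams n m p k ≤ 5 * (n + m + p) + 1 := by
    intro k
    fin_cases k <;> simp [linkingParams] <;> omega
  let s₀ : RamState := ((((((ramInput A B C).setReg 3 (n + m)).setReg 4 (n + m + n)).setReg 5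
    (n + p)).setReg 16 1).setReg 6 (n + p + (n + m + n))).setReg 6 (n + p + (n + m + n) + 1)
  have hs₀ : Represents (linkingParams n m p) (fun _ => 0) (ramInput A B C).arr s₀ := by
    refine ⟨fun k => ?_, fun v => ?_, rfl⟩
    · fin_cases k <;> rfl
    · fin_cases v <;> rfl
  obtain ⟨s₁, r₁, hs₁, -⟩ := RamStmt.linking.runsWithin_compile hM
    (fun _ => 0, (ramInput A B C).arr) 16 s₀ le_rfl hs₀
  obtain ⟨s₂, r₂, -, -, hv⟩ := e.runsWithin_compile hM _ _ 16 s₁ le_rfl hs₁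
  have hrun : RunsWithin (.seq (.plus 3 0 1) <| .seq (.plus 4 3 0) <| .seq (.plus 5 0 2) <|
      .seq (.const 16 1) <| .seq (.plus 6 5 4) <| .seq (.plus 6 6 16) <|
      .seq (RamStmt.linking.compile 16) <| .seq (e.compile 16) (.copy 0 16)) (ramInput A B C) _
      (s₂.setReg 0 (s₂.reg 16)) :=
    (RamRuns.plus _ 3 0 1).within.seq <| (RamRuns.plus _ 4 3 0).within.seq <|
      (RamRuns.plus _ 5 0 2).within.seq <| (RamRuns.const _ 16 1).within.seq <|
      (RamRuns.plus _ 6 5 4).within.seq <| (RamRuns.plus _ 6 6 16).within.seq <|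
      r₁.seq <| r₂.seq (RamRuns.copy _ 0 16).within
  obtain ⟨t, ht, hr⟩ := hrun
  refine ⟨t, _, hr, ht.trans ?_, ?_⟩
  · simp only [Polynomial.eval_comp, Polynomial.eval_add, Polynomial.eval_mul, Polynomial.eval_X,
      Polynomial.eval_ofNat, Polynomial.eval_one]
    omega
  · beta_reduce
    rw [RamState.reg_setReg_self, hv, ← RamStmt.run_linking (fun _ => 0)
      (α := (ramInput A B C).arr) ⟨rfl, rfl, rfl⟩ rfl rfl rfl]
    exact RamExpr.val_answer.imp And.symm And.symm

theorem mainTheorem4 :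
    (∀ (n : ℕ) (A : StructMatrix (Fin n) (Fin n)), GenericallyDiagonalizable A →
      (∀ (m : ℕ) (B : StructMatrix (Fin n) (Fin m)),
        StructMatrix.grank (Matrix.fromCols (reachablePart A B) B) = grankCtrb A B) ∧
      (∀ (m p : ℕ) (B : StructMatrix (Fin n) (Fin m)) (C : StructMatrix (Fin p) (Fin n)),
        StructurallyOutputControllable A B C ↔ HasFullLinking A B C)) ∧
    DecidableInPolyTime HasFullLinking := by
  refine ⟨fun n A hA => ⟨fun m B => grank_fromCols_eq_grankCtrb A B hA, fun m p B C => ?_⟩,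
    decidableInPolyTime_hasFullLinking⟩
  rw [← exists_rank_output_eq_iff A B C hA]
  simp only [StructurallyOutputControllable, outputControllable_iff]
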